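/- Let $d\ge 0$, let $\mu$ be a probability distribution on $\mathbb N=\{0,1,2,\dots\}$ with mean $1$ and $\mu\neq\delta_1$, and let $\theta$ be a symmetric probability distribution on $\mathbb Z^d$ ($\theta(-x)=\theta(x)$). A *spatial tree* is a rooted plane tree (every node has finitely many, ordered, children) with a vector of $\mathbb Z^d$ attached to each edge. A *spine-indexed forest* is $\mathcal T=(T_i)_{i\in\mathbb Z}$, where the $T_i$ are spatial trees and, for $i\ge 1$, the roots of $T_i$ and $T_{-i}$ are glued into one point $(i,\varnothing)$; the points $(0,\varnothing),(1,\varnothing),(2,\varnothing),\dots$ form the *spine*, consecutive ones are joined by an edge that also carries a vector (the displacement from $(i,\varnothing)$ to $(i+1,\varnothing)$), and $(0,\varnothing)$ is the *base point*. The space of forests has the $\sigma$-algebra generated by the events that a given word is a node of a given $T_i$ and by the displacements. Under the law $\mathbf P_{\mu,\theta}$: the root of $T_0$ and every non-root node of every $T_i$ has a $\mu$-distributed number of children; for $i\ge1$ the numbers $(\gamma_i^+,\gamma_i^-)$ of children of $(i,\varnothing)$ in $T_i$ and in $T_{-i}$ satisfy $\mathbf P_{\mu,\theta}(\gamma_i^+=a,\gamma_i^-=b)=\mu(a+b+1)$;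 all edge displacements, also on the spine, have law $\theta$; and all these variables are independent, except that $\gamma_i^+$ and $\gamma_i^-$ are related as stated. The position of a vertex is the sum of the displacements along the path to it from the base point. View the forest as an infinite plane tree in which the parent of $(i,\varnothing)$ is $(i+1,\varnothing)$ and the children of $(i,\varnothing)$, $i\ge1$, are in order its children in $T_{-i}$, then $(i-1,\varnothing)$, then its children in $T_i$. Let $\dots,u_{-1},u_0=(0,\varnothing),u_1,\dots$ be the enumeration of the vertices in lexicographic order (parents before their descendants, siblings with their descendants in order), let $v_i$ be the position of $u_i$, and let $R[i,j]=\{v_i,\dots,v_j\}$. Let $\sigma$ be the map on forests that moves the base point to $u_1$, keeping the infinite plane tree and its displacements (a displacement changes sign if its edge is traversed in the opposite direction). Then $\mathbf P_{\mu,\theta}$ is a probability measure; almost surely the sequence $(u_i)_{i\in\mathbb Z}$ is well defined and lists each vertex exactly once; and almost surely, for all $i\in\mathbb Z$, $u_i(\sigma(\mathcal T))$ corresponds to $u_{i+1}(\mathcal T)$ (the correspondence preserves the parent relation) and $v_i(\sigma(\mathcal T))=v_{i+1}(\mathcal T)-v_1(\mathcal T)$. Moreover: 1. $\sigma$ is measurable,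 and $\mathbf P_{\mu,\theta}$ is invariant and ergodic under $\sigma$. 2. For all $i\in\mathbb Z$ and $n\in\mathbb N$, under $\mathbf P_{\mu,\theta}$, $$(v_i-v_i,\;v_{i+1}-v_i,\;\dots,\;v_{i+n}-v_i)\overset{d}{=}(v_0,v_1,\dots,v_n).$$ 3. For all $i\in\mathbb Z$ and $n\in\mathbb N$, under $\mathbf P_{\mu,\theta}$, $R[i,i+n]-v_i\overset{d}{=}R[0,n]$. -/

import Mathlib

open MeasureTheory ProbabilityTheory
open scoped ENNReal

noncomputable section

namespace SpineForest

/-- The lattice `ℤ^d`. -/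
abbrev Site (d : ℕ) : Type := Fin d → ℤ

/-- A spatial tree: a plane tree, given by its set of nodes (finite words; letters are counted from
`0`, so the children of `u` are `u0, u1, …, u(k-1)`), with a vector of `ℤ^d` attached to each edge;
`disp u` belongs to the edge from the parent of `u` to `u`, and is set to `0` if there is none. -/
@[ext]
structure SpatialTree (d : ℕ) where
  nodes : Set (List ℕ)
  root_mem : [] ∈ nodes
  parent_mem : ∀ u j, u ++ [j] ∈ nodes → u ∈ nodes
  exists_offspring : ∀ u ∈ nodes, ∃ k : ℕ, ∀ j, u ++ [j] ∈ nodes ↔ j < k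
  disp : List ℕ → Site d
  disp_root : disp [] = 0
  disp_of_notMem : ∀ u, u ∉ nodes → disp u = 0

namespace SpatialTree

/-- The number of offspring of the node `u`. -/
def offspring {d : ℕ} (T : SpatialTree d) (u : List ℕ) : ℕ :=
  {j : ℕ | u ++ [j] ∈ T.nodes}.ncard

lemma append_mem_iff {d : ℕ} (T : SpatialTree d) {u : List ℕ} (hu : u ∈ T.nodes) (j : ℕ) :
    u ++ [j] ∈ T.nodes ↔ j < T.offspring u := by
  obtain ⟨k, hk⟩ := T.exists_offspring u hu
  have h : {j : ℕ | u ++ [j] ∈ T.nodes} = Set.Iio k := by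
    ext j; simp [hk]
  rw [hk, offspring, h, ← Nat.card_coe_set_eq]
  simp

/-- The spatial tree generated by offspring numbers `c` and displacements `x`: a word is a node
if each of its letters `j`, read after the prefix `p`, satisfies `j < c p`. -/
def grow {d : ℕ} (c : List ℕ → ℕ) (x : List ℕ → Site d) : SpatialTree d where
  nodes := {u | ∀ p j, p ++ [j] <+: u → j < c p}
  root_mem := by intro p j h; simp at h
  parent_mem := by
    intro u j h p i hp
    exact h p i (hp.trans (List.prefix_append _ _))
  exists_offspring := by
    intro u hu
    refine ⟨c u, fun j => ⟨fun h => h u j List.prefix_rfl, fun h p i hp => ?_⟩⟩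
    rcases List.prefix_concat_iff.1 hp with h' | h'
    · obtain ⟨rfl, h''⟩ := List.append_inj' h' rfl
      obtain rfl : i = j := by simpa using h''
      exact h
    · exact hu p i h'
  disp u := by
    classical
    exact if u ≠ [] ∧ (∀ p j, p ++ [j] <+: u → j < c p) then x u else 0
  disp_root := by simp
  disp_of_notMem := by
    intro u hu
    exact if_neg fun h => hu h.2

end SpatialTree

/-- A (spatial) forest indexed by a spine: trees `T_0, T_1, T_{-1}, T_2, T_{-2}, …`, the roots of
`T_i` and `T_{-i}` being glued into one point, the `i`-th point of the spine. Consecutive points of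
the spine are joined by edges; `spine n` is the displacement from the `n`-th to the `(n+1)`-st. -/
@[ext]
structure Forest (d : ℕ) where
  tree : ℤ → SpatialTree d
  spine : ℕ → Site d

/-- The σ-algebra generated by the events `u ∈ T_i` and by all the displacements. -/
instance Forest.instMeasurableSpace (d : ℕ) : MeasurableSpace (Forest d) :=
  MeasurableSpace.comap
    (fun F : Forest d =>
      ((fun (i : ℤ) (u : List ℕ) => u ∈ (F.tree i).nodes,
        fun (i : ℤ) (u : List ℕ) => (F.tree i).disp u,
        F.spine) : (ℤ → List ℕ → Prop) × (ℤ → List ℕ → Site d) × (ℕ → Site d)))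
    inferInstance

/-! ### The law of the random forest -/

/-- The joint law on `ℕ × ℕ` of the numbers of offspring of a point of the spine (other than the
base point) in its two trees: the pair `(a, b)` has mass `μ (a + b + 1)`. -/
def spineLaw (μ : PMF ℕ) : Measure (ℕ × ℕ) :=
  Measure.sum fun p : ℕ × ℕ => μ (p.1 + p.2 + 1) • Measure.dirac p

/-- Independent labels from which a forest is built: offspring numbers of the nodes `(i, u)`,
pairs of offspring numbers of the points of the spine, displacements on the edges of the trees,
displacements on the edges of the spine. -/
abbrev Labels (d : ℕ) : Type :=
  (ℤ × List ℕ → ℕ) × (ℕ → ℕ × ℕ) × (ℤ × List ℕ → Site d) × (ℕ → Site d)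

/-- All the labels are independent; offspring numbers have law `μ`, pairs on the spine have law
`spineLaw μ`, displacements have law `θ`. -/
def labelLaw {d : ℕ} (μ : PMF ℕ) (θ : PMF (Site d)) : Measure (Labels d) :=
  (Measure.infinitePi fun _ : ℤ × List ℕ => μ.toMeasure).prod
    ((Measure.infinitePi fun _ : ℕ => spineLaw μ).prod
      ((Measure.infinitePi fun _ : ℤ × List ℕ => θ.toMeasure).prod
        (Measure.infinitePi fun _ : ℕ => θ.toMeasure)))

/-- The number of offspring of the node `u` in the tree `T_i`: on the spine, away from the base
point, it is the first (if `i > 0`) or second (if `i < 0`) entry of the pair at that point. -/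
def labelOffspring {d : ℕ} (ω : Labels d) (i : ℤ) (u : List ℕ) : ℕ :=
  if u = [] ∧ 0 < i then (ω.2.1 i.natAbs).1
  else if u = [] ∧ i < 0 then (ω.2.1 i.natAbs).2
  else ω.1 (i, u)

def build {d : ℕ} (ω : Labels d) : Forest d where
  tree i := SpatialTree.grow (labelOffspring ω i) (fun u => ω.2.2.1 (i, u))
  spine := ω.2.2.2

/-- The law `P_{μ,θ}` of the random forest. -/
def forestLaw {d : ℕ} (μ : PMF ℕ) (θ : PMF (Site d)) : Measure (Forest d) :=
  (labelLaw μ θ).map build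

/-! ### Vertices, lexicographic exploration, positions -/

/-- A vertex is written `(i, u)`, with `u` a node of `T_i`. The point of the spine at which `T_n`
and `T_{-n}` are glued is written `(-n, [])`. -/
abbrev Vertex : Type := ℤ × List ℕ

/-- The lexicographic order on vertices (first index `i`, then words): with the spine leading from
the base point to its ancestors, each vertex comes before its descendants, in the order
`…, (-2, []), T_{-2} \ {[]}, (-1, []), T_{-1} \ {[]}, (0, []), T_0 \ {[]}, T_1 \ {[]}, …`. -/
def Before (v w : Vertex) : Prop :=
  v.1 < w.1 ∨ (v.1 = w.1 ∧ v.2 < w.2)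

/-- The base point. -/
def base : Vertex := (0, [])

/-- The parent, when the infinite tree is rooted at the end of the spine: the parent of a point of
the spine is the next point of the spine. -/
def parent (v : Vertex) : Vertex :=
  if v.2 = [] then (v.1 - 1, [])
  else if v.2.dropLast = [] then (-|v.1|, [])
  else (v.1, v.2.dropLast)

namespace Forest

variable {d : ℕ}

/-- The set of vertices of the forest, each point of the spine being counted once. -/
def verts (F : Forest d) : Set Vertex :=
  {v | v.2 ∈ (F.tree v.1).nodes ∧ (v.2 = [] → v.1 ≤ 0)}

/-- `v` is the vertex number `n` of the lexicographic exploration, the base point having number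
`0`: exactly `n` vertices `w` satisfy `base ≤ w < v` if `n ≥ 0`, exactly `-n` vertices `w` satisfy
`v ≤ w < base` if `n ≤ 0`. -/
def IsNode (F : Forest d) (n : ℤ) (v : Vertex) : Prop :=
  v ∈ F.verts ∧
    {w ∈ F.verts | ¬ Before w base ∧ Before w v}.encard = n.toNat ∧
    {w ∈ F.verts | ¬ Before w v ∧ Before w base}.encard = (-n).toNat

open Classical in
/-- The vertex number `n` of the lexicographic exploration (the base point if there is none). -/
def node (F : Forest d) (n : ℤ) : Vertex :=
  if h : ∃ v, F.IsNode n v then h.choose else base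

/-- The position of a vertex: the sum of the displacements along the path from the base point. -/
def pos (F : Forest d) (v : Vertex) : Site d :=
  ∑ n ∈ Finset.range v.1.natAbs, F.spine n +
    ∑ m ∈ Finset.range v.2.length, (F.tree v.1).disp (v.2.take (m + 1))

/-- The position of the vertex number `i` of the lexicographic exploration. -/
def X (F : Forest d) (i : ℤ) : Site d :=
  F.pos (F.node i)

/-- The range `{X_i, X_{i+1}, …, X_j}`. -/
def range (F : Forest d) (i j : ℤ) : Finset (Site d) :=
  (Finset.Icc i j).image F.X

/-! ### Change of base point -/

/-- The `j`-th child (from `0`) of a vertex `v`, when the infinite tree is rooted at the end of the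
spine; it is a vertex of the forest exactly if `v` is one and has more than `j` children. The
children of the spine point `(-n, [])`, `n > 0`, are its children in `T_{-n}`, then the preceding
point of the spine, then its children in `T_n`. -/
def child (F : Forest d) (v : Vertex) (j : ℕ) : Vertex :=
  if v.2 = [] ∧ 0 < v.1 then v
  else if v.2 = [] ∧ v.1 < 0 then
    if j < (F.tree v.1).offspring [] then (v.1, [j])
    else if j = (F.tree v.1).offspring [] then (v.1 + 1, [])
    else (-v.1, [j - (F.tree v.1).offspring [] - 1])
  else (v.1, v.2 ++ [j])

/-- The descendant of `v` reached by taking successively the children given by the word `u`. -/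
def desc (F : Forest d) (v : Vertex) (u : List ℕ) : Vertex :=
  u.foldl F.child v

/-- The number of siblings that come before `v`. -/
def rank (F : Forest d) (v : Vertex) : ℕ :=
  {w ∈ F.verts | parent w = parent v ∧ Before w v}.ncard

/-- After the base point has been moved to `w`, the `n`-th point of the spine is the `n`-th
ancestor `a` of `w`; its children before (resp. after) the `(n-1)`-st ancestor are the children of
the root of the new tree `T_{-n}` (resp. `T_n`). `reindex F w i u` is the vertex of `F` that
becomes the node `u` of the new tree `T_i`. -/
def reindex (F : Forest d) (w : Vertex) (i : ℤ) : List ℕ → Vertex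
  | [] => parent^[i.natAbs] w
  | j :: u =>
    if 0 < i then
      F.desc (parent^[i.natAbs] w) ((F.rank (parent^[i.natAbs - 1] w) + 1 + j) :: u)
    else F.desc (parent^[i.natAbs] w) (j :: u)

/-- The set of nodes of the new tree `T_i` after the base point has been moved to `w`. -/
def rebaseNodes (F : Forest d) (w : Vertex) (i : ℤ) : Set (List ℕ) :=
  {u | F.reindex w i u ∈ F.verts ∧
    (i < 0 → ∀ j ∈ u.head?, j < F.rank (parent^[i.natAbs - 1] w))}

lemma parent_mem_verts (F : Forest d) {v : Vertex} (hv : v ∈ F.verts) : parent v ∈ F.verts := by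
  obtain ⟨i, u⟩ := v
  obtain ⟨hu, hi⟩ := hv
  simp only [parent]
  split_ifs with h1 h2
  · exact ⟨(F.tree _).root_mem, fun _ => by have := hi h1; simp only at this ⊢; omega⟩
  · exact ⟨(F.tree _).root_mem, fun _ => by simp⟩
  · refine ⟨(F.tree i).parent_mem _ (u.getLast h1) ?_, fun h => absurd h h2⟩
    simpa [List.dropLast_append_getLast] using hu

lemma iterate_parent_mem_verts (F : Forest d) {v : Vertex} (hv : v ∈ F.verts) (n : ℕ) :
    parent^[n] v ∈ F.verts := by
  induction n with
  | zero => exact hv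
  | succ n ih => rw [Function.iterate_succ_apply']; exact F.parent_mem_verts ih

lemma mem_of_child_mem (F : Forest d) {v : Vertex} {j : ℕ} (h : F.child v j ∈ F.verts) :
    v ∈ F.verts := by
  obtain ⟨i, u⟩ := v
  simp only [child] at h
  split_ifs at h with h1 h2 h3 h4
  · exact h
  all_goals try exact ⟨h2.1 ▸ (F.tree _).root_mem, fun _ => h2.2.le⟩
  refine ⟨(F.tree i).parent_mem _ _ h.1, fun hu => ?_⟩
  simp only at hu ⊢
  by_contra hi
  exact h1 ⟨hu, by omega⟩

lemma exists_child_iff (F : Forest d) {v : Vertex} (hv : v ∈ F.verts) :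
    ∃ k : ℕ, ∀ j, F.child v j ∈ F.verts ↔ j < k := by
  obtain ⟨i, u⟩ := v
  obtain ⟨hu, hi⟩ := hv
  simp only at hu hi
  have h1 : ¬ (u = [] ∧ 0 < i) := fun h => absurd (hi h.1) (by omega)
  by_cases h2 : u = [] ∧ i < 0
  · obtain ⟨rfl, hneg⟩ := h2
    set a := (F.tree i).offspring [] with ha
    set b := (F.tree (-i)).offspring [] with hb
    have hL : ∀ j, [j] ∈ (F.tree i).nodes ↔ j < a := fun j =>
      (F.tree i).append_mem_iff (F.tree i).root_mem j
    have hR : ∀ j, [j] ∈ (F.tree (-i)).nodes ↔ j < b := fun j =>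
      (F.tree (-i)).append_mem_iff (F.tree (-i)).root_mem j
    refine ⟨a + 1 + b, fun j => ?_⟩
    have hc : F.child (i, []) j =
        if j < a then (i, [j]) else if j = a then (i + 1, []) else (-i, [j - a - 1]) := by
      simp [child, hneg, not_lt_of_gt hneg, ← ha]
    rw [hc]
    split_ifs with h3 h4
    · exact ⟨fun _ => by omega, fun _ => ⟨(hL j).2 h3, fun h => by simp at h⟩⟩
    · exact ⟨fun _ => by omega, fun _ => ⟨(F.tree _).root_mem, fun _ => by
        simp only; omega⟩⟩
    · refine ⟨fun h => ?_, fun h => ⟨(hR _).2 (by omega), fun h => by simp at h⟩⟩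
      have := (hR _).1 h.1
      omega
  · obtain ⟨k, hk⟩ := (F.tree i).exists_offspring u hu
    refine ⟨k, fun j => ?_⟩
    simp only [child, h1, h2, if_false, verts, Set.mem_ofPred_eq]
    simp [hk]

lemma desc_append (F : Forest d) (v : Vertex) (u : List ℕ) (j : ℕ) :
    F.desc v (u ++ [j]) = F.child (F.desc v u) j := by
  simp [desc, List.foldl_append]

lemma reindex_append (F : Forest d) (w : Vertex) (i : ℤ) {u : List ℕ} (hu : u ≠ []) (j : ℕ) :
    F.reindex w i (u ++ [j]) = F.child (F.reindex w i u) j := by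
  cases u with
  | nil => exact absurd rfl hu
  | cons a u =>
    simp only [List.cons_append, reindex]
    split_ifs
    · rw [← List.cons_append, desc_append]
    · rw [← List.cons_append, desc_append]

lemma nil_mem_rebaseNodes (F : Forest d) {w : Vertex} (hw : w ∈ F.verts) (i : ℤ) :
    [] ∈ F.rebaseNodes w i :=
  ⟨F.iterate_parent_mem_verts hw _, by simp⟩

lemma mem_rebaseNodes_of_append (F : Forest d) {w : Vertex} (hw : w ∈ F.verts) (i : ℤ)
    (u : List ℕ) (j : ℕ) (h : u ++ [j] ∈ F.rebaseNodes w i) : u ∈ F.rebaseNodes w i := by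
  by_cases hu : u = []
  · subst hu; exact F.nil_mem_rebaseNodes hw i
  · obtain ⟨h1, h2⟩ := h
    rw [F.reindex_append w i hu] at h1
    refine ⟨F.mem_of_child_mem h1, fun hi a ha => h2 hi a ?_⟩
    cases u with
    | nil => exact absurd rfl hu
    | cons b u => simpa using ha

lemma exists_rebase_offspring (F : Forest d) {w : Vertex} (hw : w ∈ F.verts) (i : ℤ)
    (u : List ℕ) (h : u ∈ F.rebaseNodes w i) :
    ∃ k : ℕ, ∀ j, u ++ [j] ∈ F.rebaseNodes w i ↔ j < k := by
  by_cases hu : u = []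
  · subst hu
    obtain ⟨k, hk⟩ := F.exists_child_iff (F.iterate_parent_mem_verts hw i.natAbs)
    set r := F.rank (parent^[i.natAbs - 1] w) with hr
    rcases lt_trichotomy i 0 with hi | hi | hi
    · refine ⟨min r k, fun j => ?_⟩
      have h0 : ¬ 0 < i := by omega
      simp [rebaseNodes, reindex, desc, hk, hi, h0, ← hr, and_comm]
    · refine ⟨k, fun j => ?_⟩
      subst hi
      simpa [rebaseNodes, reindex, desc] using hk j
    · refine ⟨k - (r + 1), fun j => ?_⟩
      have h0 : ¬ i < 0 := by omega
      simp only [rebaseNodes, reindex, desc, hi, h0, ← hr, List.nil_append, if_true,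
        List.foldl_cons, List.foldl_nil, Set.mem_ofPred_eq, hk, false_imp_iff, and_true]
      omega
  · obtain ⟨k, hk⟩ := F.exists_child_iff h.1
    refine ⟨k, fun j => ?_⟩
    rw [← hk j, ← F.reindex_append w i hu]
    refine ⟨fun h' => h'.1, fun h' => ⟨h', fun hi a ha => h.2 hi a ?_⟩⟩
    cases u with
    | nil => exact absurd rfl hu
    | cons b u => simpa using ha

open Classical in
/-- The forest `F` with the base point moved to its vertex `w`: the same infinite tree, seen from
`w`, with all edges keeping their displacements (with the opposite sign if the edge is traversed
in the opposite direction). -/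
def rebase (F : Forest d) (w : Vertex) (hw : w ∈ F.verts) : Forest d where
  tree i :=
    { nodes := F.rebaseNodes w i
      root_mem := F.nil_mem_rebaseNodes hw i
      parent_mem := F.mem_rebaseNodes_of_append hw i
      exists_offspring := F.exists_rebase_offspring hw i
      disp := fun u =>
        if u ≠ [] ∧ u ∈ F.rebaseNodes w i then
          F.pos (F.reindex w i u) - F.pos (parent (F.reindex w i u))
        else 0
      disp_root := by simp
      disp_of_notMem := fun u hu => if_neg fun h => hu h.2 }
  spine n := F.pos (parent^[n + 1] w) - F.pos (parent^[n] w)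

lemma node_mem_verts (F : Forest d) (n : ℤ) : F.node n ∈ F.verts := by
  unfold node
  split_ifs with h
  · exact h.choose_spec.1
  · exact ⟨(F.tree 0).root_mem, fun _ => le_rfl⟩

/-- The shift `σ`: the base point is moved to the next vertex of the lexicographic exploration. -/
def shift (F : Forest d) : Forest d :=
  F.rebase (F.node 1) (F.node_mem_verts 1)

end Forest

end SpineForest

end

noncomputable section

namespace SpineForest

/-! ### The lexicographic order on words and vertices -/

/-! The argument conjugates `shift` with a Bernoulli shift. Attach to each vertex its label: its
number of children in the infinite tree rooted at the end of the spine, and the displacement along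
the edge from its parent. Neither depends on the base point, so moving the base point to the next
vertex just translates the sequence `code` of the labels listed in lexicographic order
(`Good.code_shift`). It remains to see that this sequence determines the forest and that it is
i.i.d.

The code determines the forest: the descendants of a vertex form an interval of the exploration,
which ends when the Łukasiewicz path, with steps (offspring number minus one), first falls below its
starting level (`Good.isAncestor_node_iff`). Hence the descendants of the `n`-th spine point occupy
a finite window of indices that can be recognised from the offspring numbers inside it, and the
labels there determine the forest up to that point (`Good.agreeTo_of_code_eq`).

The code is i.i.d. with law `μ ⊗ θ`: a spine point with `a` and `b` children in its two trees has `a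
+ b + 1` children in all and carries the weight `μ (a + b + 1)`. By symmetry of `θ`, reversing the
spine edges costs nothing. So a finite piece of forest has the product of the weights of its labels
as its probability (`forestLaw_agreeTo`). Summing over disjoint window events bounds the law of the
code from above by the product law; both have mass one, so they are equal (`map_code`). No inverse
of the coding map has to be constructed.

All this holds on `Good` forests, which have full measure (`ae_good`): critical trees are finite,
and infinitely many trees on the right of the spine are nontrivial. Invariance and ergodicity then
come from the mixing of the Bernoulli shift, and the stationarity of increments and ranges from
invariance. -/

lemma append_lt_append_left (x : List ℕ) {a b : List ℕ} (h : a < b) : x ++ a < x ++ b := by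
  induction x with
  | nil => exact h
  | cons c x ih => exact List.cons_lt_cons_iff.2 (Or.inr ⟨rfl, ih⟩)

lemma lt_append_of_ne_nil (x : List ℕ) {a : List ℕ} (h : a ≠ []) : x < x ++ a := by
  have : x ++ [] < x ++ a := append_lt_append_left x (by
    cases a with
    | nil => exact absurd rfl h
    | cons b a => exact List.nil_lt_cons b a)
  simpa using this

/-- The words with prefix `x` form an interval of the lexicographic order. -/
lemma exists_append_of_le {x y z : List ℕ} (h1 : ¬ y < x) (h2 : ¬ x ++ z < y) :
    ∃ t, y = x ++ t := by
  induction x generalizing y with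
  | nil => exact ⟨y, rfl⟩
  | cons c x ih =>
    cases y with
    | nil => exact absurd (List.nil_lt_cons c x) h1
    | cons b y =>
      rw [List.cons_lt_cons_iff, not_or, not_and] at h1
      rw [List.cons_append, List.cons_lt_cons_iff, not_or, not_and] at h2
      have hbc : b = c := le_antisymm (not_lt.1 h2.1) (not_lt.1 h1.1)
      subst hbc
      obtain ⟨t, rfl⟩ := ih (h1.2 rfl) (h2.2 rfl)
      exact ⟨t, rfl⟩

lemma before_iff (v w : Vertex) : Before v w ↔ toLex v < toLex w := by
  simp [Before, Prod.Lex.lt_iff]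

lemma before_irrefl (v : Vertex) : ¬ Before v v := by simp [before_iff]

lemma Before.trans {u v w : Vertex} (h1 : Before u v) (h2 : Before v w) : Before u w := by
  rw [before_iff] at *
  exact h1.trans h2

lemma Before.asymm {u v : Vertex} (h1 : Before u v) : ¬ Before v u := by
  rw [before_iff] at *
  exact h1.asymm

lemma before_or_before_of_ne {v w : Vertex} (h : v ≠ w) : Before v w ∨ Before w v := by
  simp only [before_iff]
  exact lt_or_gt_of_ne (fun h' => h (toLex.injective h'))

/-- The `n`-th point of the spine. -/
def spinePt (n : ℕ) : Vertex := (-(n : ℤ), [])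

@[simp] lemma spinePt_zero : spinePt 0 = base := rfl

lemma parent_spinePt (n : ℕ) : parent (spinePt n) = spinePt (n + 1) := by
  simp [parent, spinePt]; ring

lemma iterate_parent_base (n : ℕ) : parent^[n] base = spinePt n := by
  induction n with
  | zero => rfl
  | succ n ih => rw [Function.iterate_succ_apply', ih, parent_spinePt]

lemma spinePt_injective : Function.Injective spinePt := by
  intro m n h
  simpa [spinePt] using h

lemma before_spinePt {m n : ℕ} (h : m < n) : Before (spinePt n) (spinePt m) :=
  Or.inl (by simpa [spinePt] using h)

/-- `v` is `w` or one of its ancestors. -/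
def IsAncestor (v w : Vertex) : Prop := ∃ k : ℕ, parent^[k] w = v

lemma IsAncestor.refl (v : Vertex) : IsAncestor v v := ⟨0, rfl⟩

lemma IsAncestor.trans {u v w : Vertex} (h1 : IsAncestor u v) (h2 : IsAncestor v w) :
    IsAncestor u w := by
  obtain ⟨k, rfl⟩ := h1
  obtain ⟨l, rfl⟩ := h2
  exact ⟨k + l, Function.iterate_add_apply _ _ _ _⟩

lemma isAncestor_parent (v : Vertex) : IsAncestor (parent v) v := ⟨1, rfl⟩

lemma isAncestor_spinePt {m n : ℕ} (h : m ≤ n) : IsAncestor (spinePt n) (spinePt m) := by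
  refine ⟨n - m, ?_⟩
  rw [← iterate_parent_base m, ← Function.iterate_add_apply, iterate_parent_base]
  congr 1; omega

lemma isAncestor_iff_eq_or_parent {v w : Vertex} :
    IsAncestor v w ↔ w = v ∨ IsAncestor v (parent w) := by
  constructor
  · rintro ⟨k, hk⟩
    cases k with
    | zero => exact Or.inl hk
    | succ k => exact Or.inr ⟨k, hk⟩
  · rintro (rfl | ⟨k, hk⟩)
    · exact IsAncestor.refl _
    · exact ⟨k + 1, hk⟩

lemma SpatialTree.mem_of_append {d : ℕ} (T : SpatialTree d) {u s : List ℕ}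
    (h : u ++ s ∈ T.nodes) : u ∈ T.nodes := by
  induction s using List.reverseRecOn with
  | nil => simpa using h
  | append_singleton s j ih =>
    rw [← List.append_assoc] at h
    exact ih (T.parent_mem _ _ h)

namespace Forest

variable {d : ℕ} (F : Forest d)

lemma spinePt_mem (n : ℕ) : spinePt n ∈ F.verts :=
  ⟨(F.tree _).root_mem, fun _ => by simp [spinePt]⟩

lemma base_mem : base ∈ F.verts := F.spinePt_mem 0

/-! ### Children and descendants -/

/-- The condition excludes the spine points other than the base point, the only vertices whose
children are spread over two trees and the spine. -/
lemma child_of_ne {i : ℤ} {x : List ℕ} (h : x ≠ [] ∨ i = 0) (j : ℕ) :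
    F.child (i, x) j = (i, x ++ [j]) := by
  have h1 : ¬ (x = [] ∧ 0 < i) := by rintro ⟨rfl, hi⟩; simp at h; omega
  have h2 : ¬ (x = [] ∧ i < 0) := by rintro ⟨rfl, hi⟩; simp at h; omega
  simp [child, h1, h2]

lemma child_spinePt (n j : ℕ) :
    F.child (spinePt (n + 1)) j =
      if j < (F.tree (-(n + 1 : ℤ))).offspring [] then (-(n + 1 : ℤ), [j])
      else if j = (F.tree (-(n + 1 : ℤ))).offspring [] then spinePt n
      else ((n + 1 : ℤ), [j - (F.tree (-(n + 1 : ℤ))).offspring [] - 1]) := by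
  have h1 : ¬ (0 : ℤ) < -(n + 1 : ℤ) := by omega
  have h2 : -(n + 1 : ℤ) < 0 := by omega
  have h3 : -(n + 1 : ℤ) + 1 = -n := by ring
  simp only [child, spinePt, Nat.cast_succ, h1, h2, h3, and_false, and_true, if_true, if_false,
    neg_neg]

lemma desc_nil (v : Vertex) : F.desc v [] = v := rfl

lemma desc_cons (v : Vertex) (j : ℕ) (u : List ℕ) :
    F.desc v (j :: u) = F.desc (F.child v j) u := rfl

lemma desc_append' (v : Vertex) (u s : List ℕ) : F.desc v (u ++ s) = F.desc (F.desc v u) s := by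
  simp [desc, List.foldl_append]

lemma desc_of_ne {i : ℤ} {x : List ℕ} (h : x ≠ [] ∨ i = 0) (u : List ℕ) :
    F.desc (i, x) u = (i, x ++ u) := by
  induction u generalizing x with
  | nil => simp [desc]
  | cons j u ih => rw [desc_cons, child_of_ne F h, ih (Or.inl (by simp))]; simp

lemma mem_of_desc_mem {v : Vertex} {u : List ℕ} (h : F.desc v u ∈ F.verts) : v ∈ F.verts := by
  induction u using List.reverseRecOn with
  | nil => exact h
  | append_singleton u j ih => rw [desc_append] at h; exact ih (F.mem_of_child_mem h)

lemma vertex_cases {v : Vertex} (hv : v ∈ F.verts) :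
    (∃ i x, v = (i, x) ∧ (x ≠ [] ∨ i = 0)) ∨ ∃ n : ℕ, v = spinePt (n + 1) := by
  obtain ⟨i, x⟩ := v
  by_cases h : x ≠ [] ∨ i = 0
  · exact Or.inl ⟨i, x, rfl, h⟩
  · push Not at h
    obtain ⟨rfl, hi⟩ := h
    have := hv.2 rfl
    simp only at this
    refine Or.inr ⟨(-i).toNat - 1, ?_⟩
    simp only [spinePt, Prod.mk.injEq, and_true]
    omega

lemma parent_child {v : Vertex} {j : ℕ} (h : F.child v j ∈ F.verts) :
    parent (F.child v j) = v := by
  rcases F.vertex_cases (F.mem_of_child_mem h) with ⟨i, x, rfl, hx⟩ | ⟨n, rfl⟩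
  · rw [child_of_ne F hx]
    rcases eq_or_ne x [] with rfl | hx'
    · obtain rfl : i = 0 := by simpa using hx
      simp [parent]
    · simp [parent, hx']
  · rw [child_spinePt]
    split_ifs with h1 h2
    · simp only [parent, spinePt, List.cons_ne_self, List.dropLast_singleton, if_true,
        if_false, Nat.cast_succ, abs_neg, abs_of_nonneg (show (0 : ℤ) ≤ n + 1 by omega)]
    · exact parent_spinePt n
    · simp only [parent, spinePt, List.dropLast_singleton, if_true,
        if_false, Nat.cast_succ, abs_of_nonneg (show (0 : ℤ) ≤ n + 1 by omega),
        reduceCtorEq]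

lemma exists_child_eq {x : Vertex} (hx : x ∈ F.verts) : ∃ j, F.child (parent x) j = x := by
  obtain ⟨i, u⟩ := x
  rcases List.eq_nil_or_concat u with rfl | ⟨u, j, rfl⟩
  · have hi : i ≤ 0 := hx.2 rfl
    obtain ⟨n, rfl⟩ : ∃ n : ℕ, i = -(n : ℤ) := ⟨(-i).toNat, by omega⟩
    refine ⟨(F.tree (-(n + 1 : ℤ))).offspring [], ?_⟩
    change F.child (parent (spinePt n)) _ = spinePt n
    rw [parent_spinePt, child_spinePt]
    simp
  · rcases eq_or_ne u [] with rfl | hu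
    · have hj : j < (F.tree i).offspring [] :=
        ((F.tree i).append_mem_iff (F.tree i).root_mem j).1 hx.1
      have hp : parent (i, [] ++ [j]) = spinePt i.natAbs := by
        simp [parent, spinePt]
      rw [List.concat_eq_append, hp]
      rcases lt_trichotomy i 0 with hi | rfl | hi
      · obtain ⟨n, rfl⟩ : ∃ n : ℕ, i = -(n + 1 : ℤ) := ⟨(-i).toNat - 1, by omega⟩
        refine ⟨j, ?_⟩
        rw [show (-(n + 1 : ℤ)).natAbs = n + 1 by omega, child_spinePt, if_pos hj]
        rfl
      · exact ⟨j, F.child_of_ne (Or.inr rfl) j⟩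
      · obtain ⟨n, rfl⟩ : ∃ n : ℕ, i = (n + 1 : ℤ) := ⟨i.toNat - 1, by omega⟩
        refine ⟨(F.tree (-(n + 1 : ℤ))).offspring [] + 1 + j, ?_⟩
        rw [show (n + 1 : ℤ).natAbs = n + 1 by omega, child_spinePt, if_neg (by omega),
          if_neg (by omega)]
        simp; omega
    · refine ⟨j, ?_⟩
      have hp : parent (i, u.concat j) = (i, u) := by simp [parent, hu]
      rw [hp, child_of_ne F (Or.inl hu)]
      simp

/-- Together with `exists_desc_spinePt`, this identifies the descendants of the `n`-th spine point
with the vertices of the trees `T_i`, `|i| ≤ n`. -/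
lemma natAbs_desc_spinePt (n : ℕ) (u : List ℕ) : (F.desc (spinePt n) u).1.natAbs ≤ n := by
  induction n generalizing u with
  | zero => simp [spinePt, desc_of_ne]
  | succ n ih =>
    cases u with
    | nil => simp only [desc_nil, spinePt]; omega
    | cons j u =>
      rw [desc_cons, child_spinePt]
      split_ifs
      · rw [desc_of_ne F (by simp)]; simp; omega
      · exact (ih u).trans (by omega)
      · rw [desc_of_ne F (by simp)]; simp; omega

lemma before_child {v : Vertex} {j : ℕ} (h : F.child v j ∈ F.verts) : Before v (F.child v j) := by
  rcases F.vertex_cases (F.mem_of_child_mem h) with ⟨i, x, rfl, hx⟩ | ⟨n, rfl⟩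
  · rw [child_of_ne F hx]
    exact Or.inr ⟨rfl, lt_append_of_ne_nil _ (by simp)⟩
  · rw [child_spinePt]
    split_ifs
    · exact Or.inr ⟨by simp [spinePt], by simp [spinePt]⟩
    · exact before_spinePt (by omega)
    · exact Or.inl (by simp [spinePt]; omega)

lemma before_desc {v : Vertex} {u : List ℕ} (h : F.desc v u ∈ F.verts) (hu : u ≠ []) :
    Before v (F.desc v u) := by
  induction u using List.reverseRecOn with
  | nil => exact absurd rfl hu
  | append_singleton u j ih =>
    rw [desc_append] at h ⊢
    rcases eq_or_ne u [] with rfl | hu'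
    · exact F.before_child h
    · exact (ih (F.mem_of_child_mem h) hu').trans (F.before_child h)

/-- The children, taken in order, have successive subtrees. -/
lemma desc_before_of_lt {v : Vertex} {j j' : ℕ} (hj : j < j') {u u' : List ℕ}
    (h : F.desc v (j :: u) ∈ F.verts) :
    Before (F.desc v (j :: u)) (F.desc v (j' :: u')) := by
  rcases F.vertex_cases (F.mem_of_desc_mem h) with ⟨i, x, rfl, hx⟩ | ⟨n, rfl⟩
  · rw [desc_of_ne F hx, desc_of_ne F hx]
    exact Or.inr ⟨rfl, append_lt_append_left _ (List.cons_lt_cons_iff.2 (Or.inl hj))⟩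
  · rw [desc_cons, desc_cons, child_spinePt, child_spinePt]
    have hn (s : List ℕ) := F.natAbs_desc_spinePt n s
    split_ifs
    · rw [desc_of_ne F (by simp), desc_of_ne F (by simp)]
      exact Or.inr ⟨rfl, List.cons_lt_cons_iff.2 (Or.inl hj)⟩
    · have := hn u'
      rw [desc_of_ne F (by simp)]
      exact Or.inl (by simp only; omega)
    · rw [desc_of_ne F (by simp), desc_of_ne F (by simp)]
      exact Or.inl (by simp only; omega)
    · omega
    · omega
    · have := hn u
      rw [desc_of_ne F (x := [_]) (by simp)]
      exact Or.inl (by simp only; omega)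
    · omega
    · omega
    · rw [desc_of_ne F (by simp), desc_of_ne F (by simp)]
      exact Or.inr ⟨rfl, List.cons_lt_cons_iff.2 (Or.inl (by omega))⟩

/-- Seen from a common ancestor, `Before` is the lexicographic order of words. Any two vertices have
a common ancestor on the spine, so comparisons of vertices reduce to comparisons of words. -/
lemma desc_before {v : Vertex} {u u' : List ℕ} (h : F.desc v u ∈ F.verts)
    (h' : F.desc v u' ∈ F.verts) (hu : u < u') : Before (F.desc v u) (F.desc v u') := by
  induction u generalizing v u' with
  | nil => exact F.before_desc h' (by rintro rfl; simp at hu)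
  | cons j u ih =>
    cases u' with
    | nil => simp at hu
    | cons j' u' =>
      rcases List.cons_lt_cons_iff.1 hu with hj | ⟨rfl, hu'⟩
      · exact F.desc_before_of_lt hj h
      · exact ih h h' hu'

lemma desc_before_iff {v : Vertex} {u u' : List ℕ} (h : F.desc v u ∈ F.verts)
    (h' : F.desc v u' ∈ F.verts) : Before (F.desc v u) (F.desc v u') ↔ u < u' := by
  refine ⟨fun hb => ?_, F.desc_before h h'⟩
  rcases lt_trichotomy u u' with hu | rfl | hu
  · exact hu
  · exact absurd hb (before_irrefl _)
  · exact absurd hb (F.desc_before h' h hu).asymm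

lemma child_before_iff {v : Vertex} {j j' : ℕ} (h : F.child v j ∈ F.verts)
    (h' : F.child v j' ∈ F.verts) : Before (F.child v j) (F.child v j') ↔ j < j' := by
  have := F.desc_before_iff (v := v) (u := [j]) (u' := [j']) h h'
  simpa [desc, List.cons_lt_cons_iff] using this

lemma child_injOn {v : Vertex} {j j' : ℕ} (h : F.child v j ∈ F.verts)
    (h' : F.child v j' ∈ F.verts) (he : F.child v j = F.child v j') : j = j' := by
  rcases lt_trichotomy j j' with hj | hj | hj
  · exact absurd ((F.child_before_iff h h').2 hj) (he ▸ before_irrefl _)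
  · exact hj
  · exact absurd ((F.child_before_iff h' h).2 hj) (he ▸ before_irrefl _)

lemma exists_desc_spinePt {n : ℕ} {x : Vertex} (hx : x ∈ F.verts) (hn : x.1.natAbs ≤ n) :
    ∃ u, F.desc (spinePt n) u = x := by
  induction n with
  | zero =>
    obtain ⟨i, u⟩ := x
    obtain rfl : i = 0 := by simpa using hn
    exact ⟨u, by simp [spinePt, desc_of_ne]⟩
  | succ n ih =>
    rcases Nat.lt_or_ge n x.1.natAbs with h | h
    · obtain ⟨i, s⟩ := x
      simp only at hn h
      cases s with
      | nil =>
        -- A vertex with empty word has nonpositive index, so here it is the spine point `n + 1`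
        -- itself.
        refine ⟨[], ?_⟩
        have := hx.2 rfl
        simp only at this
        simp only [desc_nil, spinePt, Prod.mk.injEq, and_true]
        omega
      | cons j s =>
        have hj : j < (F.tree i).offspring [] :=
          ((F.tree i).append_mem_iff (F.tree i).root_mem j).1
            ((F.tree i).mem_of_append (u := [j]) (s := s) hx.1)
        rcases le_or_gt i 0 with hi | hi
        · obtain rfl : i = -(n + 1 : ℤ) := by omega
          refine ⟨j :: s, ?_⟩
          rw [desc_cons, child_spinePt, if_pos hj, desc_of_ne F (by simp)]
          rfl
        · obtain rfl : i = (n + 1 : ℤ) := by omega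
          refine ⟨((F.tree (-(n + 1 : ℤ))).offspring [] + 1 + j) :: s, ?_⟩
          rw [desc_cons, child_spinePt, if_neg (by omega), if_neg (by omega),
            desc_of_ne F (by simp)]
          simp; omega
    · obtain ⟨u, hu⟩ := ih h
      -- The letter `offspring []` of the left tree leads to the preceding spine point, where the
      -- induction hypothesis applies.
      refine ⟨(F.tree (-(n + 1 : ℤ))).offspring [] :: u, ?_⟩
      rw [desc_cons, child_spinePt, if_neg (by omega), if_pos rfl, hu]

/-! ### Ancestors -/

lemma iterate_parent_desc {v : Vertex} {u : List ℕ} (h : F.desc v u ∈ F.verts) :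
    parent^[u.length] (F.desc v u) = v := by
  induction u using List.reverseRecOn with
  | nil => rfl
  | append_singleton u j ih =>
    rw [desc_append] at h ⊢
    simp only [List.length_append, List.length_singleton, Function.iterate_succ_apply]
    rw [F.parent_child h, ih (F.mem_of_child_mem h)]

lemma exists_desc_eq_of_iterate_parent {x : Vertex} (hx : x ∈ F.verts) (k : ℕ) :
    ∃ u, F.desc (parent^[k] x) u = x := by
  induction k with
  | zero => exact ⟨[], rfl⟩
  | succ k ih =>
    obtain ⟨u, hu⟩ := ih
    obtain ⟨j, hj⟩ := F.exists_child_eq (F.iterate_parent_mem_verts hx k)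
    refine ⟨j :: u, ?_⟩
    rw [desc_cons, Function.iterate_succ_apply', hj, hu]

lemma isAncestor_iff {v x : Vertex} (hx : x ∈ F.verts) :
    IsAncestor v x ↔ ∃ u, F.desc v u = x := by
  constructor
  · rintro ⟨k, rfl⟩
    exact F.exists_desc_eq_of_iterate_parent hx k
  · rintro ⟨u, rfl⟩
    exact ⟨u.length, F.iterate_parent_desc hx⟩

lemma mem_verts_of_isAncestor {v x : Vertex} (hx : x ∈ F.verts) (h : IsAncestor v x) :
    v ∈ F.verts := by
  obtain ⟨k, rfl⟩ := h
  exact F.iterate_parent_mem_verts hx k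

lemma isAncestor_spinePt_iff {n : ℕ} {x : Vertex} (hx : x ∈ F.verts) :
    IsAncestor (spinePt n) x ↔ x.1.natAbs ≤ n := by
  rw [F.isAncestor_iff hx]
  exact ⟨by rintro ⟨u, rfl⟩; exact F.natAbs_desc_spinePt n u, F.exists_desc_spinePt hx⟩

lemma not_before_of_isAncestor {v x : Vertex} (hx : x ∈ F.verts) (h : IsAncestor v x) :
    ¬ Before x v := by
  obtain ⟨u, rfl⟩ := (F.isAncestor_iff hx).1 h
  rcases eq_or_ne u [] with rfl | hu
  · exact before_irrefl _
  · exact (F.before_desc hx hu).asymm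

lemma parent_before {x : Vertex} (hx : x ∈ F.verts) : Before (parent x) x := by
  obtain ⟨j, hj⟩ := F.exists_child_eq hx
  conv_rhs => rw [← hj]
  exact F.before_child (hj.symm ▸ hx)

/-- The descendants of a vertex form an interval. -/
lemma isAncestor_of_between {v x y : Vertex} (hx : x ∈ F.verts)
    (hy : y ∈ F.verts) (h1 : ¬ Before x v) (h2 : ¬ Before y x) (h : IsAncestor v y) :
    IsAncestor v x := by
  have hv := F.mem_verts_of_isAncestor hy h
  obtain ⟨s, rfl⟩ := (F.isAncestor_iff hy).1 h
  obtain ⟨ν, hν⟩ := F.exists_desc_spinePt (n := max v.1.natAbs x.1.natAbs) hv (le_max_left _ _)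
  obtain ⟨χ, hχ⟩ := F.exists_desc_spinePt (n := max v.1.natAbs x.1.natAbs) hx (le_max_right _ _)
  set N := max v.1.natAbs x.1.natAbs
  rw [← hν, ← hχ, F.desc_before_iff (hχ ▸ hx) (hν ▸ hv)] at h1
  rw [← hν, ← F.desc_append' (spinePt N)] at hy
  rw [← hν, ← F.desc_append' (spinePt N), ← hχ, F.desc_before_iff hy (hχ ▸ hx)] at h2
  -- Read from one spine point above both `v` and `x`, the claim is that words with a given prefix
  -- form an interval.
  obtain ⟨t, rfl⟩ := exists_append_of_le h1 h2
  rw [F.isAncestor_iff hx]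
  exact ⟨t, by rw [← hν, ← desc_append', hχ]⟩

/-! ### Children and ranks -/

/-- The number of children of `v` in the infinite tree. -/
def numChildren (v : Vertex) : ℕ := {w ∈ F.verts | parent w = v}.ncard

lemma children_eq_image {v : Vertex} {k : ℕ} (hk : ∀ j, F.child v j ∈ F.verts ↔ j < k) :
    {w ∈ F.verts | parent w = v} = F.child v '' Set.Iio k := by
  ext w
  constructor
  · rintro ⟨hw, rfl⟩
    obtain ⟨j, hj⟩ := F.exists_child_eq hw
    exact ⟨j, (hk j).1 (hj.symm ▸ hw), hj⟩
  · rintro ⟨j, hj, rfl⟩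
    exact ⟨(hk j).2 hj, F.parent_child ((hk j).2 hj)⟩

lemma child_mem_iff {v : Vertex} (hv : v ∈ F.verts) (j : ℕ) :
    F.child v j ∈ F.verts ↔ j < F.numChildren v := by
  obtain ⟨k, hk⟩ := F.exists_child_iff hv
  rw [numChildren, F.children_eq_image hk, Set.InjOn.ncard_image, hk]
  · simp [← Nat.card_coe_set_eq]
  · intro a ha b hb h
    exact F.child_injOn ((hk a).2 ha) ((hk b).2 hb) h

lemma finite_children (v : Vertex) (hv : v ∈ F.verts) : {w ∈ F.verts | parent w = v}.Finite := by
  obtain ⟨k, hk⟩ := F.exists_child_iff hv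
  rw [F.children_eq_image hk]
  exact (Set.finite_Iio k).image _

lemma rank_child {v : Vertex} {j : ℕ} (h : F.child v j ∈ F.verts) : F.rank (F.child v j) = j := by
  have hv := F.mem_of_child_mem h
  have hlt := (F.child_mem_iff hv j).1 h
  have : {w ∈ F.verts | parent w = parent (F.child v j) ∧ Before w (F.child v j)} =
      F.child v '' Set.Iio j := by
    ext w
    rw [F.parent_child h]
    constructor
    · rintro ⟨hw, rfl, hb⟩
      obtain ⟨i, hi⟩ := F.exists_child_eq hw
      refine ⟨i, ?_, hi⟩
      rw [← hi] at hb hw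
      rw [hi] at hw hb
      have hw' : F.child (parent w) i ∈ F.verts := by rw [hi]; exact hw
      exact (F.child_before_iff hw' h).1 (by rw [hi]; exact hb)
    · rintro ⟨i, hi, rfl⟩
      have hm := (F.child_mem_iff hv i).2 (lt_trans hi hlt)
      exact ⟨hm, F.parent_child hm, (F.child_before_iff hm h).2 hi⟩
  rw [rank, this, Set.InjOn.ncard_image]
  · simp [← Nat.card_coe_set_eq]
  · intro a ha b hb h'
    exact F.child_injOn ((F.child_mem_iff hv a).2 (lt_trans ha hlt))
      ((F.child_mem_iff hv b).2 (lt_trans hb hlt)) h'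

lemma child_rank {x : Vertex} (hx : x ∈ F.verts) : F.child (parent x) (F.rank x) = x := by
  obtain ⟨j, hj⟩ := F.exists_child_eq hx
  have := F.rank_child (hj.symm ▸ hx : F.child (parent x) j ∈ F.verts)
  rw [hj] at this
  rw [this, hj]

/-- This makes the size of a left tree's first generation visible in the order of siblings, which is
how it is recovered from the code. -/
lemma rank_spinePt (n : ℕ) : F.rank (spinePt n) = (F.tree (-(n + 1 : ℤ))).offspring [] := by
  have h : F.child (spinePt (n + 1)) ((F.tree (-(n + 1 : ℤ))).offspring []) = spinePt n := by
    rw [child_spinePt]; simp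
  have := F.rank_child (h.symm ▸ F.spinePt_mem n)
  rwa [h] at this

end Forest

end SpineForest

namespace SpineForest

namespace Forest

variable {d : ℕ} (F : Forest d)

/-! ### Enumerations of the vertices -/

/-- `e` lists all the vertices in increasing order, starting from the base point. -/
structure IsEnum (e : ℤ → Vertex) : Prop where
  before : ∀ i j, i < j → Before (e i) (e j)
  range_eq : Set.range e = F.verts
  zero : e 0 = base

variable {F} in
lemma IsEnum.before_iff {e : ℤ → Vertex} (he : F.IsEnum e) {i j : ℤ} :
    Before (e i) (e j) ↔ i < j := by
  refine ⟨fun h => ?_, he.before i j⟩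
  rcases lt_trichotomy i j with hij | rfl | hij
  · exact hij
  · exact absurd h (before_irrefl _)
  · exact absurd h (he.before _ _ hij).asymm

variable {F} in
lemma IsEnum.injective {e : ℤ → Vertex} (he : F.IsEnum e) : Function.Injective e := by
  intro i j h
  rcases lt_trichotomy i j with hij | hij | hij
  · exact absurd (he.before _ _ hij) (h ▸ before_irrefl _)
  · exact hij
  · exact absurd (he.before _ _ hij) (h ▸ before_irrefl _)

variable {F} in
lemma IsEnum.mem {e : ℤ → Vertex} (he : F.IsEnum e) (i : ℤ) : e i ∈ F.verts :=
  he.range_eq ▸ Set.mem_range_self i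

variable {F} in
lemma IsEnum.exists_eq {e : ℤ → Vertex} (he : F.IsEnum e) {v : Vertex} (hv : v ∈ F.verts) :
    ∃ i, e i = v := by
  rwa [← he.range_eq] at hv

variable {F} in
lemma IsEnum.encard_between {e : ℤ → Vertex} (he : F.IsEnum e) (i j : ℤ) :
    {w ∈ F.verts | ¬ Before w (e i) ∧ Before w (e j)}.encard = (j - i).toNat := by
  have : {w ∈ F.verts | ¬ Before w (e i) ∧ Before w (e j)} = e '' (Finset.Ico i j) := by
    ext w
    constructor
    · rintro ⟨hw, h1, h2⟩
      obtain ⟨k, rfl⟩ := he.exists_eq hw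
      rw [he.before_iff] at h1 h2
      exact ⟨k, by simp; omega, rfl⟩
    · rintro ⟨k, hk, rfl⟩
      simp only [Finset.coe_Ico, Set.mem_Ico] at hk
      exact ⟨he.mem k, by rw [he.before_iff]; omega, by rw [he.before_iff]; omega⟩
  rw [this, he.injective.encard_image, Set.encard_coe_eq_coe_finsetCard, Int.card_Ico]

variable {F} in
-- An enumeration turns the two cardinalities in `IsNode` into lengths of integer intervals.
-- Consequently exhibiting any enumeration identifies `node`.
lemma IsEnum.isNode_iff {e : ℤ → Vertex} (he : F.IsEnum e) (n : ℤ) (v : Vertex) :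
    F.IsNode n v ↔ v = e n := by
  constructor
  · rintro ⟨hv, h1, h2⟩
    obtain ⟨m, rfl⟩ := he.exists_eq hv
    rw [← he.zero, he.encard_between] at h1 h2
    rw [Nat.cast_inj] at h1 h2
    congr 1; omega
  · rintro rfl
    refine ⟨he.mem n, ?_, ?_⟩
    · rw [← he.zero, he.encard_between, sub_zero]
    · rw [← he.zero, he.encard_between, zero_sub]

variable {F} in
lemma IsEnum.node_eq {e : ℤ → Vertex} (he : F.IsEnum e) : F.node = e := by
  funext n
  have h : ∃ v, F.IsNode n v := ⟨e n, (he.isNode_iff n _).2 rfl⟩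
  rw [node, dif_pos h]
  exact (he.isNode_iff n _).1 h.choose_spec

/-- The vertices are listed by the exploration, and each has finitely many descendants. -/
structure Good : Prop where
  isEnum : F.IsEnum F.node
  finite : ∀ x ∈ F.verts, {y ∈ F.verts | IsAncestor x y}.Finite

/-! ### Positions -/

lemma pos_sub_pos_parent {i : ℤ} {u : List ℕ} (hu : u ≠ []) :
    F.pos (i, u) - F.pos (parent (i, u)) = (F.tree i).disp u := by
  rcases List.eq_nil_or_concat u with rfl | ⟨s, j, rfl⟩
  · exact absurd rfl hu
  · have hp : F.pos (parent (i, s.concat j)) = F.pos (i, s) := by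
      rcases eq_or_ne s [] with rfl | hs
      · simp [parent, pos, Int.natAbs_abs]
      · simp [parent, hs]
    rw [hp]
    simp only [pos, List.concat_eq_append, List.length_append, List.length_singleton,
      -- The last summand reads the whole word; the earlier ones only read prefixes of `s`.
      Finset.sum_range_succ, List.take_of_length_le (show (s ++ [j]).length ≤ s.length + 1 by simp)]
    have : ∀ m ∈ Finset.range s.length, (F.tree i).disp ((s ++ [j]).take (m + 1)) =
        (F.tree i).disp (s.take (m + 1)) := by
      intro m hm
      rw [List.take_append_of_le_length (by simpa using hm)]
    rw [Finset.sum_congr rfl this]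
    abel

lemma pos_spinePt_sub_pos_parent (n : ℕ) :
    F.pos (spinePt n) - F.pos (parent (spinePt n)) = - F.spine n := by
  rw [parent_spinePt]
  have h (m : ℕ) : F.pos (spinePt m) = ∑ k ∈ Finset.range m, F.spine k := by simp [pos, spinePt]
  rw [h, h, Finset.sum_range_succ]
  abel

@[simp] lemma pos_base : F.pos base = 0 := by simp [pos, base]

/-- Two vertices have a common ancestor. -/
lemma exists_iterate_parent_eq {x y : Vertex} (hx : x ∈ F.verts) (hy : y ∈ F.verts) :
    ∃ k l, parent^[k] x = parent^[l] y := by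
  obtain ⟨k, hk⟩ := (F.isAncestor_spinePt_iff (n := max x.1.natAbs y.1.natAbs) hx).2
    (le_max_left _ _)
  obtain ⟨l, hl⟩ := (F.isAncestor_spinePt_iff (n := max x.1.natAbs y.1.natAbs) hy).2
    (le_max_right _ _)
  exact ⟨k, l, hk.trans hl.symm⟩

/-- The offspring number of a vertex, with the displacement along the edge from its parent. -/
def label (v : Vertex) : ℕ × Site d := (F.numChildren v, F.pos v - F.pos (parent v))

/-- The labels of the vertices, in the order of the exploration. -/
def code (i : ℤ) : ℕ × Site d := F.label (F.node i)

/-! ### Change of base point -/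

lemma reindex_of_nonpos (w : Vertex) {i : ℤ} (hi : i ≤ 0) (u : List ℕ) :
    F.reindex w i u = F.desc (parent^[i.natAbs] w) u := by
  cases u with
  | nil => rfl
  | cons j u => simp [reindex, not_lt.2 hi]

lemma reindex_of_pos (w : Vertex) {i : ℤ} (hi : 0 < i) (j : ℕ) (u : List ℕ) :
    F.reindex w i (j :: u) =
      F.desc (parent^[i.natAbs] w) ((F.rank (parent^[i.natAbs - 1] w) + 1 + j) :: u) := by
  simp [reindex, hi]

lemma exists_desc_eq_reindex (w : Vertex) (i : ℤ) (u : List ℕ) :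
    ∃ s, F.reindex w i u = F.desc (parent^[i.natAbs] w) s := by
  rcases le_or_gt i 0 with hi | hi
  · exact ⟨u, F.reindex_of_nonpos w hi u⟩
  · cases u with
    | nil => exact ⟨[], rfl⟩
    | cons j u => exact ⟨_, F.reindex_of_pos w hi j u⟩

/-- The descendants of an ancestor, seen from an older ancestor. -/
lemma exists_desc_iterate_parent {w : Vertex} (hw : w ∈ F.verts) {m M : ℕ} (h : m < M)
    (s : List ℕ) : ∃ t, F.desc (parent^[m] w) s =
      F.desc (parent^[M] w) (F.rank (parent^[M - 1] w) :: t) := by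
  induction M, h using Nat.le_induction with
  | base =>
    refine ⟨s, ?_⟩
    rw [desc_cons, Nat.succ_sub_one, Function.iterate_succ_apply',
      F.child_rank (F.iterate_parent_mem_verts hw m)]
  | succ M hM ih =>
    obtain ⟨t, ht⟩ := ih
    refine ⟨F.rank (parent^[M - 1] w) :: t, ht.trans ?_⟩
    rw [F.desc_cons (parent^[M + 1] w), Nat.add_sub_cancel, Function.iterate_succ_apply',
      F.child_rank (F.iterate_parent_mem_verts hw M)]

variable {F} {w : Vertex} (hw : w ∈ F.verts)
include hw

lemma reindex_mem {v : Vertex} (hv : v ∈ (F.rebase w hw).verts) :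
    F.reindex w v.1 v.2 ∈ F.verts := hv.1.1

/-- Both vertices are written as words from the older of the two ancestors of `w` involved. There
the branch towards `w` starts with the letter `rank`, the new left tree with smaller letters and the
new right tree with larger ones. -/
lemma reindex_before {v v' : Vertex} (hv : v ∈ (F.rebase w hw).verts)
    (hv' : v' ∈ (F.rebase w hw).verts) (h : Before v v') :
    Before (F.reindex w v.1 v.2) (F.reindex w v'.1 v'.2) := by
  have hm := reindex_mem hw hv
  have hm' := reindex_mem hw hv'
  obtain ⟨i, u⟩ := v
  obtain ⟨i', u'⟩ := v'
  obtain ⟨⟨-, hr⟩, hi⟩ := hv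
  obtain ⟨-, hi'⟩ := hv'
  simp only at hm hm' hr hi hi' ⊢
  rcases h with h | ⟨h, h'⟩
  · simp only at h
    rcases lt_trichotomy i.natAbs i'.natAbs with hlt | heq | hlt
    · cases u' with
      -- Spine points are only counted with nonpositive index, so a vertex with positive index has a
      -- nonempty word.
      | nil => have := hi' rfl; omega
      | cons j' u' =>
        have hpos : 0 < i' := by omega
        obtain ⟨s, hs⟩ := F.exists_desc_eq_reindex w i u
        obtain ⟨t, ht⟩ := F.exists_desc_iterate_parent hw hlt s
        rw [hs, ht] at hm ⊢
        rw [F.reindex_of_pos w hpos] at hm' ⊢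
        exact F.desc_before hm hm' (List.cons_lt_cons_iff.2 (Or.inl (by omega)))
    · have hneg : i < 0 := by omega
      cases u' with
      | nil => have := hi' rfl; omega
      | cons j' u' =>
        have hpos : 0 < i' := by omega
        rw [F.reindex_of_nonpos w hneg.le] at hm ⊢
        rw [F.reindex_of_pos w hpos, ← heq] at hm' ⊢
        refine F.desc_before hm hm' ?_
        cases u with
        | nil => exact List.nil_lt_cons _ _
        | cons j u =>
          have := hr hneg j rfl
          exact List.cons_lt_cons_iff.2 (Or.inl (by omega))
    · have hneg : i < 0 := by omega
      obtain ⟨s, hs⟩ := F.exists_desc_eq_reindex w i' u'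
      obtain ⟨t, ht⟩ := F.exists_desc_iterate_parent hw hlt s
      rw [hs, ht] at hm' ⊢
      rw [F.reindex_of_nonpos w hneg.le] at hm ⊢
      refine F.desc_before hm hm' ?_
      cases u with
      | nil => exact List.nil_lt_cons _ _
      | cons j u => exact List.cons_lt_cons_iff.2 (Or.inl (hr hneg j rfl))
  · simp only at h h'
    subst h
    rcases le_or_gt i 0 with h0 | h0
    · rw [F.reindex_of_nonpos w h0] at hm hm'
      rw [F.reindex_of_nonpos w h0, F.reindex_of_nonpos w h0]
      exact F.desc_before hm hm' h'
    · cases u with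
      | nil => have := hi rfl; omega
      | cons j u =>
        cases u' with
        | nil => have := hi' rfl; omega
        | cons j' u' =>
          rw [F.reindex_of_pos w h0] at hm hm'
          rw [F.reindex_of_pos w h0, F.reindex_of_pos w h0]
          refine F.desc_before hm hm' ?_
          rw [List.cons_lt_cons_iff] at h' ⊢
          exact h'.imp (by omega) (fun h => ⟨by omega, h.2⟩)

lemma reindex_injOn {v v' : Vertex} (hv : v ∈ (F.rebase w hw).verts)
    (hv' : v' ∈ (F.rebase w hw).verts)
    (h : F.reindex w v.1 v.2 = F.reindex w v'.1 v'.2) : v = v' := by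
  by_contra hne
  rcases before_or_before_of_ne hne with hb | hb
  · exact before_irrefl _ (h ▸ reindex_before hw hv hv' hb)
  · exact before_irrefl _ (h ▸ reindex_before hw hv' hv hb)

/-- The new tree containing `x` is found from the youngest ancestor of `w` that is also an ancestor
of `x`; the first letter of the path from there to `x` decides the side. -/
lemma exists_reindex_eq {x : Vertex} (hx : x ∈ F.verts) :
    ∃ v ∈ (F.rebase w hw).verts, F.reindex w v.1 v.2 = x := by
  have hex : ∃ n, IsAncestor (parent^[n] w) x := by
    obtain ⟨k, l, h⟩ := F.exists_iterate_parent_eq hx hw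
    exact ⟨l, k, h⟩
  classical
  obtain ⟨u, hu⟩ := (F.isAncestor_iff hx).1 (Nat.find_spec hex)
  set n := Nat.find hex with hn
  have hmin : ∀ m < n, ¬ IsAncestor (parent^[m] w) x := fun m hm => Nat.find_min hex hm
  clear_value n
  rcases Nat.eq_zero_or_pos n with rfl | hpos
  · refine ⟨(0, u), ⟨⟨?_, by simp⟩, by simp⟩, ?_⟩
    · rw [F.reindex_of_nonpos w le_rfl]; exact hu.symm ▸ hx
    · rw [F.reindex_of_nonpos w le_rfl]; exact hu
  · have hnat : (-(n : ℤ)).natAbs = n := by omega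
    have hval : F.reindex w (-(n : ℤ)) u = x := by
      rw [F.reindex_of_nonpos w (by omega), hnat, hu]
    cases u with
    | nil => exact ⟨(-(n : ℤ), []), ⟨⟨hval.symm ▸ hx, by simp⟩, fun _ => by simp⟩, hval⟩
    | cons j u =>
      rcases lt_trichotomy j (F.rank (parent^[n - 1] w)) with hj | hj | hj
      · exact ⟨(-(n : ℤ), j :: u), ⟨⟨hval.symm ▸ hx, fun _ i hi => by
          obtain rfl : j = i := by simpa using hi
          simpa [hnat] using hj⟩, fun _ => by simp⟩, hval⟩
      -- The letter `rank` leads to the next younger ancestor of `w`, against the minimality of `n`.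
      · refine absurd ((F.isAncestor_iff hx).2 ⟨u, ?_⟩) (hmin (n - 1) (by omega))
        rw [← hu, desc_cons, hj]
        obtain ⟨m, rfl⟩ : ∃ m, n = m + 1 := ⟨n - 1, by omega⟩
        rw [Nat.add_sub_cancel, Function.iterate_succ_apply',
          F.child_rank (F.iterate_parent_mem_verts hw m)]
      · have hval : F.reindex w n ((j - F.rank (parent^[n - 1] w) - 1) :: u) = x := by
          rw [F.reindex_of_pos w (by omega), Int.natAbs_natCast, ← hu]
          congr 2; omega
        exact ⟨(n, _ :: u), ⟨⟨hval.symm ▸ hx, fun h => by simp at h; omega⟩, by simp⟩, hval⟩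

lemma reindex_parent {v : Vertex} (hv : v ∈ (F.rebase w hw).verts) :
    F.reindex w (parent v).1 (parent v).2 = parent (F.reindex w v.1 v.2) := by
  have hm := reindex_mem hw hv
  obtain ⟨i, u⟩ := v
  rcases List.eq_nil_or_concat u with rfl | ⟨s, j, rfl⟩
  · have hi : i ≤ 0 := hv.2 rfl
    have : (i - 1).natAbs = i.natAbs + 1 := by omega
    have hp : parent (i, []) = (i - 1, []) := by simp [parent]
    rw [hp]
    simp only [reindex, this, Function.iterate_succ_apply']
  · simp only [List.concat_eq_append] at hm ⊢
    rcases eq_or_ne s [] with rfl | hs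
    · have hp : parent (i, [] ++ [j]) = (-|i|, []) := by simp [parent]
      have hd : ∃ k, F.reindex w i ([] ++ [j]) = F.child (parent^[i.natAbs] w) k := by
        simp only [reindex, List.nil_append]
        split_ifs
        · exact ⟨_, rfl⟩
        · exact ⟨_, rfl⟩
      obtain ⟨k, hk⟩ := hd
      rw [hp]
      simp only at hm ⊢
      rw [hk] at hm ⊢
      rw [F.parent_child hm]
      simp [reindex, Int.natAbs_abs]
    · have hp : parent (i, s ++ [j]) = (i, s) := by simp [parent, hs]
      rw [hp]
      simp only at hm ⊢
      rw [F.reindex_append w i hs] at hm ⊢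
      rw [F.parent_child hm]

lemma reindex_iterate_parent {v : Vertex} (hv : v ∈ (F.rebase w hw).verts) (k : ℕ) :
    F.reindex w (parent^[k] v).1 (parent^[k] v).2 = parent^[k] (F.reindex w v.1 v.2) := by
  induction k with
  | zero => rfl
  | succ k ih =>
    rw [Function.iterate_succ_apply', Function.iterate_succ_apply', ← ih,
      reindex_parent hw ((F.rebase w hw).iterate_parent_mem_verts hv k)]

lemma parent_reindex_eq_iff {v v' : Vertex} (hv : v ∈ (F.rebase w hw).verts)
    (hv' : v' ∈ (F.rebase w hw).verts) :
    parent (F.reindex w v.1 v.2) = F.reindex w v'.1 v'.2 ↔ parent v = v' := by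
  rw [← reindex_parent hw hv]
  exact ⟨fun h => reindex_injOn hw ((F.rebase w hw).parent_mem_verts hv) hv' h, by rintro rfl; rfl⟩

lemma numChildren_rebase {v : Vertex} (hv : v ∈ (F.rebase w hw).verts) :
    (F.rebase w hw).numChildren v = F.numChildren (F.reindex w v.1 v.2) := by
  have : {x ∈ F.verts | parent x = F.reindex w v.1 v.2} =
      (fun x : Vertex => F.reindex w x.1 x.2) '' {x ∈ (F.rebase w hw).verts | parent x = v} := by
    ext x
    constructor
    · rintro ⟨hx, hp⟩
      obtain ⟨y, hy, rfl⟩ := exists_reindex_eq hw hx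
      exact ⟨y, ⟨hy, (parent_reindex_eq_iff hw hy hv).1 hp⟩, rfl⟩
    · rintro ⟨y, ⟨hy, hp⟩, rfl⟩
      exact ⟨reindex_mem hw hy, (parent_reindex_eq_iff hw hy hv).2 hp⟩
  rw [numChildren, numChildren, this, Set.InjOn.ncard_image]
  intro a ha b hb h
  exact reindex_injOn hw ha.1 hb.1 h

lemma pos_rebase_sub {v : Vertex} (hv : v ∈ (F.rebase w hw).verts) :
    (F.rebase w hw).pos v - (F.rebase w hw).pos (parent v) =
      F.pos (F.reindex w v.1 v.2) - F.pos (parent (F.reindex w v.1 v.2)) := by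
  obtain ⟨i, u⟩ := v
  rcases eq_or_ne u [] with rfl | hu
  · have hi : i ≤ 0 := hv.2 rfl
    obtain ⟨n, rfl⟩ : ∃ n : ℕ, i = -(n : ℤ) := ⟨(-i).toNat, by omega⟩
    have := (F.rebase w hw).pos_spinePt_sub_pos_parent n
    simp only [spinePt] at this
    rw [this]
    simp [rebase, reindex, Function.iterate_succ_apply']
  · rw [pos_sub_pos_parent _ hu]
    simp only [rebase]
    rw [if_pos ⟨hu, hv.1⟩]

/-- Old and new positions have equal increments along every parent edge, so their difference is
constant along ancestral lines, and common ancestors make it the same everywhere. At the new base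
point it is the old position of `w`. -/
lemma pos_rebase {v : Vertex} (hv : v ∈ (F.rebase w hw).verts) :
    (F.rebase w hw).pos v = F.pos (F.reindex w v.1 v.2) - F.pos w := by
  have key : ∀ x ∈ (F.rebase w hw).verts, ∀ k : ℕ,
      (F.rebase w hw).pos (parent^[k] x) -
        F.pos (F.reindex w (parent^[k] x).1 (parent^[k] x).2) =
      (F.rebase w hw).pos x - F.pos (F.reindex w x.1 x.2) := by
    intro x hx k
    induction k with
    | zero => rfl
    | succ k ih =>
      rw [← ih, Function.iterate_succ_apply']
      have hk := (F.rebase w hw).iterate_parent_mem_verts hx k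
      have := pos_rebase_sub hw hk
      rw [reindex_parent hw hk]
      rw [sub_eq_sub_iff_add_eq_add] at this ⊢
      rw [add_comm, ← this, add_comm]
  obtain ⟨k, l, h⟩ := (F.rebase w hw).exists_iterate_parent_eq hv (F.rebase w hw).base_mem
  have h1 := key _ hv k
  have h2 := key _ (F.rebase w hw).base_mem l
  rw [← h, h1, pos_base] at h2
  have h3 : F.reindex w base.1 base.2 = w := rfl
  rw [h3, zero_sub] at h2
  rw [sub_eq_iff_eq_add.1 h2]; abel

lemma IsEnum.rebase {e : ℤ → Vertex} (he : F.IsEnum e) {k : ℤ} (hk : e k = w) :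
    ∃ e', (F.rebase w hw).IsEnum e' ∧ ∀ i, F.reindex w (e' i).1 (e' i).2 = e (i + k) := by
  choose e' he' h using fun i => exists_reindex_eq hw (he.mem (i + k))
  refine ⟨e', ⟨fun i j hij => ?_, ?_, ?_⟩, h⟩
  · by_contra hb
    rcases eq_or_ne (e' i) (e' j) with heq | hne
    · have := he.injective ((h i).symm.trans ((by rw [heq] : _ = _).trans (h j)))
      omega
    · have := reindex_before hw (he' j) (he' i)
        ((before_or_before_of_ne hne).resolve_left hb)
      rw [h, h, he.before_iff] at this
      omega
  · ext x
    constructor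
    · rintro ⟨i, rfl⟩; exact he' i
    · intro hx
      obtain ⟨i, hi⟩ := he.exists_eq (reindex_mem hw hx)
      refine ⟨i - k, reindex_injOn hw (he' _) hx ?_⟩
      rw [h, sub_add_cancel, hi]
  · refine reindex_injOn hw (he' 0) (F.rebase w hw).base_mem ?_
    rw [h, zero_add, hk]
    rfl

omit hw

lemma Good.reindex_shift_node (hF : F.Good) (i : ℤ) :
    F.reindex (F.node 1) (F.shift.node i).1 (F.shift.node i).2 = F.node (i + 1) := by
  obtain ⟨e', he', h⟩ := hF.isEnum.rebase (F.node_mem_verts 1) rfl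
  rw [shift, he'.node_eq, h]

lemma Good.shift (hF : F.Good) : F.shift.Good := by
  obtain ⟨e', he', h⟩ := hF.isEnum.rebase (F.node_mem_verts 1) rfl
  refine ⟨?_, fun x hx => ?_⟩
  · rw [Forest.shift, he'.node_eq]; exact he'
  · have hw := F.node_mem_verts 1
    refine Set.Finite.of_finite_image (f := fun v : Vertex => F.reindex (F.node 1) v.1 v.2)
      ((hF.finite _ (reindex_mem hw hx)).subset ?_)
      (fun a ha b hb h => reindex_injOn hw ha.1 hb.1 h)
    rintro _ ⟨y, ⟨hy, k, rfl⟩, rfl⟩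
    exact ⟨reindex_mem hw hy, k, (reindex_iterate_parent hw hy k).symm⟩

/-- Offspring numbers and displacements from the parent refer only to the tree rooted at infinity,
which the change of base point preserves. -/
lemma Good.code_shift (hF : F.Good) (i : ℤ) : F.shift.code i = F.code (i + 1) := by
  have hw := F.node_mem_verts 1
  have hv := F.shift.node_mem_verts i
  rw [code, code, ← hF.reindex_shift_node, label, label]
  exact Prod.ext (numChildren_rebase hw hv) (pos_rebase_sub hw hv)

lemma Good.parent_shift_node_iff (hF : F.Good) (i j : ℤ) :
    parent (F.shift.node i) = F.shift.node j ↔ parent (F.node (i + 1)) = F.node (j + 1) := by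
  rw [← hF.reindex_shift_node, ← hF.reindex_shift_node]
  exact (parent_reindex_eq_iff (F.node_mem_verts 1) (F.shift.node_mem_verts i)
    (F.shift.node_mem_verts j)).symm

lemma Good.X_shift (hF : F.Good) (i : ℤ) : F.shift.X i = F.X (i + 1) - F.X 1 := by
  rw [X, X, X, ← hF.reindex_shift_node]
  exact pos_rebase (F.node_mem_verts 1) (F.shift.node_mem_verts i)

end Forest

end SpineForest

namespace SpineForest

/-! ### Reading the genealogy in the offspring numbers -/

/-- `i` is an ancestor of `j` in the tree coded by the offspring numbers `c`, listed in
lexicographic order. -/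
def CodeAncestor (c : ℤ → ℕ) (i j : ℤ) : Prop :=
  ∀ l, i < l → l ≤ j → l - i ≤ ∑ k ∈ Finset.Ico i l, (c k : ℤ)

lemma CodeAncestor.congr {c c' : ℤ → ℕ} {i j : ℤ} (h : CodeAncestor c i j)
    (hc : ∀ k, i ≤ k → k < j → c k = c' k) : CodeAncestor c' i j := by
  intro l hl hlj
  refine (h l hl hlj).trans_eq (Finset.sum_congr rfl fun k hk => ?_)
  rw [Finset.mem_Ico] at hk
  rw [hc k hk.1 (by omega)]

open Classical in
/-- The descendants of the `n`-th ancestor of `0` have the numbers `a, …, b - 1`. -/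
structure IsWindow (n : ℕ) (c : ℤ → ℕ) (a b : ℤ) : Prop where
  le_zero : a ≤ 0
  pos : 0 < b
  card : ((Finset.Ico a 0).filter fun i => CodeAncestor c i 0).card = n
  ancestor : ∀ j, a ≤ j → j < b → CodeAncestor c a j
  not_ancestor : ¬ CodeAncestor c a b

/-- Testing ancestry of `j` only reads values before `j`, so even the failure at `b` is decided
inside `[a, b)`. A window is thus recognisable from its own content, like a stopping time. -/
lemma IsWindow.congr {n : ℕ} {c c' : ℤ → ℕ} {a b : ℤ} (h : IsWindow n c a b)
    (hc : ∀ k, a ≤ k → k < b → c k = c' k) : IsWindow n c' a b where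
  le_zero := h.le_zero
  pos := h.pos
  card := by
    have h0 := h.pos
    rw [← h.card]
    congr 1
    ext i
    simp only [Finset.mem_filter, Finset.mem_Ico, and_congr_right_iff]
    intro hi
    exact ⟨fun h' => h'.congr fun k h1 h2 => (hc k (by omega) (by omega)).symm,
      fun h' => h'.congr fun k h1 h2 => hc k (by omega) (by omega)⟩
  ancestor j h1 h2 := (h.ancestor j h1 h2).congr fun k h3 h4 => hc k h3 (by omega)
  not_ancestor h' := h.not_ancestor (h'.congr fun k h1 h2 => (hc k h1 h2).symm)

/-- The left end is itself an ancestor of `0`, so a window starting further left would contain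
strictly more ancestors. -/
lemma IsWindow.left_le {n : ℕ} {c : ℤ → ℕ} {a b a' b' : ℤ} (h : IsWindow n c a b)
    (h' : IsWindow n c a' b') : a ≤ a' := by
  classical
  by_contra! hlt
  have hss : (Finset.Ico a 0).filter (fun i => CodeAncestor c i 0) ⊂
      (Finset.Ico a' 0).filter (fun i => CodeAncestor c i 0) := by
    rw [Finset.ssubset_iff_of_subset]
    · refine ⟨a', ?_, ?_⟩
      · have := h.le_zero
        simp only [Finset.mem_filter, Finset.mem_Ico, le_refl, true_and]
        exact ⟨by omega, h'.ancestor 0 h'.le_zero h'.pos⟩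
      · simp only [Finset.mem_filter, Finset.mem_Ico]; omega
    · intro i
      simp only [Finset.mem_filter, Finset.mem_Ico]
      exact fun hi => ⟨by omega, hi.2⟩
  have := Finset.card_lt_card hss
  rw [h.card, h'.card] at this
  exact lt_irrefl _ this

lemma IsWindow.right_le {n : ℕ} {c : ℤ → ℕ} {a b b' : ℤ} (h : IsWindow n c a b)
    (h' : IsWindow n c a b') : b ≤ b' := by
  by_contra! hlt
  exact h'.not_ancestor (h.ancestor b' (h'.le_zero.trans h'.pos.le) hlt)

lemma IsWindow.unique {n : ℕ} {c : ℤ → ℕ} {a b a' b' : ℤ} (h : IsWindow n c a b)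
    (h' : IsWindow n c a' b') : a = a' ∧ b = b' := by
  obtain rfl := le_antisymm (h.left_le h') (h'.left_le h)
  exact ⟨rfl, le_antisymm (h.right_le h') (h'.right_le h)⟩

namespace Forest

variable {d : ℕ} {F : Forest d}

lemma Good.not_before_iff (hF : F.Good) {i j : ℤ} : ¬ Before (F.node i) (F.node j) ↔ j ≤ i := by
  rw [hF.isEnum.before_iff, not_lt]

lemma Good.le_of_isAncestor (hF : F.Good) {i j : ℤ} (h : IsAncestor (F.node i) (F.node j)) :
    i ≤ j :=
  hF.not_before_iff.1 (F.not_before_of_isAncestor (F.node_mem_verts j) h)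

lemma Good.exists_parent (hF : F.Good) (j : ℤ) : ∃ i < j, parent (F.node j) = F.node i := by
  obtain ⟨i, hi⟩ := hF.isEnum.exists_eq (F.parent_mem_verts (F.node_mem_verts j))
  refine ⟨i, ?_, hi.symm⟩
  rw [← hF.isEnum.before_iff, hi]
  exact F.parent_before (F.node_mem_verts j)

lemma Good.isAncestor_between (hF : F.Good) {i j k : ℤ} (hij : i ≤ j) (hjk : j ≤ k)
    (h : IsAncestor (F.node i) (F.node k)) : IsAncestor (F.node i) (F.node j) :=
  F.isAncestor_of_between (F.node_mem_verts j) (F.node_mem_verts k)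
    (hF.not_before_iff.2 hij) (hF.not_before_iff.2 hjk) h

lemma Good.isAncestor_parent_of_lt (hF : F.Good) {i j : ℤ} (hij : i < j)
    (h : IsAncestor (F.node i) (F.node j)) : IsAncestor (F.node i) (parent (F.node j)) := by
  refine (isAncestor_iff_eq_or_parent.1 h).resolve_left fun h' => ?_
  have := hF.isEnum.injective h'
  omega

lemma Good.sum_numChildren (hF : F.Good) (i l : ℤ) :
    ∑ k ∈ Finset.Ico i l, F.numChildren (F.node k) =
      {x ∈ F.verts | ∃ k, i ≤ k ∧ k < l ∧ parent x = F.node k}.ncard ∧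
      {x ∈ F.verts | ∃ k, i ≤ k ∧ k < l ∧ parent x = F.node k}.Finite := by
  classical
  have hfin (k : ℤ) := F.finite_children (F.node k) (F.node_mem_verts k)
  have hU : {x ∈ F.verts | ∃ k, i ≤ k ∧ k < l ∧ parent x = F.node k} =
      ((Finset.Ico i l).biUnion fun k => (hfin k).toFinset : Finset Vertex) := by
    ext x
    simp only [Set.mem_ofPred_eq, Finset.coe_biUnion, Finset.coe_Ico, Set.mem_Ico,
      Set.Finite.coe_toFinset, Set.mem_iUnion, exists_prop]
    constructor
    · rintro ⟨hx, k, h1, h2, h3⟩; exact ⟨k, ⟨h1, h2⟩, hx, h3⟩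
    · rintro ⟨k, ⟨h1, h2⟩, hx, h3⟩; exact ⟨hx, k, h1, h2, h3⟩
  rw [hU]
  refine ⟨?_, Finset.finite_toSet _⟩
  rw [Set.ncard_coe_finset, Finset.card_biUnion]
  · refine Finset.sum_congr rfl fun k _ => ?_
    rw [numChildren, Set.ncard_eq_toFinset_card _ (hfin k)]
  · intro k _ m _ hkm
    rw [Function.onFun, Finset.disjoint_left]
    intro x hx hx'
    simp only [Set.Finite.mem_toFinset, Set.mem_ofPred_eq] at hx hx'
    exact hkm (hF.isEnum.injective (hx.2.symm.trans hx'.2))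

/-- This is the Łukasiewicz path criterion, proved by counting. If `i` is an ancestor of `j`, then
`i + 1, …, l` all have their parents in `[i, l)`. If not, let `i + t` be the first non-descendant:
all children of `i, …, i + t - 1` have numbers strictly between `i` and `i + t`, so there are at
most `t - 1` of them. -/
lemma Good.isAncestor_node_iff (hF : F.Good) (i j : ℤ) (hij : i ≤ j) :
    IsAncestor (F.node i) (F.node j) ↔ CodeAncestor (fun k => (F.code k).1) i j := by
  constructor
  · intro h l hl hlj
    obtain ⟨hsum, hfin⟩ := hF.sum_numChildren i l
    have hsub : F.node '' (Finset.Ioc i l) ⊆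
        {x ∈ F.verts | ∃ k, i ≤ k ∧ k < l ∧ parent x = F.node k} := by
      rintro _ ⟨m, hm, rfl⟩
      simp only [Finset.coe_Ioc, Set.mem_Ioc] at hm
      have ha := hF.isAncestor_parent_of_lt hm.1
        (hF.isAncestor_between hm.1.le (hm.2.trans hlj) h)
      obtain ⟨k, hk, hp⟩ := hF.exists_parent m
      rw [hp] at ha
      exact ⟨F.node_mem_verts m, k, hF.le_of_isAncestor ha, by omega, hp⟩
    have := Set.ncard_le_ncard hsub hfin
    rw [Set.ncard_image_of_injective _ hF.isEnum.injective, Set.ncard_coe_finset, Int.card_Ioc,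
      ← hsum] at this
    simp only [code, label]
    rw [← Nat.cast_sum]
    omega
  · intro h
    by_contra hn
    have hex : ∃ t : ℕ, ¬ IsAncestor (F.node i) (F.node (i + t)) :=
      ⟨(j - i).toNat, by rwa [show i + ((j - i).toNat : ℤ) = j by omega]⟩
    classical
    have hsp := Nat.find_spec hex
    have hle : Nat.find hex ≤ (j - i).toNat :=
      Nat.find_min' hex (by rwa [show i + ((j - i).toNat : ℤ) = j by omega])
    have hmin : ∀ m < Nat.find hex, IsAncestor (F.node i) (F.node (i + m)) :=
      fun m hm => not_not.1 (Nat.find_min hex hm)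
    generalize Nat.find hex = t at hsp hle hmin
    have ht : 0 < t := by
      rcases Nat.eq_zero_or_pos t with rfl | ht
      · exact absurd (by simpa using IsAncestor.refl (F.node i)) hsp
      · exact ht
    obtain ⟨hsum, -⟩ := hF.sum_numChildren i (i + t)
    have hsub : {x ∈ F.verts | ∃ k, i ≤ k ∧ k < i + t ∧ parent x = F.node k} ⊆
        F.node '' (Finset.Ioo i (i + t)) := by
      rintro x ⟨hx, k, h1, h2, h3⟩
      obtain ⟨m, rfl⟩ := hF.isEnum.exists_eq hx
      have hk : IsAncestor (F.node i) (F.node m) := by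
        have := hmin (k - i).toNat (by omega)
        rw [show i + ((k - i).toNat : ℤ) = k by omega] at this
        exact this.trans (h3 ▸ isAncestor_parent _)
      have hkm : k < m := by
        rw [← hF.isEnum.before_iff, ← h3]; exact F.parent_before hx
      refine ⟨m, ?_, rfl⟩
      simp only [Finset.coe_Ioo, Set.mem_Ioo]
      refine ⟨by omega, ?_⟩
      by_contra! hm
      -- A child numbered `i + t` or more would, since descendants form an interval, make `i + t` a
      -- descendant.
      exact hsp (hF.isAncestor_between (by omega) hm hk)
    have := Set.ncard_le_ncard hsub ((Finset.finite_toSet _).image _)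
    rw [Set.ncard_image_of_injective _ hF.isEnum.injective, Set.ncard_coe_finset, Int.card_Ioo,
      ← hsum] at this
    have h' := h (i + t) (by omega) (by omega)
    simp only [code, label] at h'
    rw [← Nat.cast_sum] at h'
    omega

/-- The window starts at the number of the spine point and ends at the first non-descendant after
it, which exists because a good forest gives each vertex finitely many descendants. -/
lemma Good.exists_window (hF : F.Good) (n : ℕ) :
    ∃ a b, IsWindow n (fun k => (F.code k).1) a b ∧ F.node a = spinePt n ∧
      ∀ j, IsAncestor (spinePt n) (F.node j) ↔ a ≤ j ∧ j < b := by
  classical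
  choose h hh using fun k => hF.isEnum.exists_eq (F.spinePt_mem k)
  have h0 : F.node 0 = base := hF.isEnum.zero
  have hanti : ∀ k m, k < m → h m < h k := fun k m hkm => by
    rw [← hF.isEnum.before_iff, hh, hh]; exact before_spinePt hkm
  have hh0 : h 0 = 0 := hF.isEnum.injective (by rw [hh, h0]; rfl)
  have han : h n ≤ 0 := by
    rcases Nat.eq_zero_or_pos n with rfl | hn
    · exact hh0.le
    · exact hh0 ▸ (hanti 0 n hn).le
  have hex : ∃ t : ℕ, ¬ IsAncestor (F.node (h n)) (F.node (h n + t)) := by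
    by_contra! hall
    refine Set.infinite_of_injective_forall_mem
      (s := {y ∈ F.verts | IsAncestor (F.node (h n)) y}) (f := fun t : ℕ => F.node (h n + t)) ?_
      (fun t => ⟨F.node_mem_verts _, hall t⟩) (hF.finite _ (F.node_mem_verts (h n)))
    intro s t hst
    have := hF.isEnum.injective hst
    omega
  have hsp := Nat.find_spec hex
  have hmin : ∀ m < Nat.find hex, IsAncestor (F.node (h n)) (F.node (h n + m)) :=
    fun m hm => not_not.1 (Nat.find_min hex hm)
  generalize Nat.find hex = t at hsp hmin
  have hwin : ∀ j, IsAncestor (F.node (h n)) (F.node j) ↔ h n ≤ j ∧ j < h n + t := by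
    intro j
    refine ⟨fun hj => ⟨hF.le_of_isAncestor hj, ?_⟩, fun ⟨h1, h2⟩ => ?_⟩
    · by_contra! hlt
      exact hsp (hF.isAncestor_between (by omega) hlt hj)
    · have := hmin (j - h n).toNat (by omega)
      rwa [show h n + ((j - h n).toNat : ℤ) = j by omega] at this
  have hb : 0 < h n + t := ((hwin 0).1 (by
    rw [h0, hh]; exact isAncestor_spinePt (Nat.zero_le n))).2
  refine ⟨h n, h n + t, ⟨han, hb, ?_, ?_, ?_⟩, hh n, fun j => by rw [← hh n, hwin]⟩
  -- The ancestors of `0` in the window other than `0` are the spine points `1, …, n`.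
  · have : (Finset.Ico (h n) 0).filter (fun i => CodeAncestor (fun k => (F.code k).1) i 0) =
        (Finset.Icc 1 n).image h := by
      ext i
      simp only [Finset.mem_filter, Finset.mem_Ico, Finset.mem_image, Finset.mem_Icc]
      constructor
      · rintro ⟨⟨h1, h2⟩, h3⟩
        rw [← hF.isAncestor_node_iff i 0 h2.le, h0] at h3
        obtain ⟨k, hk⟩ := h3
        rw [iterate_parent_base, ← hh] at hk
        have hk' := hF.isEnum.injective hk
        subst hk'
        refine ⟨k, ⟨?_, ?_⟩, rfl⟩
        · rcases Nat.eq_zero_or_pos k with rfl | hk0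
          · omega
          · exact hk0
        · by_contra! hlt
          have := hanti _ _ hlt
          omega
      · rintro ⟨k, ⟨h1, h2⟩, rfl⟩
        have hk0 : h k < 0 := hh0 ▸ hanti 0 k h1
        refine ⟨⟨?_, hk0⟩, ?_⟩
        · rcases h2.lt_or_eq with h2 | rfl
          · exact (hanti k n h2).le
          · exact le_rfl
        · rw [← hF.isAncestor_node_iff _ 0 hk0.le, h0, hh]
          exact isAncestor_spinePt (Nat.zero_le k)
    rw [this, Finset.card_image_of_injOn, Nat.card_Icc, Nat.add_sub_cancel]
    intro k _ m _ hkm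
    exact spinePt_injective (by rw [← hh, ← hh, hkm])
  · intro j h1 h2
    rw [← hF.isAncestor_node_iff _ _ h1, hwin]
    exact ⟨h1, h2⟩
  · rw [← hF.isAncestor_node_iff _ _ (by omega), hwin]
    omega

/-! ### Reconstruction of the forest from its code -/

/-- `F` and `F₀` coincide up to the `n`-th point of the spine. -/
structure AgreeTo (n : ℕ) (F F₀ : Forest d) : Prop where
  tree : ∀ i : ℤ, i.natAbs ≤ n → F.tree i = F₀.tree i
  spine : ∀ k ≤ n, F.spine k = F₀.spine k

/-- The parent is the last proper ancestor in the exploration, so parenthood is expressible through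
ancestry, which the code determines. -/
lemma Good.parent_eq_iff (hF : F.Good) (i j : ℤ) : parent (F.node j) = F.node i ↔
    i < j ∧ IsAncestor (F.node i) (F.node j) ∧
      ∀ k, i < k → k < j → ¬ IsAncestor (F.node k) (F.node j) := by
  obtain ⟨p, hpj, hp⟩ := hF.exists_parent j
  constructor
  · intro h
    obtain rfl : p = i := hF.isEnum.injective (hp.symm.trans h)
    refine ⟨hpj, h ▸ isAncestor_parent _, fun k hk hkj hanc => ?_⟩
    have := hF.le_of_isAncestor (h ▸ hF.isAncestor_parent_of_lt hkj hanc)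
    omega
  · rintro ⟨hij, hanc, hmax⟩
    have h1 := hF.le_of_isAncestor (hp ▸ hF.isAncestor_parent_of_lt hij hanc)
    rcases h1.lt_or_eq with h1 | rfl
    · exact absurd (hp ▸ isAncestor_parent _) (hmax p h1 hpj)
    · exact hp

lemma Good.rank_node (hF : F.Good) (j : ℤ) :
    F.rank (F.node j) = {m | parent (F.node m) = parent (F.node j) ∧ m < j}.ncard := by
  rw [rank, ← Set.ncard_image_of_injective _ hF.isEnum.injective]
  congr 1
  ext w
  constructor
  · rintro ⟨hw, h1, h2⟩
    obtain ⟨m, rfl⟩ := hF.isEnum.exists_eq hw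
    exact ⟨m, ⟨h1, hF.isEnum.before_iff.1 h2⟩, rfl⟩
  · rintro ⟨m, ⟨h1, h2⟩, rfl⟩
    exact ⟨F.node_mem_verts m, h1, hF.isEnum.before _ _ h2⟩

/-- Inside the window the code yields ancestry, hence parents and ranks among siblings. Each vertex
is then rebuilt as the child of given rank of its parent, in the order of the exploration. -/
lemma Good.node_eq_of_code_eq {F₀ : Forest d} (hF : F.Good) (hF₀ : F₀.Good) {n : ℕ} {a b : ℤ}
    (hw : IsWindow n (fun k => (F₀.code k).1) a b)
    (h : ∀ k, a ≤ k → k < b → F.code k = F₀.code k) :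
    (∀ j, IsAncestor (spinePt n) (F.node j) ↔ a ≤ j ∧ j < b) ∧
    (∀ j, IsAncestor (spinePt n) (F₀.node j) ↔ a ≤ j ∧ j < b) ∧
    ∀ j, a ≤ j → j < b → F.node j = F₀.node j := by
  have hw' : IsWindow n (fun k => (F.code k).1) a b :=
    hw.congr fun k h1 h2 => by simp only [h k h1 h2]
  obtain ⟨a₁, b₁, hw₁, hna, hwin⟩ := hF.exists_window n
  obtain ⟨rfl, rfl⟩ := hw₁.unique hw'
  obtain ⟨a₁, b₁, hw₂, hna₀, hwin₀⟩ := hF₀.exists_window n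
  obtain ⟨rfl, rfl⟩ := hw₂.unique hw
  refine ⟨hwin, hwin₀, ?_⟩
  have hA : ∀ i j, a₁ ≤ i → j < b₁ →
      (IsAncestor (F.node i) (F.node j) ↔ IsAncestor (F₀.node i) (F₀.node j)) := by
    intro i j hi hj
    rcases le_or_gt i j with hij | hij
    · rw [hF.isAncestor_node_iff _ _ hij, hF₀.isAncestor_node_iff _ _ hij]
      exact ⟨fun h' => h'.congr fun k h1 h2 => by rw [h k (by omega) (by omega)],
        fun h' => h'.congr fun k h1 h2 => by rw [h k (by omega) (by omega)]⟩
    · exact ⟨fun h' => absurd (hF.le_of_isAncestor h') (not_le.2 hij),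
        fun h' => absurd (hF₀.le_of_isAncestor h') (not_le.2 hij)⟩
  have hB : ∀ i j, a₁ ≤ i → j < b₁ →
      (parent (F.node j) = F.node i ↔ parent (F₀.node j) = F₀.node i) := by
    intro i j hi hj
    rw [hF.parent_eq_iff, hF₀.parent_eq_iff, hA i j hi hj]
    refine and_congr_right fun _ => and_congr_right fun _ => forall_congr' fun k =>
      imp_congr_right fun hk => ?_
    rw [hA k j (by omega) hj]
  have hpar : ∀ j, a₁ < j → j < b₁ → ∃ i, a₁ ≤ i ∧ i < j ∧ parent (F.node j) = F.node i ∧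
      parent (F₀.node j) = F₀.node i := by
    intro j h1 h2
    obtain ⟨i, hij, hi⟩ := hF₀.exists_parent j
    have : IsAncestor (F₀.node a₁) (F₀.node i) := by
      rw [← hi]
      refine hF₀.isAncestor_parent_of_lt h1 ?_
      rw [hna₀, hwin₀]
      exact ⟨h1.le, h2⟩
    have hle := hF₀.le_of_isAncestor this
    exact ⟨i, hle, hij, (hB i j hle h2).2 hi, hi⟩
  have hrank : ∀ j, a₁ < j → j < b₁ → F.rank (F.node j) = F₀.rank (F₀.node j) := by
    intro j h1 h2
    rw [hF.rank_node, hF₀.rank_node]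
    obtain ⟨i, h3, h4, h5, h6⟩ := hpar j h1 h2
    rw [h5, h6]
    congr 1
    ext m
    exact and_congr_left fun hm => hB i m h3 (hm.trans h2)
  have hspine : ∀ k ≤ n, ∃ i, a₁ ≤ i ∧ i < b₁ ∧ F.node i = spinePt k ∧ F₀.node i = spinePt k := by
    intro k
    induction k with
    | zero => exact fun _ => ⟨0, hw.le_zero, hw.pos, hF.isEnum.zero, hF₀.isEnum.zero⟩
    | succ k ih =>
      intro hk
      obtain ⟨i, h1, h2, h3, h4⟩ := ih (by omega)
      have hlt : a₁ < i := lt_of_le_of_ne h1 (by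
        rintro rfl
        have := spinePt_injective (hna.symm.trans h3)
        omega)
      obtain ⟨p, h5, h6, h7, h8⟩ := hpar i hlt h2
      exact ⟨p, h5, h6.trans h2, by rw [← h7, h3, parent_spinePt],
        by rw [← h8, h4, parent_spinePt]⟩
  -- `child` depends on the forest only at the spine points `m + 1`, through the number of children
  -- in the left tree; this number is the rank of the spine point `m`, on which the two forests
  -- already agree.
  have main : ∀ t : ℕ, a₁ + t < b₁ → F.node (a₁ + t) = F₀.node (a₁ + t) := by
    intro t
    induction t using Nat.strong_induction_on with
    | _ t ih =>
      intro ht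
      rcases Nat.eq_zero_or_pos t with rfl | htpos
      · simp only [Nat.cast_zero, add_zero]
        rw [hna, hna₀]
      · obtain ⟨i, h1, h2, h3, h4⟩ := hpar (a₁ + t) (by omega) ht
        have hi := ih (i - a₁).toNat (by omega) (by omega)
        rw [show a₁ + ((i - a₁).toNat : ℤ) = i by omega] at hi
        rw [← F.child_rank (F.node_mem_verts (a₁ + t)),
          ← F₀.child_rank (F₀.node_mem_verts (a₁ + t)), hrank _ (by omega) ht, h3, h4, hi]
        generalize F₀.rank (F₀.node (a₁ + t)) = r
        rcases F₀.vertex_cases (F₀.node_mem_verts i) with ⟨k, x, hx, hk⟩ | ⟨m, hm⟩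
        · rw [hx, child_of_ne F hk, child_of_ne F₀ hk]
        · have hmn : m + 1 ≤ n := by
            have := (hwin₀ i).2 ⟨h1, by omega⟩
            rw [F₀.isAncestor_spinePt_iff (F₀.node_mem_verts i), hm] at this
            simp only [spinePt] at this
            omega
          obtain ⟨q, g1, g2, g3, g4⟩ := hspine m (by omega)
          have hlt : a₁ < q := lt_of_le_of_ne g1 (by
            rintro rfl
            have := spinePt_injective (hna.symm.trans g3)
            omega)
          have hr := hrank q hlt g2
          rw [g3, g4, rank_spinePt, rank_spinePt] at hr
          rw [hm, child_spinePt, child_spinePt, hr]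
  intro j h1 h2
  have := main (j - a₁).toNat (by omega)
  rwa [show a₁ + ((j - a₁).toNat : ℤ) = j by omega] at this

/-- The code determines the forest. -/
lemma Good.agreeTo_of_code_eq {F₀ : Forest d} (hF : F.Good) (hF₀ : F₀.Good) {n : ℕ} {a b : ℤ}
    (hw : IsWindow n (fun k => (F₀.code k).1) a b)
    (h : ∀ k, a ≤ k → k < b → F.code k = F₀.code k) : AgreeTo n F F₀ := by
  obtain ⟨hwin, hwin₀, hnode⟩ := hF.node_eq_of_code_eq hF₀ hw h
  -- Both forests list their vertices up to level `n` by the same numbers `[a, b)`, and these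
  -- numbers name the same vertices.
  have hv : ∀ v : Vertex, v.1.natAbs ≤ n → (v ∈ F.verts ↔ v ∈ F₀.verts) := by
    intro v hv
    constructor
    · intro hm
      obtain ⟨j, rfl⟩ := hF.isEnum.exists_eq hm
      obtain ⟨h1, h2⟩ := (hwin j).1 ((F.isAncestor_spinePt_iff hm).2 hv)
      rw [hnode j h1 h2]
      exact F₀.node_mem_verts j
    · intro hm
      obtain ⟨j, rfl⟩ := hF₀.isEnum.exists_eq hm
      obtain ⟨h1, h2⟩ := (hwin₀ j).1 ((F₀.isAncestor_spinePt_iff hm).2 hv)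
      rw [← hnode j h1 h2]
      exact F.node_mem_verts j
  have hlab : ∀ v ∈ F.verts, v.1.natAbs ≤ n →
      F.pos v - F.pos (parent v) = F₀.pos v - F₀.pos (parent v) := by
    intro v hm hv
    obtain ⟨j, rfl⟩ := hF.isEnum.exists_eq hm
    obtain ⟨h1, h2⟩ := (hwin j).1 ((F.isAncestor_spinePt_iff hm).2 hv)
    have := congrArg Prod.snd (h j h1 h2)
    simp only [code, label, ← hnode j h1 h2] at this
    exact this
  refine ⟨fun i hi => ?_, fun k hk => ?_⟩
  · have hnodes : ∀ u, u ∈ (F.tree i).nodes ↔ u ∈ (F₀.tree i).nodes := by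
      intro u
      rcases eq_or_ne u [] with rfl | hu
      · exact iff_of_true (F.tree i).root_mem (F₀.tree i).root_mem
      · have := hv (i, u) hi
        simpa [verts, hu] using this
    ext u : 2
    · exact hnodes u
    · by_cases hu : u = []
      · rw [hu, (F.tree i).disp_root, (F₀.tree i).disp_root]
      · by_cases hm : u ∈ (F.tree i).nodes
        · have := hlab (i, u) ⟨hm, fun h => absurd h hu⟩ hi
          rwa [pos_sub_pos_parent F hu, pos_sub_pos_parent F₀ hu] at this
        · rw [(F.tree i).disp_of_notMem u hm,
            (F₀.tree i).disp_of_notMem u (fun h => hm ((hnodes u).2 h))]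
  · have := hlab (spinePt k) (F.spinePt_mem k) (by simpa [spinePt] using hk)
    rwa [pos_spinePt_sub_pos_parent, pos_spinePt_sub_pos_parent, neg_inj] at this

lemma natAbs_le_parent {v : Vertex} (hv : v ∈ F.verts) :
    v.1.natAbs ≤ (parent v).1.natAbs := by
  obtain ⟨i, u⟩ := v
  simp only [parent]
  split_ifs with h1 h2
  · have := hv.2 h1
    simp only at this ⊢
    omega
  · simp [Int.natAbs_abs]
  · exact le_rfl

end Forest

end SpineForest

namespace SpineForest

namespace Forest

variable {d : ℕ}

/-! ### Forests of finite trees -/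

/-- A forest of finite trees, with infinitely many vertices on the right of the spine, is listed by
the exploration. -/
lemma good_of_finite (F : Forest d) (hfin : ∀ i, (F.tree i).nodes.Finite)
    (hinf : ∀ m : ℕ, ∃ i : ℕ, m < i ∧ [0] ∈ (F.tree i).nodes) : F.Good := by
  have hlevel : ∀ n : ℕ, {v ∈ F.verts | v.1.natAbs ≤ n}.Finite := by
    intro n
    refine ((Set.finite_Icc (-(n : ℤ)) n).biUnion
      fun i _ => (hfin i).image fun u => (i, u)).subset ?_
    rintro ⟨i, u⟩ ⟨hv, hi⟩
    simp only at hi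
    simp only [Set.mem_iUnion]
    exact ⟨i, ⟨by omega, by omega⟩, u, hv.1, rfl⟩
  -- The vertices form a locally finite linear order without extremal elements, hence one isomorphic
  -- to `ℤ`. The isomorphism is then translated so that the base point gets number `0`.
  let S : Set (ℤ ×ₗ List ℕ) := {x | ofLex x ∈ F.verts}
  have hicc : ∀ x y : S, (Set.Icc x y).Finite := by
    intro x y
    refine Set.Finite.of_finite_image (f := fun z : S => ofLex z.1)
      ((hlevel (max (ofLex x.1).1.natAbs (ofLex y.1).1.natAbs)).subset ?_)
      (fun a _ b _ h => Subtype.ext (ofLex.injective h))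
    rintro _ ⟨z, ⟨h1, h2⟩, rfl⟩
    refine ⟨z.2, ?_⟩
    rw [← Subtype.coe_le_coe, Prod.Lex.le_iff] at h1 h2
    simp only
    omega
  let _ : LocallyFiniteOrder S := LocallyFiniteOrder.ofFiniteIcc hicc
  let _ : SuccOrder S := LinearLocallyFiniteOrder.succOrder S
  let _ : PredOrder S := LinearLocallyFiniteOrder.predOrder S
  have : Nonempty S := ⟨⟨toLex base, F.base_mem⟩⟩
  have : NoMaxOrder S := by
    refine ⟨fun x => ?_⟩
    obtain ⟨i, hi, hm⟩ := hinf (ofLex x.1).1.natAbs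
    refine ⟨⟨toLex ((i : ℤ), [0]), hm, fun h => by simp at h⟩, ?_⟩
    rw [← Subtype.coe_lt_coe, Prod.Lex.lt_iff]
    left
    simp only [ofLex_toLex]
    omega
  have : NoMinOrder S := by
    refine ⟨fun x => ⟨⟨toLex (spinePt ((ofLex x.1).1.natAbs + 1)), F.spinePt_mem _⟩, ?_⟩⟩
    rw [← Subtype.coe_lt_coe, Prod.Lex.lt_iff]
    left
    simp only [ofLex_toLex, spinePt]
    omega
  let e₀ : S ≃o ℤ := orderIsoIntOfLinearSuccPredArch
  have he : F.IsEnum fun i => ofLex (e₀.symm (i + e₀ ⟨toLex base, F.base_mem⟩)).1 := by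
    refine ⟨fun i j hij => ?_, ?_, ?_⟩
    · simp only [SpineForest.before_iff, toLex_ofLex, Subtype.coe_lt_coe]
      exact e₀.symm.strictMono (by omega)
    · ext v
      constructor
      · rintro ⟨i, rfl⟩
        exact (e₀.symm _).2
      · intro hv
        exact ⟨e₀ ⟨toLex v, hv⟩ - e₀ ⟨toLex base, F.base_mem⟩, by simp⟩
    · simp
  refine ⟨he.node_eq ▸ he, fun x hx => (hlevel (parent x).1.natAbs).subset ?_⟩
  rintro y ⟨hy, hxy⟩
  have h1 : IsAncestor (spinePt x.1.natAbs) y :=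
    ((F.isAncestor_spinePt_iff hx).2 le_rfl).trans hxy
  exact ⟨hy, ((F.isAncestor_spinePt_iff hy).1 h1).trans (natAbs_le_parent hx)⟩

/-! ### Measurability -/

lemma measurable_coord : Measurable (fun F : Forest d =>
    ((fun (i : ℤ) (u : List ℕ) => u ∈ (F.tree i).nodes,
        fun (i : ℤ) (u : List ℕ) => (F.tree i).disp u,
        F.spine) : (ℤ → List ℕ → Prop) × (ℤ → List ℕ → Site d) × (ℕ → Site d))) :=
  comap_measurable _

lemma measurableSet_mem_nodes (i : ℤ) (u : List ℕ) :
    MeasurableSet {F : Forest d | u ∈ (F.tree i).nodes} := by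
  have := measurable_coord (d := d)
  exact measurableSet_setOfPred.2
    ((measurable_pi_apply u).comp ((measurable_pi_apply i).comp this.fst))

lemma measurable_disp (i : ℤ) (u : List ℕ) :
    Measurable fun F : Forest d => (F.tree i).disp u := by
  have := measurable_coord (d := d)
  exact (measurable_pi_apply u).comp ((measurable_pi_apply i).comp this.snd.fst)

lemma measurable_spine (n : ℕ) : Measurable fun F : Forest d => F.spine n := by
  have := measurable_coord (d := d)
  exact (measurable_pi_apply n).comp this.snd.snd

lemma measurable_of_coord {α : Type*} [MeasurableSpace α] {f : α → Forest d}
    (h1 : ∀ i u, MeasurableSet {x | u ∈ ((f x).tree i).nodes})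
    (h2 : ∀ i u, Measurable fun x => ((f x).tree i).disp u)
    (h3 : ∀ n, Measurable fun x => (f x).spine n) : Measurable f := by
  refine measurable_comap_iff.2 (Measurable.prodMk ?_ (Measurable.prodMk ?_ ?_))
  · exact measurable_pi_iff.2 fun i => measurable_pi_iff.2 fun u => measurableSet_setOfPred.1 (h1 i u)
  · exact measurable_pi_iff.2 fun i => measurable_pi_iff.2 fun u => h2 i u
  · exact measurable_pi_iff.2 h3

/-- Words carry the discrete σ-algebra. -/
local instance : MeasurableSpace (List ℕ) := ⊤

local instance : DiscreteMeasurableSpace (List ℕ) := ⟨fun _ => trivial⟩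

/-- Vertices are countable, so a random vertex may be substituted into any family of measurable
functions. -/
lemma measurable_comp_vertex {α β : Type*} [MeasurableSpace α] [MeasurableSpace β]
    {f : Vertex → α → β} {g : α → Vertex} (hf : ∀ v, Measurable (f v)) (hg : Measurable g) :
    Measurable fun x => f (g x) x := by
  have h : Measurable fun p : Vertex × α => f p.1 p.2 := measurable_from_prod_countable_right hf
  exact h.comp (hg.prodMk measurable_id)

lemma measurable_ncard_of {α β : Type*} [MeasurableSpace α] [Countable β] {p : α → β → Prop}
    (h : ∀ b, MeasurableSet {x | p x b}) : Measurable fun x => {b | p x b}.ncard :=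
  measurable_ncard.comp (measurable_set_iff.2 fun b => measurableSet_setOfPred.1 (h b))

lemma measurable_encard_of {α β : Type*} [MeasurableSpace α] [Countable β] {p : α → β → Prop}
    (h : ∀ b, MeasurableSet {x | p x b}) : Measurable fun x => {b | p x b}.encard :=
  measurable_encard.comp (measurable_set_iff.2 fun b => measurableSet_setOfPred.1 (h b))

lemma measurableSet_mem_verts (v : Vertex) : MeasurableSet {F : Forest d | v ∈ F.verts} :=
  (measurableSet_mem_nodes v.1 v.2).inter (MeasurableSet.const _)

lemma measurable_pos (v : Vertex) : Measurable fun F : Forest d => F.pos v := by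
  refine Measurable.add (Finset.measurable_sum _ fun n _ => measurable_spine n)
    (Finset.measurable_sum _ fun m _ => measurable_disp _ _)

lemma measurable_offspring (i : ℤ) (u : List ℕ) :
    Measurable fun F : Forest d => (F.tree i).offspring u :=
  measurable_ncard_of fun _ => measurableSet_mem_nodes _ _

lemma measurable_numChildren (v : Vertex) : Measurable fun F : Forest d => F.numChildren v :=
  measurable_ncard_of fun w => (measurableSet_mem_verts w).inter (MeasurableSet.const _)

lemma measurable_rank (v : Vertex) : Measurable fun F : Forest d => F.rank v :=
  measurable_ncard_of fun w => (measurableSet_mem_verts w).inter (MeasurableSet.const _)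

lemma measurableSet_isNode (n : ℤ) (v : Vertex) :
    MeasurableSet {F : Forest d | F.IsNode n v} := by
  refine (measurableSet_mem_verts v).inter (MeasurableSet.inter ?_ ?_)
  · exact (measurable_encard_of fun w => (measurableSet_mem_verts w).inter
      (MeasurableSet.const _)) (measurableSet_singleton _)
  · exact (measurable_encard_of fun w => (measurableSet_mem_verts w).inter
      (MeasurableSet.const _)) (measurableSet_singleton _)

/-- Uniqueness makes the arbitrary choice in `node` harmless, which its measurability requires. It
holds on every forest: a later vertex has strictly more predecessors after the base point, or
strictly fewer successors before it. -/
lemma isNode_unique {F : Forest d} {n : ℤ} {v w : Vertex} (hv : F.IsNode n v)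
    (hw : F.IsNode n w) : v = w := by
  wlog h : Before v w generalizing v w
  · by_contra hne
    exact hne (this hw hv ((before_or_before_of_ne hne).resolve_left h)).symm
  exfalso
  obtain ⟨hv0, hv1, hv2⟩ := hv
  obtain ⟨hw0, hw1, hw2⟩ := hw
  rcases le_total 0 n with hn | hn
  · have hvb : ¬ Before v base := by
      intro hb
      rw [show (-n).toNat = 0 by omega, Nat.cast_zero, Set.encard_eq_zero] at hv2
      exact Set.eq_empty_iff_forall_notMem.1 hv2 v ⟨hv0, before_irrefl v, hb⟩
    have hfin : {x ∈ F.verts | ¬ Before x base ∧ Before x w}.Finite :=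
      Set.finite_of_encard_eq_coe hw1
    have hss : {x ∈ F.verts | ¬ Before x base ∧ Before x v} ⊂
        {x ∈ F.verts | ¬ Before x base ∧ Before x w} := by
      refine (Set.ssubset_iff_of_subset ?_).2 ⟨v, ⟨hv0, hvb, h⟩, fun h' => before_irrefl v h'.2.2⟩
      rintro x ⟨h1, h2, h3⟩
      exact ⟨h1, h2, h3.trans h⟩
    have hlt := (hfin.subset hss.subset).encard_lt_encard hss
    rw [hv1, hw1] at hlt
    exact lt_irrefl _ hlt
  · have hwb : ¬ Before base w := by
      intro hb
      rw [show n.toNat = 0 by omega, Nat.cast_zero, Set.encard_eq_zero] at hw1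
      exact Set.eq_empty_iff_forall_notMem.1 hw1 base ⟨F.base_mem, before_irrefl _, hb⟩
    have hvb : Before v base := by
      rcases eq_or_ne w base with rfl | hne
      · exact h
      · exact h.trans ((before_or_before_of_ne hne).resolve_right hwb)
    have hfin : {x ∈ F.verts | ¬ Before x v ∧ Before x base}.Finite :=
      Set.finite_of_encard_eq_coe hv2
    have hss : {x ∈ F.verts | ¬ Before x w ∧ Before x base} ⊂
        {x ∈ F.verts | ¬ Before x v ∧ Before x base} := by
      refine (Set.ssubset_iff_of_subset ?_).2
        ⟨v, ⟨hv0, before_irrefl v, hvb⟩, fun h' => h'.2.1 h⟩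
      rintro x ⟨h1, h2, h3⟩
      exact ⟨h1, fun h' => h2 (h'.trans h), h3⟩
    have hlt := (hfin.subset hss.subset).encard_lt_encard hss
    rw [hv2, hw2] at hlt
    exact lt_irrefl _ hlt

lemma measurable_node (n : ℤ) : Measurable fun F : Forest d => F.node n := by
  refine measurable_to_countable' fun v => ?_
  have : (fun F : Forest d => F.node n) ⁻¹' {v} =
      {F | F.IsNode n v} ∪ ((⋂ w, {F : Forest d | F.IsNode n w}ᶜ) ∩ {_F | base = v}) := by
    ext F
    simp only [Set.mem_preimage, Set.mem_singleton_iff, Set.mem_union, Set.mem_inter_iff,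
      Set.mem_iInter, Set.mem_compl_iff, Set.mem_ofPred_eq]
    by_cases h : ∃ w, F.IsNode n w
    · have hs : F.IsNode n (F.node n) := by rw [node, dif_pos h]; exact h.choose_spec
      constructor
      · rintro rfl; exact Or.inl hs
      · rintro (h' | h')
        · exact isNode_unique hs h'
        · exact absurd hs (h'.1 _)
    · rw [node, dif_neg h]
      push Not at h
      constructor
      · exact fun h' => Or.inr ⟨h, h'⟩
      · rintro (h' | h')
        · exact absurd h' (h v)
        · exact h'.2
  rw [this]
  exact (measurableSet_isNode n v).union ((MeasurableSet.iInter fun w =>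
    (measurableSet_isNode n w).compl).inter (MeasurableSet.const _))

lemma measurable_code (i : ℤ) : Measurable fun F : Forest d => F.code i :=
  measurable_comp_vertex (f := fun v F => F.label v)
    (fun v => (measurable_numChildren v).prodMk ((measurable_pos v).sub (measurable_pos _)))
    (measurable_node i)

lemma measurable_X (i : ℤ) : Measurable fun F : Forest d => F.X i :=
  measurable_comp_vertex measurable_pos (measurable_node i)

lemma measurable_child (v : Vertex) (j : ℕ) : Measurable fun F : Forest d => F.child v j := by
  have h := measurable_offspring (d := d) v.1 []
  unfold child
  refine Measurable.ite (MeasurableSet.const _) measurable_const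
    (Measurable.ite (MeasurableSet.const _) (Measurable.ite ?_ measurable_const
      (Measurable.ite ?_ measurable_const ?_)) measurable_const)
  · exact measurableSet_lt measurable_const h
  · exact measurableSet_eq_fun measurable_const h
  · exact (Measurable.of_discrete (f := fun k : ℕ => ((-v.1, [j - k - 1]) : Vertex))).comp h

lemma measurable_desc (v : Vertex) (u : List ℕ) : Measurable fun F : Forest d => F.desc v u := by
  induction u using List.reverseRecOn with
  | nil => exact measurable_const
  | append_singleton u j ih =>
    simp only [desc_append]
    exact measurable_comp_vertex (f := fun v F => F.child v j) (fun v => measurable_child v j) ih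

lemma measurable_reindex (w : Vertex) (i : ℤ) (u : List ℕ) :
    Measurable fun F : Forest d => F.reindex w i u := by
  cases u with
  | nil => exact measurable_const
  | cons j u =>
    simp only [reindex]
    refine Measurable.ite (MeasurableSet.const _) ?_ (measurable_desc _ _)
    generalize parent^[i.natAbs] w = a
    generalize parent^[i.natAbs - 1] w = b
    have h : Measurable fun p : ℕ × Forest d => p.2.desc a ((p.1 + 1 + j) :: u) :=
      measurable_from_prod_countable_right fun k => measurable_desc a ((k + 1 + j) :: u)
    have h2 := h.comp ((measurable_rank b).prodMk measurable_id)
    simpa only [Function.comp_def, id] using h2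

lemma measurableSet_mem_rebaseNodes (w : Vertex) (i : ℤ) (u : List ℕ) :
    MeasurableSet {F : Forest d | u ∈ F.rebaseNodes w i} := by
  have h1 : MeasurableSet {F : Forest d | F.reindex w i u ∈ F.verts} := by
    have h := measurable_comp_vertex (f := fun v (F : Forest d) => v ∈ F.verts)
      (fun v => measurableSet_setOfPred.1 (measurableSet_mem_verts v)) (measurable_reindex w i u)
    exact measurableSet_setOfPred.2 h
  have h2 : MeasurableSet {F : Forest d |
      i < 0 → ∀ j ∈ u.head?, j < F.rank (parent^[i.natAbs - 1] w)} := by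
    generalize parent^[i.natAbs - 1] w = b
    exact measurable_rank b
      (MeasurableSet.of_discrete (s := {r : ℕ | i < 0 → ∀ j ∈ u.head?, j < r}))
  exact h1.inter h2

lemma measurable_shift : Measurable (Forest.shift : Forest d → Forest d) := by
  classical
  refine measurable_of_coord (fun i u => ?_) (fun i u => ?_) (fun n => ?_)
  · exact measurableSet_setOfPred.2 (measurable_comp_vertex
      (f := fun w (F : Forest d) => u ∈ F.rebaseNodes w i)
      (fun w => measurableSet_setOfPred.1 (measurableSet_mem_rebaseNodes w i u)) (measurable_node 1))
  · refine measurable_comp_vertex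
      (f := fun w (F : Forest d) => if u ≠ [] ∧ u ∈ F.rebaseNodes w i then
          F.pos (F.reindex w i u) - F.pos (parent (F.reindex w i u)) else 0)
      (fun w => ?_) (measurable_node 1)
    refine Measurable.ite ((MeasurableSet.const _).inter (measurableSet_mem_rebaseNodes w i u))
      ?_ measurable_const
    exact measurable_comp_vertex (f := fun v (F : Forest d) => F.pos v - F.pos (parent v))
      (fun v => (measurable_pos v).sub (measurable_pos _)) (measurable_reindex w i u)
  · exact measurable_comp_vertex
      (f := fun w (F : Forest d) => F.pos (parent^[n + 1] w) - F.pos (parent^[n] w))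
      (fun w => (measurable_pos _).sub (measurable_pos _)) (measurable_node 1)

end Forest

end SpineForest

namespace SpineForest

variable {d : ℕ}

/-! ### The law of the forest -/

lemma spineLaw_singleton (μ : PMF ℕ) (p : ℕ × ℕ) : spineLaw μ {p} = μ (p.1 + p.2 + 1) := by
  rw [spineLaw, Measure.sum_apply _ (measurableSet_singleton _), tsum_eq_single p]
  · simp
  · intro q hq
    simp [hq]

lemma isProbabilityMeasure_spineLaw {μ : PMF ℕ} (hmean : ∑' k : ℕ, (k : ENNReal) * μ k = 1) :
    IsProbabilityMeasure (spineLaw μ) := by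
  refine ⟨?_⟩
  rw [spineLaw, Measure.sum_apply _ MeasurableSet.univ]
  simp only [Measure.smul_apply, measure_univ, smul_eq_mul, mul_one]
  -- There are `n + 1` pairs with sum `n`, so the total mass is the sum of `(n + 1) μ (n + 1)`, the
  -- mean of `μ`.
  rw [← Finset.HasAntidiagonal.sigmaAntidiagonalEquivProd.tsum_eq, ENNReal.tsum_sigma', ← hmean]
  have h0 : ∑' k : ℕ, (k : ENNReal) * μ k = ∑' k : ℕ, ((k + 1 : ℕ) : ENNReal) * μ (k + 1) := by
    rw [tsum_eq_zero_add' ENNReal.summable]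
    simp
  rw [h0]
  refine tsum_congr fun n => ?_
  have : ∀ p : Finset.HasAntidiagonal.antidiagonal n,
      μ ((Finset.HasAntidiagonal.sigmaAntidiagonalEquivProd ⟨n, p⟩).1 +
        (Finset.HasAntidiagonal.sigmaAntidiagonalEquivProd ⟨n, p⟩).2 + 1) = μ (n + 1) := by
    rintro ⟨p, hp⟩
    rw [Finset.HasAntidiagonal.mem_antidiagonal] at hp
    simp [Finset.HasAntidiagonal.sigmaAntidiagonalEquivProd, hp]
  rw [tsum_congr this, tsum_fintype]
  simp

lemma isProbabilityMeasure_labelLaw {μ : PMF ℕ} (hmean : ∑' k : ℕ, (k : ENNReal) * μ k = 1)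
    (θ : PMF (Site d)) : IsProbabilityMeasure (labelLaw μ θ) := by
  have := isProbabilityMeasure_spineLaw hmean
  unfold labelLaw
  infer_instance

lemma measurable_labelOffspring (i : ℤ) (u : List ℕ) :
    Measurable fun ω : Labels d => labelOffspring ω i u := by
  unfold labelOffspring
  refine Measurable.ite (MeasurableSet.const _) ?_ (Measurable.ite (MeasurableSet.const _) ?_ ?_)
  · exact ((measurable_pi_apply _).comp measurable_snd.fst).fst
  · exact ((measurable_pi_apply _).comp measurable_snd.fst).snd
  · exact (measurable_pi_apply _).comp measurable_fst

lemma measurableSet_mem_grow (i : ℤ) (u : List ℕ) : MeasurableSet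
    {ω : Labels d | ∀ p j, p ++ [j] <+: u → j < labelOffspring ω i p} := by
  simp only [Set.ofPred_forall]
  exact MeasurableSet.iInter fun p => MeasurableSet.iInter fun j => MeasurableSet.iInter fun _ =>
    measurableSet_lt measurable_const (measurable_labelOffspring i p)

lemma measurable_build : Measurable (build : Labels d → Forest d) := by
  classical
  refine Forest.measurable_of_coord (measurableSet_mem_grow) (fun i u => ?_) (fun n => ?_)
  · simp only [build, SpatialTree.grow]
    refine Measurable.ite ((MeasurableSet.const _).inter (measurableSet_mem_grow i u)) ?_
      measurable_const
    exact (measurable_pi_apply _).comp measurable_snd.snd.fst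
  · exact (measurable_pi_apply _).comp measurable_snd.snd.snd

lemma isProbabilityMeasure_forestLaw {μ : PMF ℕ} (hmean : ∑' k : ℕ, (k : ENNReal) * μ k = 1)
    (θ : PMF (Site d)) : IsProbabilityMeasure (forestLaw μ θ) := by
  have := isProbabilityMeasure_labelLaw hmean θ
  exact Measure.isProbabilityMeasure_map measurable_build.aemeasurable

/-! ### Trees grown from labels -/

namespace SpatialTree

lemma append_mem_grow_iff (c : List ℕ → ℕ) (x : List ℕ → Site d) (u : List ℕ) (j : ℕ) :
    u ++ [j] ∈ (grow c x).nodes ↔ u ∈ (grow c x).nodes ∧ j < c u := by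
  constructor
  · intro h
    exact ⟨(grow c x).parent_mem u j h, h u j List.prefix_rfl⟩
  · rintro ⟨hu, h⟩ p i hp
    rcases List.prefix_concat_iff.1 hp with h' | h'
    · obtain ⟨rfl, h''⟩ := List.append_inj' h' rfl
      obtain rfl : i = j := by simpa using h''
      exact h
    · exact hu p i h'

lemma offspring_grow (c : List ℕ → ℕ) (x : List ℕ → Site d) {u : List ℕ}
    (hu : u ∈ (grow c x).nodes) : (grow c x).offspring u = c u := by
  refine eq_of_forall_lt_iff fun j => ?_
  rw [← append_mem_iff _ hu, append_mem_grow_iff]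
  simp [hu]

lemma disp_grow (c : List ℕ → ℕ) (x : List ℕ → Site d) {u : List ℕ}
    (hu : u ∈ (grow c x).nodes) (h : u ≠ []) : (grow c x).disp u = x u :=
  if_pos ⟨h, hu⟩

/-- Growing a given tree constrains only the labels at its own nodes. For a finite tree this is a
finite box in the space of labels. -/
lemma grow_eq_iff (c : List ℕ → ℕ) (x : List ℕ → Site d) (T : SpatialTree d) :
    grow c x = T ↔ (∀ u ∈ T.nodes, c u = T.offspring u) ∧
      ∀ u ∈ T.nodes, u ≠ [] → x u = T.disp u := by
  constructor
  · rintro rfl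
    exact ⟨fun u hu => (offspring_grow c x hu).symm, fun u hu h => (disp_grow c x hu h).symm⟩
  · rintro ⟨h1, h2⟩
    have hn : ∀ u, u ∈ (grow c x).nodes ↔ u ∈ T.nodes := by
      intro u
      induction u using List.reverseRecOn with
      | nil => exact iff_of_true (grow c x).root_mem T.root_mem
      | append_singleton u j ih =>
        rw [append_mem_grow_iff, ih]
        constructor
        · rintro ⟨hu, hj⟩
          rwa [T.append_mem_iff hu, ← h1 u hu]
        · intro h
          have hu := T.parent_mem u j h
          exact ⟨hu, by rwa [h1 u hu, ← T.append_mem_iff hu]⟩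
    ext u : 2
    · exact hn u
    · by_cases hu : u ∈ T.nodes
      · rcases eq_or_ne u [] with rfl | h
        · rw [disp_root, disp_root]
        · rw [disp_grow c x ((hn u).2 hu) h, h2 u hu h]
      · rw [disp_of_notMem _ u hu, disp_of_notMem _ u (fun h => hu ((hn u).1 h))]

end SpatialTree

/-! ### Probability of a finite piece of the forest -/

namespace Forest

lemma numChildren_of_ne (F : Forest d) {i : ℤ} {x : List ℕ} (hv : (i, x) ∈ F.verts)
    (h : x ≠ [] ∨ i = 0) : F.numChildren (i, x) = (F.tree i).offspring x := by
  refine eq_of_forall_lt_iff fun j => ?_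
  rw [← F.child_mem_iff hv, child_of_ne F h, ← (F.tree i).append_mem_iff hv.1]
  simp [verts]

lemma numChildren_spinePt (F : Forest d) (n : ℕ) : F.numChildren (spinePt (n + 1)) =
    (F.tree (n + 1 : ℤ)).offspring [] + (F.tree (-(n + 1 : ℤ))).offspring [] + 1 := by
  refine eq_of_forall_lt_iff fun j => ?_
  rw [← F.child_mem_iff (F.spinePt_mem _), child_spinePt]
  have h1 := fun j => (F.tree (n + 1 : ℤ)).append_mem_iff (F.tree (n + 1 : ℤ)).root_mem j
  have h2 := fun j => (F.tree (-(n + 1 : ℤ))).append_mem_iff (F.tree (-(n + 1 : ℤ))).root_mem j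
  simp only [List.nil_append] at h1 h2
  split_ifs with h3 h4
  · exact iff_of_true ⟨(h2 j).2 h3, by simp⟩ (by omega)
  · exact iff_of_true (F.spinePt_mem n) (by omega)
  · have : ((n + 1 : ℤ), [j - (F.tree (-(n + 1 : ℤ))).offspring [] - 1]) ∈ F.verts ↔
        j - (F.tree (-(n + 1 : ℤ))).offspring [] - 1 < (F.tree (n + 1 : ℤ)).offspring [] := by
      rw [← h1]; simp [verts]
    rw [this]
    omega

lemma measurableSet_agreeTo (n : ℕ) (F₀ : Forest d) :
    MeasurableSet {F : Forest d | AgreeTo n F F₀} := by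
  have : {F : Forest d | AgreeTo n F F₀} =
      (⋂ i : ℤ, ⋂ _ : i.natAbs ≤ n, ⋂ u : List ℕ,
        {F : Forest d | u ∈ (F.tree i).nodes ↔ u ∈ (F₀.tree i).nodes} ∩
          {F : Forest d | (F.tree i).disp u = (F₀.tree i).disp u}) ∩
        ⋂ k : ℕ, ⋂ _ : k ≤ n, {F : Forest d | F.spine k = F₀.spine k} := by
    ext F
    simp only [Set.mem_ofPred_eq, Set.mem_inter_iff, Set.mem_iInter]
    constructor
    · rintro ⟨h1, h2⟩
      exact ⟨fun i hi u => by rw [h1 i hi]; simp, h2⟩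
    · rintro ⟨h1, h2⟩
      refine ⟨fun i hi => ?_, h2⟩
      ext u : 2
      · exact (h1 i hi u).1
      · exact (h1 i hi u).2
  rw [this]
  refine (MeasurableSet.iInter fun i => MeasurableSet.iInter fun _ => MeasurableSet.iInter fun u =>
    MeasurableSet.inter ?_ ?_).inter
      (MeasurableSet.iInter fun k => MeasurableSet.iInter fun _ => ?_)
  · exact measurableSet_setOfPred.2 ((measurableSet_setOfPred.1 (measurableSet_mem_nodes i u)).iff
      measurable_const)
  · exact measurable_disp i u (measurableSet_singleton _)
  · exact measurable_spine k (measurableSet_singleton _)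

/-- The law of the label of a vertex. -/
abbrev labelMeasure (μ : PMF ℕ) (θ : PMF (Site d)) : Measure (ℕ × Site d) :=
  μ.toMeasure.prod θ.toMeasure

lemma labelMeasure_singleton (μ : PMF ℕ) (θ : PMF (Site d)) (p : ℕ × Site d) :
    labelMeasure μ θ {p} = μ p.1 * θ p.2 := by
  rw [labelMeasure, ← Set.singleton_prod_singleton, Measure.prod_prod,
    PMF.toMeasure_apply_singleton _ _ (measurableSet_singleton _),
    PMF.toMeasure_apply_singleton _ _ (measurableSet_singleton _)]

/-- The labels that give a forest agreeing with `F₀` up to level `n`, the vertices of the level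
being listed in `V`. -/
lemma agreeTo_build_iff (n : ℕ) (F₀ : Forest d) {V : Finset Vertex}
    (hV : ∀ v, v ∈ V ↔ v ∈ F₀.verts ∧ v.1.natAbs ≤ n) (ω : Labels d) :
    AgreeTo n (build ω) F₀ ↔
      -- The base point is the only spine point whose offspring number comes from the first family
      -- of labels; the others use the pairs. The displacement on the edge from spine point `n` to
      -- `n + 1` is included, as it belongs to the label of spine point `n`.
      (∀ v ∈ insert base (V.filter fun v => v.2 ≠ []), ω.1 v = (F₀.tree v.1).offspring v.2) ∧
      (∀ k ∈ Finset.Ico 1 (n + 1), ω.2.1 k =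
        ((F₀.tree (k : ℤ)).offspring [], (F₀.tree (-(k : ℤ))).offspring [])) ∧
      (∀ v ∈ V.filter fun v => v.2 ≠ [], ω.2.2.1 v = (F₀.tree v.1).disp v.2) ∧
      ∀ k ∈ Finset.range (n + 1), ω.2.2.2 k = F₀.spine k := by
  have hmem : ∀ i : ℤ, i.natAbs ≤ n → ∀ u ∈ (F₀.tree i).nodes, u ≠ [] →
      (i, u) ∈ V.filter fun v => v.2 ≠ [] := by
    intro i hi u hu h
    rw [Finset.mem_filter, hV]
    exact ⟨⟨⟨hu, fun h' => absurd h' h⟩, hi⟩, h⟩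
  constructor
  · rintro ⟨h1, h2⟩
    have h3 := fun i hi => (SpatialTree.grow_eq_iff _ _ _).1 (h1 i hi)
    refine ⟨fun v hv => ?_, fun k hk => ?_, fun v hv => ?_, fun k hk => ?_⟩
    · rw [Finset.mem_insert] at hv
      rcases hv with rfl | hv
      · have := (h3 0 (by simp)).1 [] (F₀.tree 0).root_mem
        simpa [labelOffspring, base] using this
      · rw [Finset.mem_filter, hV] at hv
        have := (h3 v.1 hv.1.2).1 v.2 hv.1.1.1
        simpa [labelOffspring, hv.2] using this
    · rw [Finset.mem_Ico] at hk
      have h4 := (h3 k (by omega)).1 [] (F₀.tree _).root_mem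
      have h5 := (h3 (-k) (by omega)).1 [] (F₀.tree _).root_mem
      have h6 : (0 : ℤ) < k := by omega
      simp only [labelOffspring, h6, not_lt.2 h6.le, Int.natAbs_neg, Int.natAbs_natCast,
        and_self, if_true, Left.neg_neg_iff, Left.neg_pos_iff, and_false, if_false] at h4 h5
      exact Prod.ext h4 h5
    · rw [Finset.mem_filter, hV] at hv
      exact (h3 v.1 hv.1.2).2 v.2 hv.1.1.1 hv.2
    · exact h2 k (by rw [Finset.mem_range] at hk; omega)
  · rintro ⟨h1, h2, h3, h4⟩
    refine ⟨fun i hi => (SpatialTree.grow_eq_iff _ _ _).2 ⟨fun u hu => ?_, fun u hu h => ?_⟩,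
      fun k hk => h4 k (by rw [Finset.mem_range]; omega)⟩
    · by_cases h : u = []
      · subst h
        rcases lt_trichotomy i 0 with h0 | rfl | h0
        · have := h2 i.natAbs (by rw [Finset.mem_Ico]; omega)
          rw [show (i.natAbs : ℤ) = -i by omega] at this
          simp [labelOffspring, h0, not_lt.2 h0.le, this]
        · have := h1 base (Finset.mem_insert_self _ _)
          simpa [labelOffspring, base] using this
        · have := h2 i.natAbs (by rw [Finset.mem_Ico]; omega)
          rw [show (i.natAbs : ℤ) = i by omega] at this
          simp [labelOffspring, h0, this]
      · have := h1 (i, u) (Finset.mem_insert_of_mem (hmem i hi u hu h))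
        simpa [labelOffspring, h] using this
    · exact h3 (i, u) (hmem i hi u hu h)

lemma labelLaw_box {μ : PMF ℕ} (hmean : ∑' k : ℕ, (k : ENNReal) * μ k = 1) (θ : PMF (Site d))
    (s₁ : Finset Vertex) (s₂ : Finset ℕ) (s₃ : Finset Vertex) (s₄ : Finset ℕ)
    (f₁ : Vertex → ℕ) (f₂ : ℕ → ℕ × ℕ) (f₃ : Vertex → Site d) (f₄ : ℕ → Site d) :
    labelLaw μ θ {ω | (∀ v ∈ s₁, ω.1 v = f₁ v) ∧ (∀ k ∈ s₂, ω.2.1 k = f₂ k) ∧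
      (∀ v ∈ s₃, ω.2.2.1 v = f₃ v) ∧ ∀ k ∈ s₄, ω.2.2.2 k = f₄ k} =
    (∏ v ∈ s₁, μ (f₁ v)) * ((∏ k ∈ s₂, μ ((f₂ k).1 + (f₂ k).2 + 1)) *
      ((∏ v ∈ s₃, θ (f₃ v)) * ∏ k ∈ s₄, θ (f₄ k))) := by
  have := isProbabilityMeasure_spineLaw hmean
  have hset : {ω : Labels d | (∀ v ∈ s₁, ω.1 v = f₁ v) ∧ (∀ k ∈ s₂, ω.2.1 k = f₂ k) ∧
      (∀ v ∈ s₃, ω.2.2.1 v = f₃ v) ∧ ∀ k ∈ s₄, ω.2.2.2 k = f₄ k} =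
      (Set.pi s₁ fun v => {f₁ v}) ×ˢ ((Set.pi s₂ fun v => {f₂ v}) ×ˢ
        ((Set.pi s₃ fun v => {f₃ v}) ×ˢ (Set.pi s₄ fun v => {f₄ v}))) := by
    ext ω
    simp [Set.mem_pi]
  rw [hset, labelLaw, Measure.prod_prod, Measure.prod_prod, Measure.prod_prod,
    Measure.infinitePi_pi _ (fun _ _ => measurableSet_singleton _),
    Measure.infinitePi_pi _ (fun _ _ => measurableSet_singleton _),
    Measure.infinitePi_pi _ (fun _ _ => measurableSet_singleton _),
    Measure.infinitePi_pi _ (fun _ _ => measurableSet_singleton _)]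
  simp only [spineLaw_singleton, PMF.toMeasure_apply_singleton _ _ (measurableSet_singleton _)]

/-- The probability of agreeing with a given forest up to a level. -/
lemma forestLaw_agreeTo {μ : PMF ℕ} (hmean : ∑' k : ℕ, (k : ENNReal) * μ k = 1)
    {θ : PMF (Site d)} (hθ : ∀ x, θ (-x) = θ x) {F₀ : Forest d} (hF₀ : F₀.Good) {n : ℕ} {a b : ℤ}
    (hw : IsWindow n (fun k => (F₀.code k).1) a b) :
    forestLaw μ θ {F | AgreeTo n F F₀} =
      ∏ k ∈ Finset.Ico a b, labelMeasure μ θ {F₀.code k} := by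
  classical
  obtain ⟨a₁, b₁, hw₁, -, hwin⟩ := hF₀.exists_window n
  obtain ⟨rfl, rfl⟩ := hw₁.unique hw
  set V : Finset Vertex := (Finset.Ico a₁ b₁).image F₀.node with hVdef
  have hV : ∀ v, v ∈ V ↔ v ∈ F₀.verts ∧ v.1.natAbs ≤ n := by
    intro v
    simp only [hVdef, Finset.mem_image, Finset.mem_Ico]
    constructor
    · rintro ⟨k, hk, rfl⟩
      exact ⟨F₀.node_mem_verts k, (F₀.isAncestor_spinePt_iff (F₀.node_mem_verts k)).1
        ((hwin k).2 hk)⟩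
    · rintro ⟨hv, hn⟩
      obtain ⟨k, rfl⟩ := hF₀.isEnum.exists_eq hv
      exact ⟨k, (hwin k).1 ((F₀.isAncestor_spinePt_iff hv).2 hn), rfl⟩
  have hsplit : ∀ g : Vertex → ℝ≥0∞, ∏ v ∈ V, g v =
      (∏ v ∈ V.filter fun v => v.2 ≠ [], g v) * ∏ k ∈ Finset.range (n + 1), g (spinePt k) := by
    intro g
    rw [← Finset.prod_filter_mul_prod_filter_not V (fun v => v.2 ≠ []) g]
    congr 1
    have : V.filter (fun v => ¬ v.2 ≠ []) = (Finset.range (n + 1)).image spinePt := by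
      ext ⟨i, u⟩
      simp only [Finset.mem_filter, hV, not_not, Finset.mem_image, Finset.mem_range]
      constructor
      · rintro ⟨⟨h1, h2⟩, h3⟩
        have := h1.2 h3
        simp only at this h2
        exact ⟨i.natAbs, by omega, by rw [spinePt, h3]; congr 1; omega⟩
      · rintro ⟨k, hk, h⟩
        obtain ⟨rfl, rfl⟩ := Prod.ext_iff.1 h
        exact ⟨⟨F₀.spinePt_mem k, by simp only [spinePt]; omega⟩, rfl⟩
    rw [this, Finset.prod_image fun _ _ _ _ h => spinePt_injective h]
  rw [forestLaw, Measure.map_apply measurable_build (measurableSet_agreeTo n F₀)]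
  have hpre : build ⁻¹' {F | AgreeTo n F F₀} = {ω : Labels d |
      (∀ v ∈ insert base (V.filter fun v => v.2 ≠ []), ω.1 v = (F₀.tree v.1).offspring v.2) ∧
      (∀ k ∈ Finset.Ico 1 (n + 1), ω.2.1 k =
        ((F₀.tree (k : ℤ)).offspring [], (F₀.tree (-(k : ℤ))).offspring [])) ∧
      (∀ v ∈ V.filter fun v => v.2 ≠ [], ω.2.2.1 v = (F₀.tree v.1).disp v.2) ∧
      ∀ k ∈ Finset.range (n + 1), ω.2.2.2 k = F₀.spine k} :=
    Set.ext fun ω => agreeTo_build_iff n F₀ hV ω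
  rw [hpre, labelLaw_box hmean θ _ _ _ _ (fun v => (F₀.tree v.1).offspring v.2)
    (fun k => ((F₀.tree (k : ℤ)).offspring [], (F₀.tree (-(k : ℤ))).offspring []))
    (fun v => (F₀.tree v.1).disp v.2) F₀.spine]
  have hcode : ∏ k ∈ Finset.Ico a₁ b₁, labelMeasure μ θ {F₀.code k} =
      ∏ v ∈ V, labelMeasure μ θ {F₀.label v} := by
    rw [hVdef, Finset.prod_image fun _ _ _ _ h => hF₀.isEnum.injective h]
    rfl
  rw [hcode]
  simp only [labelMeasure_singleton, label]
  rw [Finset.prod_mul_distrib, hsplit, hsplit, Finset.prod_insert (by simp [base])]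
  have e1 : ∀ v ∈ V.filter fun v => v.2 ≠ [],
      μ (F₀.numChildren v) = μ ((F₀.tree v.1).offspring v.2) := by
    rintro ⟨i, u⟩ hv
    rw [Finset.mem_filter, hV] at hv
    rw [F₀.numChildren_of_ne hv.1.1 (Or.inl hv.2)]
  have e2 : ∀ v ∈ V.filter fun v => v.2 ≠ [],
      θ (F₀.pos v - F₀.pos (parent v)) = θ ((F₀.tree v.1).disp v.2) := by
    rintro ⟨i, u⟩ hv
    rw [Finset.mem_filter] at hv
    rw [pos_sub_pos_parent F₀ hv.2]
  -- The displacement from the parent runs against the direction of `spine`; the symmetry of `θ`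
  -- absorbs the sign.
  have e3 : ∀ k ∈ Finset.range (n + 1),
      θ (F₀.pos (spinePt k) - F₀.pos (parent (spinePt k))) = θ (F₀.spine k) := by
    intro k _
    rw [pos_spinePt_sub_pos_parent, hθ]
  -- The reason for the law on the spine: the total offspring number `a + b + 1` of a spine point
  -- receives its `μ`-mass, as at any other vertex.
  have e4 : ∏ k ∈ Finset.range (n + 1), μ (F₀.numChildren (spinePt k)) =
      μ ((F₀.tree base.1).offspring base.2) * ∏ k ∈ Finset.Ico 1 (n + 1),
        μ ((F₀.tree (k : ℤ)).offspring [] + (F₀.tree (-(k : ℤ))).offspring [] + 1) := by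
    rw [Finset.range_eq_Ico, Finset.prod_eq_prod_Ico_succ_bot (by omega), spinePt_zero, base,
      F₀.numChildren_of_ne F₀.base_mem (Or.inr rfl)]
    congr 1
    refine Finset.prod_congr rfl fun k hk => ?_
    rw [Finset.mem_Ico] at hk
    obtain ⟨m, rfl⟩ : ∃ m, k = m + 1 := ⟨k - 1, by omega⟩
    rw [numChildren_spinePt]
    push_cast
    rfl
  rw [Finset.prod_congr rfl e1, Finset.prod_congr rfl e2, Finset.prod_congr rfl e3, e4]
  ring

end Forest

end SpineForest

namespace SpineForest

variable {d : ℕ}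

/-! ### Finiteness of the trees -/

lemma exists_two_le {μ : PMF ℕ} (hmean : ∑' k : ℕ, (k : ENNReal) * μ k = 1)
    (hμ : μ ≠ PMF.pure 1) : ∃ k, 2 ≤ k ∧ μ k ≠ 0 := by
  by_contra! h
  rw [tsum_eq_single 1] at hmean
  · rw [Nat.cast_one, one_mul, PMF.apply_eq_one_iff] at hmean
    refine hμ (PMF.ext fun k => ?_)
    rcases eq_or_ne k 1 with rfl | hk
    · rw [PMF.pure_apply, if_pos rfl, PMF.apply_eq_one_iff, hmean]
    · rw [PMF.pure_apply, if_neg hk, PMF.apply_eq_zero_iff, hmean]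
      exact hk
  · intro k hk
    rcases Nat.lt_or_ge k 2 with h2 | h2
    · obtain rfl : k = 0 := by omega
      simp
    · rw [h k h2, mul_zero]

/-- The only fixed point in `[0, 1]` of the generating function of a critical law is `1`. -/
lemma eq_one_of_fixed_point {μ : PMF ℕ} (hmean : ∑' k : ℕ, (k : ENNReal) * μ k = 1)
    (hμ : μ ≠ PMF.pure 1) {q : ℝ≥0∞} (hq1 : q ≤ 1) (hq : ∑' k, μ k * q ^ k = q) : q = 1 := by
  obtain ⟨K, hK, hμK⟩ := exists_two_le hmean hμ
  have hqt : q ≠ ∞ := ne_top_of_le_ne_top ENNReal.one_ne_top hq1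
  set r := q.toReal with hr
  have hr0 : 0 ≤ r := ENNReal.toReal_nonneg
  have toReal_hasSum : ∀ (f : ℕ → ℝ≥0∞) (a : ℝ≥0∞), a ≠ ∞ → ∑' k, f k = a →
      HasSum (fun k => (f k).toReal) a.toReal := by
    intro f a ha hf
    have h := ENNReal.hasSum_toReal (f := f) (by rwa [hf])
    rwa [← ENNReal.tsum_toReal_eq (fun k => ENNReal.ne_top_of_tsum_ne_top (by rwa [hf]) k), hf] at h
  have h1 := toReal_hasSum _ 1 ENNReal.one_ne_top μ.tsum_coe
  have h2 := toReal_hasSum _ 1 ENNReal.one_ne_top hmean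
  have h3 := toReal_hasSum _ q hqt hq
  -- Since `μ` has mass and mean one, the sum of `μ k (r ^ k - 1 - k (r - 1))` is zero. Its terms
  -- are nonnegative by Bernoulli's inequality, so each one vanishes, in particular at `K ≥ 2`.
  have h4 := (h3.sub h1).sub (h2.mul_left (r - 1))
  simp only [ENNReal.toReal_mul, ENNReal.toReal_pow, ENNReal.toReal_natCast, ENNReal.toReal_one,
    ← hr, mul_one, sub_self] at h4
  have bern : ∀ k : ℕ, 1 + k * (r - 1) ≤ r ^ k := by
    intro k
    have := one_add_mul_le_pow (a := r - 1) (by linarith) k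
    simpa using this
  have h5 := (hasSum_zero_iff_of_nonneg (fun k => by
    have h6 : 0 ≤ (μ k).toReal * (r ^ k - (1 + k * (r - 1))) :=
      mul_nonneg ENNReal.toReal_nonneg (sub_nonneg.2 (bern k))
    change 0 ≤ (μ k).toReal * r ^ k - (μ k).toReal - (r - 1) * (k * (μ k).toReal)
    linarith)).1 h4
  have h6 := congrFun h5 K
  simp only [Pi.zero_apply] at h6
  have h7 : (μ K).toReal * (r ^ K - (1 + K * (r - 1))) = 0 := by linarith
  have h8 : r ^ K - (1 + K * (r - 1)) = 0 :=
    (mul_eq_zero.1 h7).resolve_left (ENNReal.toReal_ne_zero.2 ⟨hμK, μ.apply_ne_top K⟩)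
  obtain ⟨m, rfl⟩ : ∃ m, K = m + 2 := ⟨K - 2, by omega⟩
  -- Bernoulli at the exponent `K - 1`, multiplied by `r`, improves the bound at `K` by `(K - 1) (r
  -- - 1) ^ 2`, which forces `r = 1`.
  have h9 : r * (1 + ((m + 1 : ℕ) : ℝ) * (r - 1)) ≤ r * r ^ (m + 1) :=
    mul_le_mul_of_nonneg_left (bern (m + 1)) hr0
  have h10 : r * r ^ (m + 1) = 1 + ((m + 2 : ℕ) : ℝ) * (r - 1) := by
    rw [← pow_succ']; linarith
  rw [h10] at h9
  push_cast at h9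
  have h11 : ((m : ℝ) + 1) * (r - 1) ^ 2 ≤ 0 := by linarith
  have h12 : (r - 1) ^ 2 ≤ 0 := by
    by_contra! h
    have : 0 < ((m : ℝ) + 1) * (r - 1) ^ 2 := by positivity
    linarith
  have h13 : r = 1 := by
    have := pow_eq_zero_iff (two_ne_zero) |>.1 (le_antisymm h12 (sq_nonneg _))
    linarith
  rw [← ENNReal.ofReal_toReal hqt, ← hr, h13, ENNReal.ofReal_one]

/-! ### Product measures and the extinction of critical trees -/

lemma infinitePi_map_comp {ι κ X : Type*} [MeasurableSpace X] (m : Measure X)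
    [IsProbabilityMeasure m] {f : κ → ι} (hf : Function.Injective f) :
    (Measure.infinitePi fun _ : ι => m).map (fun ω k => ω (f k)) =
      Measure.infinitePi fun _ : κ => m := by
  classical
  refine Measure.eq_infinitePi _ fun s t ht => ?_
  have hm : Measurable fun (ω : ι → X) k => ω (f k) :=
    measurable_pi_iff.2 fun k => measurable_pi_apply _
  rw [Measure.map_apply hm (MeasurableSet.pi s.countable_toSet fun i _ => ht i)]
  rcases isEmpty_or_nonempty κ with hκ | hκ
  · have : s = ∅ := Finset.eq_empty_of_isEmpty s
    subst this
    simp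
  have : (fun (ω : ι → X) k => ω (f k)) ⁻¹' (Set.pi s t) =
      Set.pi (s.image f : Finset ι) fun i => t (Function.invFun f i) := by
    ext ω
    simp [Set.mem_pi, Function.leftInverse_invFun hf _]
  rw [this, Measure.infinitePi_pi _ (fun i _ => ht _), Finset.prod_image fun _ _ _ _ h => hf h]
  exact Finset.prod_congr rfl fun k _ => by rw [Function.leftInverse_invFun hf k]

/-- The nodes of the tree with offspring numbers `c`. -/
def growNodes (c : List ℕ → ℕ) : Set (List ℕ) := {u | ∀ p j, p ++ [j] <+: u → j < c p}

lemma cons_mem_growNodes (c : List ℕ → ℕ) (i : ℕ) (u : List ℕ) :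
    i :: u ∈ growNodes c ↔ i < c [] ∧ u ∈ growNodes fun v => c (i :: v) := by
  constructor
  · intro h
    refine ⟨h [] i (by simp), fun p j hp => h (i :: p) j ?_⟩
    rw [List.cons_append, List.cons_prefix_cons]
    exact ⟨rfl, hp⟩
  · rintro ⟨h1, h2⟩ p j hp
    cases p with
    | nil =>
      simp only [List.nil_append, List.cons_prefix_cons] at hp
      rw [hp.1]; exact h1
    | cons a p =>
      rw [List.cons_append, List.cons_prefix_cons] at hp
      rw [hp.1]
      exact h2 p j hp.2

lemma growNodes_eq (c : List ℕ → ℕ) : growNodes c =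
    {[]} ∪ ⋃ i ∈ Set.Iio (c []), List.cons i '' growNodes fun v => c (i :: v) := by
  ext u
  cases u with
  | nil => simp [growNodes]
  | cons i u => simp [cons_mem_growNodes, and_comm]

lemma finite_growNodes_iff (c : List ℕ → ℕ) : (growNodes c).Finite ↔
    ∀ i < c [], (growNodes fun v => c (i :: v)).Finite := by
  constructor
  · intro h i hi
    refine Set.Finite.of_finite_image (f := List.cons i) (h.subset ?_) (by simp [Set.InjOn])
    rintro _ ⟨u, hu, rfl⟩
    exact (cons_mem_growNodes c i u).2 ⟨hi, hu⟩
  · intro h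
    rw [growNodes_eq]
    exact (Set.finite_singleton _).union
      ((Set.finite_Iio _).biUnion fun i hi => (h i hi).image _)

lemma measurableSet_finite_of {α β : Type*} [MeasurableSpace α] [Countable β] {p : α → β → Prop}
    (h : ∀ b, MeasurableSet {x | p x b}) : MeasurableSet {x | {b | p x b}.Finite} :=
  (measurable_set_iff.2 fun b => measurableSet_setOfPred.1 (h b) :
    Measurable fun x => {b | p x b}) (Set.Countable.ofPred_finite.measurableSet)

lemma measurableSet_finite_growNodes :
    MeasurableSet {c : List ℕ → ℕ | (growNodes c).Finite} := by
  refine measurableSet_finite_of fun u => ?_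
  simp only [Set.ofPred_forall]
  exact MeasurableSet.iInter fun p => MeasurableSet.iInter fun j => MeasurableSet.iInter fun _ =>
    measurableSet_lt measurable_const (measurable_pi_apply p)

/-- Offspring numbers from that of the root and those of the other nodes. -/
def consOffspring (p : ℕ × (ℕ × List ℕ → ℕ)) : List ℕ → ℕ
  | [] => p.1
  | i :: u => p.2 (i, u)

lemma measurable_consOffspring : Measurable consOffspring := by
  refine measurable_pi_iff.2 fun u => ?_
  cases u with
  | nil => exact measurable_fst
  | cons i u => exact (measurable_pi_apply _).comp measurable_snd

/-- The branching property: the offspring number of the root is independent of those of all other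
nodes, which can be grouped by the child above which they lie. -/
lemma map_consOffspring (μ : PMF ℕ) :
    (μ.toMeasure.prod (Measure.infinitePi fun _ : ℕ × List ℕ => μ.toMeasure)).map consOffspring =
      Measure.infinitePi fun _ : List ℕ => μ.toMeasure := by
  classical
  refine Measure.eq_infinitePi _ fun s t ht => ?_
  rw [Measure.map_apply measurable_consOffspring
    (MeasurableSet.pi s.countable_toSet fun i _ => ht i)]
  let f : ℕ × List ℕ → List ℕ := fun p => p.1 :: p.2
  have hf : Function.Injective f := by
    rintro ⟨i, u⟩ ⟨j, v⟩ h
    simpa [f] using h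
  have hpre : consOffspring ⁻¹' (Set.pi s t) =
      (if [] ∈ s then t [] else Set.univ) ×ˢ
        Set.pi (s.preimage f hf.injOn : Finset (ℕ × List ℕ)) fun p => t (f p) := by
    ext ⟨k, g⟩
    simp only [Set.mem_preimage, Set.mem_pi, Set.mem_prod, Finset.mem_coe, Finset.mem_preimage]
    constructor
    · intro h
      refine ⟨?_, fun p hp => h _ hp⟩
      split_ifs with h0
      · exact h [] h0
      · trivial
    · rintro ⟨h1, h2⟩ u hu
      cases u with
      | nil => rwa [if_pos hu] at h1
      | cons i u => exact h2 (i, u) hu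
  rw [hpre, Measure.prod_prod, Measure.infinitePi_pi _ fun p _ => ht _,
    Finset.prod_preimage' f s hf.injOn fun u => μ.toMeasure (t u)]
  have hfil : s.filter (· ∈ Set.range f) = s.erase [] := by
    ext u
    rw [Finset.mem_filter, Finset.mem_erase, and_comm]
    refine and_congr_left fun _ => ?_
    cases u with
    | nil => simp [f]
    | cons i u => simp [f]
  rw [hfil]
  split_ifs with h0
  · exact Finset.mul_prod_erase s (fun u => μ.toMeasure (t u)) h0
  · rw [measure_univ, one_mul, Finset.erase_eq_of_notMem h0]

/-- A tree is finite when all the subtrees of the root's children are, so the probability of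
finiteness is a fixed point of the generating function. -/
lemma ae_finite_growNodes {μ : PMF ℕ} (hmean : ∑' k : ℕ, (k : ENNReal) * μ k = 1)
    (hμ : μ ≠ PMF.pure 1) :
    ∀ᵐ c ∂(Measure.infinitePi fun _ : List ℕ => μ.toMeasure), (growNodes c).Finite := by
  set π := Measure.infinitePi fun _ : List ℕ => μ.toMeasure with hπ
  set D := {c : List ℕ → ℕ | (growNodes c).Finite} with hD
  have hDm : MeasurableSet D := measurableSet_finite_growNodes
  suffices h : π D = 1 from (prob_compl_eq_zero_iff hDm).2 h
  refine eq_one_of_fixed_point hmean hμ prob_le_one ?_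
  symm
  calc π D = (μ.toMeasure.prod (Measure.infinitePi fun _ : ℕ × List ℕ => μ.toMeasure))
        (consOffspring ⁻¹' D) := by
        rw [← Measure.map_apply measurable_consOffspring hDm, map_consOffspring]
    _ = ∑' k, μ k * π D ^ k := by
        rw [Measure.prod_apply (measurable_consOffspring hDm), lintegral_countable']
        refine tsum_congr fun k => ?_
        rw [PMF.toMeasure_apply_singleton _ _ (measurableSet_singleton _), mul_comm]
        congr 1
        have hset : Prod.mk k ⁻¹' (consOffspring ⁻¹' D) =
            Function.curry ⁻¹' (Set.pi (Finset.range k) fun _ => D) := by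
          ext g
          simp only [Set.mem_preimage, hD, Set.mem_ofPred_eq, Set.mem_pi, Finset.coe_range,
            Set.mem_Iio]
          rw [finite_growNodes_iff]
          rfl
        have hmc : Measurable (Function.curry : (ℕ × List ℕ → ℕ) → ℕ → List ℕ → ℕ) :=
          measurable_pi_iff.2 fun i => measurable_pi_iff.2 fun u => measurable_pi_apply _
        rw [hset, ← Measure.map_apply hmc
          (MeasurableSet.pi (Finset.countable_toSet _) fun _ _ => hDm),
          show (Measure.infinitePi fun _ : ℕ × List ℕ => μ.toMeasure).map Function.curry =
            Measure.infinitePi fun _ : ℕ => π from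
            Measure.infinitePi_map_curry fun (_ : ℕ) (_ : List ℕ) => μ.toMeasure,
          Measure.infinitePi_pi _ fun _ _ => hDm]
        simp [hπ]

namespace Forest

lemma ae_good {μ : PMF ℕ} (hmean : ∑' k : ℕ, (k : ENNReal) * μ k = 1)
    (hμ : μ ≠ PMF.pure 1) (θ : PMF (Site d)) : ∀ᵐ F ∂(forestLaw μ θ), F.Good := by
  have hsp := isProbabilityMeasure_spineLaw hmean
  have hmeas : MeasurableSet {F : Forest d | (∀ i, (F.tree i).nodes.Finite) ∧
      ∀ m : ℕ, ∃ i : ℕ, m < i ∧ [0] ∈ (F.tree i).nodes} := by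
    refine MeasurableSet.inter (s₁ := {F : Forest d | ∀ i, (F.tree i).nodes.Finite})
      (s₂ := {F : Forest d | ∀ m : ℕ, ∃ i : ℕ, m < i ∧ [0] ∈ (F.tree i).nodes}) ?_ ?_
    · simp only [Set.ofPred_forall]
      exact MeasurableSet.iInter fun i =>
        measurableSet_finite_of fun u => measurableSet_mem_nodes i u
    · simp only [Set.ofPred_forall, Set.ofPred_exists]
      exact MeasurableSet.iInter fun m => MeasurableSet.iUnion fun i =>
        (MeasurableSet.const _).inter (measurableSet_mem_nodes i [0])
  have key : ∀ᵐ F ∂(forestLaw μ θ), (∀ i, (F.tree i).nodes.Finite) ∧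
      ∀ m : ℕ, ∃ i : ℕ, m < i ∧ [0] ∈ (F.tree i).nodes := by
    rw [forestLaw, ae_map_iff measurable_build.aemeasurable hmeas]
    refine Filter.Eventually.and ?_ ?_
    -- Roots on the spine do not have `μ`-distributed offspring in their trees. Only the subtrees
    -- above the children of roots are Galton–Watson trees, and finiteness is transferred from them.
    · have h1 : ∀ᵐ ω ∂(labelLaw μ θ), ∀ (i : ℤ) (j : ℕ),
          (growNodes fun v => ω.1 (i, j :: v)).Finite := by
        rw [ae_all_iff]; intro i
        rw [ae_all_iff]; intro j
        have h2 : ∀ᵐ c ∂(Measure.infinitePi fun _ : ℤ × List ℕ => μ.toMeasure),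
            (growNodes fun v => c (i, j :: v)).Finite := by
          have hinj : Function.Injective fun v : List ℕ => ((i, j :: v) : ℤ × List ℕ) := by
            intro v w h; simpa using h
          have h3 := ae_finite_growNodes hmean hμ
          rw [← infinitePi_map_comp μ.toMeasure hinj] at h3
          exact ae_of_ae_map (measurable_pi_iff.2 fun k =>
            measurable_pi_apply _).aemeasurable h3
        exact Measure.quasiMeasurePreserving_fst.ae h2
      filter_upwards [h1] with ω hω i
      refine (finite_growNodes_iff _).2 fun j _ => ?_
      simpa [labelOffspring] using hω i j
    -- The right offspring numbers along the spine are independent and each vanishes with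
    -- probability `q < 1`, so they cannot all vanish from some point on.
    · have h1 : ∀ᵐ g ∂(Measure.infinitePi fun _ : ℕ => spineLaw μ), ∀ m : ℕ, ∃ i : ℕ,
          m < i ∧ (g i).1 ≠ 0 := by
        rw [ae_all_iff]; intro m
        set q := spineLaw μ {p | p.1 = 0} with hq
        have hqlt : q < 1 := by
          refine lt_of_le_of_ne prob_le_one fun h => ?_
          -- The pair `(k - 1, 0)` has mass `μ k` and a nonzero first entry.
          obtain ⟨k, hk, hμk⟩ := exists_two_le hmean hμ
          rw [hq, ← prob_compl_eq_zero_iff (MeasurableSet.of_discrete)] at h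
          refine hμk (le_antisymm ?_ (zero_le))
          rw [← h]
          have := spineLaw_singleton μ (k - 1, 0)
          rw [show (k - 1, 0).1 + (k - 1, 0).2 + 1 = k by simp; omega] at this
          rw [← this]
          refine measure_mono ?_
          simp; omega
        rw [ae_iff]
        refine le_antisymm (ge_of_tendsto' (ENNReal.tendsto_pow_atTop_nhds_zero_of_lt_one hqlt)
          fun K => ?_) (zero_le)
        calc _ ≤ (Measure.infinitePi fun _ : ℕ => spineLaw μ)
              (Set.pi (Finset.Ioc m (m + K)) fun _ => {p | p.1 = 0}) := by
              refine measure_mono fun g hg i hi => ?_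
              simp only [Set.mem_ofPred_eq, not_exists, not_and, not_not] at hg
              exact hg i (by simpa using (Finset.mem_Ioc.1 hi).1)
          _ = q ^ K := by
              rw [Measure.infinitePi_pi _ fun _ _ => MeasurableSet.of_discrete]
              simp [hq]
      have h2 : ∀ᵐ ω ∂(labelLaw μ θ), ∀ m : ℕ, ∃ i : ℕ, m < i ∧ (ω.2.1 i).1 ≠ 0 :=
        (Measure.quasiMeasurePreserving_fst.comp Measure.quasiMeasurePreserving_snd).ae h1
      filter_upwards [h2] with ω hω m
      obtain ⟨i, hi, h⟩ := hω m
      refine ⟨i, hi, ?_⟩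
      refine (cons_mem_growNodes _ 0 []).2 ⟨?_, by simp [growNodes]⟩
      have hi0 : (0 : ℤ) < i := by omega
      simpa [labelOffspring, show 0 < i by omega] using Nat.pos_of_ne_zero h
  filter_upwards [key] with F hF using F.good_of_finite hF.1 hF.2

end Forest

end SpineForest

namespace SpineForest

/-! ### The Bernoulli shift -/

section Bernoulli

open Filter Topology

variable {E : Type*}

/-- The shift of sequences by `n`. -/
def seqShift (n : ℤ) (z : ℤ → E) : ℤ → E := fun i => z (i + n)

lemma seqShift_add (m n : ℤ) (z : ℤ → E) : seqShift (m + n) z = seqShift m (seqShift n z) := by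
  funext i; simp [seqShift, add_assoc]

variable [MeasurableSpace E] (m : Measure E) [IsProbabilityMeasure m]

lemma measurePreserving_seqShift (n : ℤ) : MeasurePreserving (seqShift n)
    (Measure.infinitePi fun _ : ℤ => m) (Measure.infinitePi fun _ : ℤ => m) :=
  ⟨measurable_pi_iff.2 fun _ => measurable_pi_apply _, infinitePi_map_comp m (add_left_injective n)⟩

/-- Events depending on disjoint sets of coordinates are independent. -/
lemma infinitePi_inter_pi {ι : Type*} {s s' : Finset ι} (hs : Disjoint s s') {t t' : ι → Set E}
    (ht : ∀ i, MeasurableSet (t i)) (ht' : ∀ i, MeasurableSet (t' i)) :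
    (Measure.infinitePi fun _ : ι => m) (Set.pi s t ∩ Set.pi s' t') =
      (Measure.infinitePi fun _ : ι => m) (Set.pi s t) *
        (Measure.infinitePi fun _ : ι => m) (Set.pi s' t') := by
  classical
  have h : Set.pi s t ∩ Set.pi s' t' =
      Set.pi (s ∪ s' : Finset ι) fun i => if i ∈ s then t i else t' i := by
    ext z
    simp only [Set.mem_inter_iff, Set.mem_pi, Finset.mem_coe, Finset.mem_union]
    constructor
    · rintro ⟨h1, h2⟩ i hi
      split_ifs with his
      · exact h1 i his
      · exact h2 i (hi.resolve_left his)
    · intro h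
      refine ⟨fun i hi => by simpa [hi] using h i (Or.inl hi), fun i hi => ?_⟩
      have := h i (Or.inr hi)
      rwa [if_neg (Finset.disjoint_right.1 hs hi)] at this
  rw [h, Measure.infinitePi_pi, Measure.infinitePi_pi _ fun i _ => ht i,
    Measure.infinitePi_pi _ fun i _ => ht' i, Finset.prod_union hs]
  · congr 1
    · exact Finset.prod_congr rfl fun i hi => by rw [if_pos hi]
    · exact Finset.prod_congr rfl fun i hi => by rw [if_neg (Finset.disjoint_right.1 hs hi)]
  · intro i _
    split_ifs
    · exact ht i
    · exact ht' i

/-- Mixing against cylinder sets. The cylinder stays fixed, and the class of admissible `B` is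
closed under complements and countable disjoint unions, the latter by dominated convergence. -/
lemma tendsto_measureReal_inter_seqShift {s : Finset ℤ} {t : ℤ → Set E}
    (ht : ∀ i, MeasurableSet (t i)) {B : Set (ℤ → E)} (hB : MeasurableSet B) :
    Tendsto (fun n : ℕ => (Measure.infinitePi fun _ : ℤ => m).real
        (Set.pi s t ∩ seqShift n ⁻¹' B)) atTop
      (𝓝 ((Measure.infinitePi fun _ : ℤ => m).real (Set.pi s t) *
        (Measure.infinitePi fun _ : ℤ => m).real B)) := by
  classical
  set Q := Measure.infinitePi fun _ : ℤ => m with hQ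
  have hA : MeasurableSet (Set.pi (s : Set ℤ) t) := MeasurableSet.pi s.countable_toSet fun i _ => ht i
  have hmp : ∀ n : ℕ, MeasurePreserving (seqShift (n : ℤ)) Q Q :=
    fun n => measurePreserving_seqShift m n
  have hpre : ∀ {C : Set (ℤ → E)}, MeasurableSet C → ∀ n : ℕ,
      MeasurableSet (seqShift (n : ℤ) ⁻¹' C) := fun hC n => (hmp n).measurable hC
  induction B, hB using MeasurableSpace.induction_on_inter
    (generateFrom_squareCylinders (α := fun _ : ℤ => E)).symm
    (isPiSystem_squareCylinders (fun _ => MeasurableSpace.isPiSystem_measurableSet)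
      fun _ => MeasurableSet.univ) with
  | empty => simp
  | basic B hB =>
    obtain ⟨s', (t' : ℤ → Set E), ht', rfl⟩ := hB
    have ht'' : ∀ i, MeasurableSet (t' i) := fun i => ht' i trivial
    refine tendsto_const_nhds.congr' ?_
    -- If all coordinates involved lie in `[-M, M]`, a shift by more than `2 * M` separates the two
    -- index sets, and independence is exact.
    filter_upwards [eventually_gt_atTop (2 * (s ∪ s').sup Int.natAbs)] with n hn
    have hb : ∀ i ∈ s ∪ s', i.natAbs ≤ (s ∪ s').sup Int.natAbs :=
      fun i hi => Finset.le_sup (f := Int.natAbs) hi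
    have hset : seqShift (n : ℤ) ⁻¹' (Set.pi s' t') =
        Set.pi (s'.image fun j => j + (n : ℤ) : Finset ℤ) fun i => t' (i - n) := by
      ext z
      simp only [Set.mem_preimage, Set.mem_pi, Finset.coe_image, Set.forall_mem_image,
        add_sub_cancel_right, seqShift, Finset.mem_coe]
    have hdisj : Disjoint s (s'.image fun j => j + (n : ℤ)) := by
      rw [Finset.disjoint_right]
      intro i hi his
      obtain ⟨j, hj, rfl⟩ := Finset.mem_image.1 hi
      have h1 := hb _ (Finset.mem_union_left _ his)
      have h2 := hb _ (Finset.mem_union_right _ hj)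
      omega
    have h1 := infinitePi_inter_pi m hdisj ht (fun i => ht'' (i - n))
    rw [← hset, ← hQ, (hmp n).measure_preimage
      (MeasurableSet.pi s'.countable_toSet fun i _ => ht'' i).nullMeasurableSet] at h1
    rw [Measure.real, Measure.real, Measure.real, h1, ENNReal.toReal_mul]
  | compl B hB ih =>
    have h1 : ∀ n : ℕ, Q.real (Set.pi s t ∩ seqShift (n : ℤ) ⁻¹' Bᶜ) =
        Q.real (Set.pi s t) - Q.real (Set.pi s t ∩ seqShift (n : ℤ) ⁻¹' B) := by
      intro n
      rw [Set.preimage_compl, ← Set.sdiff_eq, eq_sub_iff_add_eq, add_comm]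
      exact measureReal_inter_add_sdiff (hpre hB n)
    simp only [h1, probReal_compl_eq_one_sub hB, mul_sub, mul_one]
    exact tendsto_const_nhds.sub ih
  | iUnion f hd hf ih =>
    have hreal : ∀ {g : ℕ → Set (ℤ → E)}, Pairwise (Function.onFun Disjoint g) →
        (∀ k, MeasurableSet (g k)) → HasSum (fun k => Q.real (g k)) (Q.real (⋃ k, g k)) := by
      intro g hg hgm
      have h := measure_iUnion hg hgm (μ := Q)
      have hne : ∑' k, Q (g k) ≠ ∞ := by rw [← h]; exact measure_ne_top _ _
      have h2 := ENNReal.hasSum_toReal hne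
      rwa [← ENNReal.tsum_toReal_eq (fun k => measure_ne_top _ _), ← h] at h2
    have h1 : ∀ n : ℕ, Q.real (Set.pi s t ∩ seqShift (n : ℤ) ⁻¹' ⋃ k, f k) =
        ∑' k, Q.real (Set.pi s t ∩ seqShift (n : ℤ) ⁻¹' f k) := by
      intro n
      rw [Set.preimage_iUnion, Set.inter_iUnion]
      refine (hreal ?_ fun k => hA.inter (hpre (hf k) n)).tsum_eq.symm
      intro i j hij
      exact ((hd hij).preimage _).mono Set.inter_subset_right Set.inter_subset_right
    simp only [h1, ← (hreal hd hf).tsum_eq, ← tsum_mul_left]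
    refine tendsto_tsum_of_dominated_convergence (hreal hd hf).summable ih ?_
    refine Eventually.of_forall fun n k => ?_
    rw [Real.norm_of_nonneg measureReal_nonneg]
    calc _ ≤ Q.real (seqShift (n : ℤ) ⁻¹' f k) := measureReal_mono Set.inter_subset_right
      _ = Q.real (f k) := by
        rw [Measure.real, (hmp n).measure_preimage (hf k).nullMeasurableSet, Measure.real]

/-- An event that is almost surely invariant under the Bernoulli shift has probability `0` or
`1`. -/
lemma infinitePi_eq_zero_or_one_of_invariant {B : Set (ℤ → E)} (hB : MeasurableSet B)
    (hinv : seqShift 1 ⁻¹' B =ᵐ[Measure.infinitePi fun _ : ℤ => m] B) :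
    (Measure.infinitePi fun _ : ℤ => m) B = 0 ∨ (Measure.infinitePi fun _ : ℤ => m) B = 1 := by
  set Q := Measure.infinitePi fun _ : ℤ => m with hQ
  have hn : ∀ n : ℕ, seqShift (n : ℤ) ⁻¹' B =ᵐ[Q] B := by
    intro n
    induction n with
    | zero =>
      have h0 : (seqShift ((0 : ℕ) : ℤ) : (ℤ → E) → ℤ → E) = id := by
        funext z i; simp [seqShift]
      rw [h0, Set.preimage_id]
      exact ae_eq_refl _
    | succ n ih =>
      have h1 := (measurePreserving_seqShift m n).quasiMeasurePreserving.preimage_ae_eq hinv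
      have h2 : seqShift ((n + 1 : ℕ) : ℤ) ⁻¹' B =
          seqShift (n : ℤ) ⁻¹' (seqShift 1 ⁻¹' B) := by
        ext z
        simp only [Set.mem_preimage]
        rw [← seqShift_add, add_comm]
        rfl
      rw [h2]
      exact h1.trans ih
  have hind : ∀ (s : Finset ℤ) (t : ℤ → Set E), (∀ i, MeasurableSet (t i)) →
      Q (Set.pi s t ∩ B) = Q B * Q (Set.pi s t) := by
    intro s t ht
    have h1 := tendsto_measureReal_inter_seqShift m (s := s) ht hB
    have h2 : ∀ n : ℕ, Q.real (Set.pi s t ∩ seqShift (n : ℤ) ⁻¹' B) =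
        Q.real (Set.pi s t ∩ B) :=
      fun n => measureReal_congr ((ae_eq_refl _).inter (hn n))
    simp only [← hQ, h2] at h1
    have h3 := tendsto_nhds_unique tendsto_const_nhds h1
    rw [Measure.real, Measure.real, Measure.real, ← ENNReal.toReal_mul,
      ENNReal.toReal_eq_toReal_iff' (measure_ne_top _ _)
        (ENNReal.mul_ne_top (measure_ne_top _ _) (measure_ne_top _ _))] at h3
    rw [h3, mul_comm]
  -- An invariant event is independent of every cylinder, since the sequence in the mixing limit is
  -- constant. Cylinders generate, so it is independent of itself and `Q B = Q B * Q B`.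
  have hext : Q.restrict B = Q B • Q := by
    refine ext_of_generate_finite _ (generateFrom_squareCylinders (α := fun _ : ℤ => E)).symm
      (isPiSystem_squareCylinders (fun _ => MeasurableSpace.isPiSystem_measurableSet)
        fun _ => MeasurableSet.univ) ?_ ?_
    · rintro _ ⟨s, t, ht, rfl⟩
      have ht' : ∀ i, MeasurableSet (t i) := fun i => ht i trivial
      rw [Measure.restrict_apply (MeasurableSet.pi s.countable_toSet fun i _ => ht' i), hind s t ht']
      rfl
    · simp
  have hsq := congrArg (fun ρ => ρ B) hext
  simp only [Measure.restrict_apply hB, Set.inter_self, Measure.smul_apply, smul_eq_mul] at hsq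
  rcases eq_or_ne (Q B) 0 with h0 | h0
  · exact Or.inl h0
  · right
    have h4 : Q B * 1 = Q B * Q B := by rw [mul_one]; exact hsq
    exact ((ENNReal.mul_right_inj h0 (measure_ne_top _ _)).1 h4).symm

end Bernoulli

end SpineForest

namespace SpineForest

namespace Forest

variable {d : ℕ}

/-! ### The law of the code -/

/-- The event that the code of a forest is read in the descendants of the `n`-th point of the spine
of some good forest with property `p`. -/
def windowEvents (n : ℕ) (p : Forest d → Prop) : Set (Set (ℤ → ℕ × Site d)) :=
  {C | ∃ F : Forest d, F.Good ∧ p F ∧ ∃ a b, IsWindow n (fun k => (F.code k).1) a b ∧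
    C = {z | ∀ k ∈ Finset.Ico a b, z k = F.code k}}

lemma countable_windowEvents (n : ℕ) (p : Forest d → Prop) : (windowEvents n p).Countable := by
  refine (Set.countable_range fun κ : (Σ s : Finset ℤ, (s → ℕ × Site d)) =>
    {z : ℤ → ℕ × Site d | ∀ k : κ.1, z k = κ.2 k}).mono ?_
  rintro _ ⟨F, -, -, a, b, -, rfl⟩
  refine ⟨⟨Finset.Ico a b, fun k => F.code k⟩, ?_⟩
  ext z
  simp only [Set.mem_ofPred_eq]
  exact ⟨fun h k hk => h ⟨k, hk⟩, fun h k => h k k.2⟩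

lemma measurableSet_eq_on (s : Finset ℤ) (x : ℤ → ℕ × Site d) :
    MeasurableSet {z : ℤ → ℕ × Site d | ∀ k ∈ s, z k = x k} := by
  simp only [Set.ofPred_forall]
  exact MeasurableSet.iInter fun k => MeasurableSet.iInter fun _ =>
    measurable_pi_apply k (measurableSet_singleton _)

lemma measurableSet_of_mem_windowEvents {n : ℕ} {p : Forest d → Prop}
    {C : Set (ℤ → ℕ × Site d)} (hC : C ∈ windowEvents n p) : MeasurableSet C := by
  obtain ⟨F, -, -, a, b, -, rfl⟩ := hC
  exact measurableSet_eq_on _ _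

/-- A sequence in two of the events has both windows, which coincide by uniqueness; the prescribed
values then coincide as well. -/
lemma pairwiseDisjoint_windowEvents (n : ℕ) (p : Forest d → Prop) :
    (windowEvents n p).PairwiseDisjoint id := by
  rintro _ ⟨F, -, -, a, b, hw, rfl⟩ _ ⟨F', -, -, a', b', hw', rfl⟩ hne
  rw [Function.onFun, Set.disjoint_left]
  intro z hz hz'
  refine hne ?_
  simp only [id, Set.mem_ofPred_eq, Finset.mem_Ico] at hz hz'
  have h1 : IsWindow n (fun k => (z k).1) a b :=
    hw.congr fun k h1 h2 => by simp only [hz k ⟨h1, h2⟩]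
  have h2 : IsWindow n (fun k => (z k).1) a' b' :=
    hw'.congr fun k h1 h2 => by simp only [hz' k ⟨h1, h2⟩]
  obtain ⟨rfl, rfl⟩ := h1.unique h2
  ext y
  simp only [Set.mem_ofPred_eq, Finset.mem_Ico]
  refine forall_congr' fun k => imp_congr_right fun hk => ?_
  rw [← hz k hk, ← hz' k hk]

lemma Good.exists_mem_windowEvents {F : Forest d} (hF : F.Good) (n : ℕ) {p : Forest d → Prop}
    (hp : p F) : ∃ C ∈ windowEvents n p, F.code ∈ C := by
  obtain ⟨a, b, hw, -⟩ := hF.exists_window n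
  exact ⟨_, ⟨F, hF, hp, a, b, hw, rfl⟩, fun k _ => rfl⟩

/-- A property that only depends on the first levels of the forest can be read in its code. -/
lemma exists_measurableSet_code {n : ℕ} {p : Forest d → Prop}
    (hp : ∀ F F₀, AgreeTo n F F₀ → p F₀ → p F) :
    ∃ B, MeasurableSet B ∧ ∀ F : Forest d, F.Good → (p F ↔ F.code ∈ B) := by
  refine ⟨⋃₀ windowEvents n p, MeasurableSet.sUnion (countable_windowEvents n p)
    fun C hC => measurableSet_of_mem_windowEvents hC, fun F hF => ⟨fun h => ?_, ?_⟩⟩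
  · exact hF.exists_mem_windowEvents n h
  · rintro ⟨_, ⟨F₀, hF₀, hp₀, a, b, hw, rfl⟩, hC⟩
    exact hp F F₀ (hF.agreeTo_of_code_eq hF₀ hw fun k h1 h2 =>
      hC k (Finset.mem_Ico.2 ⟨h1, h2⟩)) hp₀

/-- The σ-algebra of the events that can be read in the code of a good forest. -/
@[reducible]
def codeSpace (d : ℕ) : MeasurableSpace (Forest d) where
  MeasurableSet' A := ∃ B, MeasurableSet B ∧ ∀ F : Forest d, F.Good → (F ∈ A ↔ F.code ∈ B)
  measurableSet_empty := ⟨∅, MeasurableSet.empty, by simp⟩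
  measurableSet_compl := by
    rintro A ⟨B, hB, h⟩
    exact ⟨Bᶜ, hB.compl, fun F hF => not_congr (h F hF)⟩
  measurableSet_iUnion := by
    intro f hf
    choose B hB h using hf
    refine ⟨⋃ i, B i, MeasurableSet.iUnion hB, fun F hF => ?_⟩
    simp only [Set.mem_iUnion]
    exact exists_congr fun i => h i F hF

/-- The generating events depend on finitely many levels, hence lie in `codeSpace`, and so does
every measurable event. -/
lemma exists_code_mem_iff {A : Set (Forest d)} (hA : MeasurableSet A) :
    ∃ B, MeasurableSet B ∧ ∀ F : Forest d, F.Good → (F ∈ A ↔ F.code ∈ B) := by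
  have hid : @Measurable _ _ (codeSpace d) _ (id : Forest d → Forest d) := by
    refine @measurable_of_coord d (Forest d) (codeSpace d) id (fun i u => ?_) (fun i u => ?_)
      (fun n => ?_)
    · refine exists_measurableSet_code (n := i.natAbs)
        (p := fun F => u ∈ (F.tree i).nodes) fun F F₀ h h₀ => ?_
      simpa only [h.tree i le_rfl] using h₀
    · refine @measurable_to_countable' _ _ _ _ (codeSpace d) _ fun x => ?_
      refine exists_measurableSet_code (n := i.natAbs)
        (p := fun F => (F.tree i).disp u = x) fun F F₀ h h₀ => ?_
      simpa only [h.tree i le_rfl] using h₀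
    · refine @measurable_to_countable' _ _ _ _ (codeSpace d) _ fun x => ?_
      refine exists_measurableSet_code (n := n)
        (p := fun F => F.spine n = x) fun F F₀ h h₀ => ?_
      simpa only [h.spine n le_rfl] using h₀
  exact hid hA

lemma measurable_code_seq : Measurable (code : Forest d → ℤ → ℕ × Site d) :=
  measurable_pi_iff.2 measurable_code

/-! ### The code is i.i.d.; consequences for the forest -/

section Law

variable {μ : PMF ℕ} (hmean : ∑' k : ℕ, (k : ENNReal) * μ k = 1) (hμ : μ ≠ PMF.pure 1)
  {θ : PMF (Site d)} (hθ : ∀ x, θ (-x) = θ x)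

include hmean hμ hθ

lemma forestLaw_code_mem_le {n : ℕ} {p : Forest d → Prop} {C : Set (ℤ → ℕ × Site d)}
    (hC : C ∈ windowEvents n p) : forestLaw μ θ {F | F.code ∈ C} ≤
      (Measure.infinitePi fun _ : ℤ => labelMeasure μ θ) C := by
  obtain ⟨F₀, hF₀, -, a, b, hw, rfl⟩ := hC
  have h : {z : ℤ → ℕ × Site d | ∀ k ∈ Finset.Ico a b, z k = F₀.code k} =
      Set.pi (Finset.Ico a b : Finset ℤ) fun k => {F₀.code k} := by
    ext z; simp [Set.mem_pi]
  rw [h, Measure.infinitePi_pi _ fun _ _ => measurableSet_singleton _, ← h,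
    ← forestLaw_agreeTo hmean hθ hF₀ hw]
  refine measure_mono_ae ?_
  filter_upwards [ae_good hmean hμ θ] with F hF hm
  exact hF.agreeTo_of_code_eq hF₀ hw fun k h1 h2 => hm k (Finset.mem_Ico.2 ⟨h1, h2⟩)

/-- Events on fixed indices are approximated from below by requiring these indices to lie in the
window of level `n`; such events split into disjoint window events, whose probabilities are bounded
one by one. -/
lemma forestLaw_code_eq_on_le (s : Finset ℤ) (x : ℤ → ℕ × Site d) :
    forestLaw μ θ {F | ∀ k ∈ s, F.code k = x k} ≤
      (Measure.infinitePi fun _ : ℤ => labelMeasure μ θ) {z | ∀ k ∈ s, z k = x k} := by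
  set Q := Measure.infinitePi fun _ : ℤ => labelMeasure μ θ
  let p : ℕ → Forest d → Prop := fun n F =>
    F.Good ∧ ∀ k ∈ s, F.code k = x k ∧ IsAncestor (spinePt n) (F.node k)
  have hmono : Monotone fun n => {F | p n F} := by
    intro m n hmn F hF
    exact ⟨hF.1, fun k hk => ⟨(hF.2 k hk).1, (isAncestor_spinePt hmn).trans (hF.2 k hk).2⟩⟩
  have hle : forestLaw μ θ {F | ∀ k ∈ s, F.code k = x k} ≤ forestLaw μ θ (⋃ n, {F | p n F}) := by
    refine measure_mono_ae ?_
    filter_upwards [ae_good hmean hμ θ] with F hF hx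
    refine Set.mem_iUnion.2 ⟨s.sup fun k => (F.node k).1.natAbs, hF, fun k hk => ⟨hx k hk, ?_⟩⟩
    rw [F.isAncestor_spinePt_iff (F.node_mem_verts k)]
    exact Finset.le_sup (f := fun k => (F.node k).1.natAbs) hk
  refine hle.trans ?_
  rw [hmono.measure_iUnion]
  refine iSup_le fun n => ?_
  have hcount := countable_windowEvents n (p n)
  calc forestLaw μ θ {F | p n F}
      ≤ forestLaw μ θ (⋃ C ∈ windowEvents n (p n), {F | F.code ∈ C}) := by
        refine measure_mono fun F hF => ?_
        obtain ⟨C, hC, hm⟩ := hF.1.exists_mem_windowEvents n hF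
        exact Set.mem_biUnion hC hm
    _ ≤ ∑' C : windowEvents n (p n), forestLaw μ θ {F | F.code ∈ C.1} :=
        measure_biUnion_le _ hcount _
    _ ≤ ∑' C : windowEvents n (p n), Q C.1 :=
        ENNReal.tsum_le_tsum fun C => forestLaw_code_mem_le hmean hμ hθ C.2
    _ = Q (⋃ C ∈ windowEvents n (p n), C) :=
        (measure_biUnion hcount (pairwiseDisjoint_windowEvents n (p n))
          fun C hC => measurableSet_of_mem_windowEvents hC).symm
    _ ≤ Q {z | ∀ k ∈ s, z k = x k} := by
        refine measure_mono fun z hz => ?_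
        simp only [Set.mem_iUnion] at hz
        obtain ⟨_, ⟨F, hF, hp, a, b, hw, rfl⟩, hz⟩ := hz
        intro k hk
        obtain ⟨a', b', hw', -, hwin⟩ := hF.exists_window n
        obtain ⟨rfl, rfl⟩ := hw'.unique hw
        rw [hz k (Finset.mem_Ico.2 ((hwin k).1 (hp.2 k hk).2)), (hp.2 k hk).1]

/-- The labels of the vertices, listed by the exploration, are independent. -/
lemma map_code : (forestLaw μ θ).map code =
    Measure.infinitePi fun _ : ℤ => labelMeasure μ θ := by
  have := isProbabilityMeasure_forestLaw hmean θ
  have hP := Measure.isProbabilityMeasure_map (μ := forestLaw μ θ)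
    (measurable_code_seq (d := d)).aemeasurable
  set Q := Measure.infinitePi fun _ : ℤ => labelMeasure μ θ
  have hrestrict : ∀ s : Finset ℤ, ((forestLaw μ θ).map code).map s.restrict =
      Q.map s.restrict := by
    intro s
    have hr : Measurable (s.restrict : (ℤ → ℕ × Site d) → s → ℕ × Site d) :=
      measurable_pi_iff.2 fun _ => measurable_pi_apply _
    have := Measure.isProbabilityMeasure_map (μ := (forestLaw μ θ).map code) hr.aemeasurable
    have := Measure.isProbabilityMeasure_map (μ := Q) hr.aemeasurable
    -- Domination between probability measures is equality, so the upper bounds suffice and nothing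
    -- has to be shown about which sequences are codes.
    refine Measure.eq_of_le_of_isProbabilityMeasure ?_
    refine Measure.le_iff.2 fun T _ => ?_
    rw [← Set.biUnion_of_singleton T,
      measure_biUnion T.to_countable (fun a _ b _ h => Set.disjoint_singleton.2 h)
        fun _ _ => measurableSet_singleton _,
      measure_biUnion T.to_countable (fun a _ b _ h => Set.disjoint_singleton.2 h)
        fun _ _ => measurableSet_singleton _]
    refine ENNReal.tsum_le_tsum fun y => ?_
    classical
    -- The value outside `s` is never read.
    let x : ℤ → ℕ × Site d := fun k => if h : k ∈ s then y.1 ⟨k, h⟩ else 0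
    have hset : (s.restrict : (ℤ → ℕ × Site d) → s → ℕ × Site d) ⁻¹' ({y.1} : Set _) = {z : ℤ → ℕ × Site d | ∀ k ∈ s, z k = x k} := by
      ext z
      simp only [Set.mem_preimage, Set.mem_singleton_iff, Set.mem_ofPred_eq, funext_iff, x]
      constructor
      · intro h k hk
        rw [dif_pos hk, ← h ⟨k, hk⟩]; rfl
      · rintro h ⟨k, hk⟩
        have := h k hk
        rwa [dif_pos hk] at this
    rw [Measure.map_apply hr (measurableSet_singleton _),
      Measure.map_apply hr (measurableSet_singleton _), hset,
      Measure.map_apply measurable_code_seq (measurableSet_eq_on s x)]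
    exact forestLaw_code_eq_on_le hmean hμ hθ s x
  refine IsProjectiveLimit.unique (P := fun s : Finset ℤ => Q.map s.restrict)
    (fun s => hrestrict s) fun s => rfl

/-! ### Invariance and ergodicity -/

lemma forestLaw_eq_of_code {A : Set (Forest d)} {B : Set (ℤ → ℕ × Site d)} (hB : MeasurableSet B)
    (h : ∀ F : Forest d, F.Good → (F ∈ A ↔ F.code ∈ B)) :
    forestLaw μ θ A = (Measure.infinitePi fun _ : ℤ => labelMeasure μ θ) B := by
  rw [← map_code hmean hμ hθ, Measure.map_apply measurable_code_seq hB]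
  refine measure_congr ?_
  filter_upwards [ae_good hmean hμ θ] with F hF
  exact propext (h F hF)

omit hmean hμ hθ in
lemma Good.code_shift_eq {F : Forest d} (hF : F.Good) : F.shift.code = seqShift 1 F.code :=
  funext hF.code_shift

lemma measurePreserving_shift :
    MeasurePreserving Forest.shift (forestLaw μ θ) (forestLaw μ θ) := by
  refine ⟨measurable_shift, Measure.ext fun A hA => ?_⟩
  obtain ⟨B, hB, h⟩ := exists_code_mem_iff hA
  have hS := measurePreserving_seqShift (labelMeasure μ θ) 1
  rw [Measure.map_apply measurable_shift hA, forestLaw_eq_of_code hmean hμ hθ hB h,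
    ← hS.measure_preimage hB.nullMeasurableSet]
  refine forestLaw_eq_of_code hmean hμ hθ (hS.measurable hB) fun F hF => ?_
  rw [Set.mem_preimage, Set.mem_preimage, h _ hF.shift, hF.code_shift_eq]

/-- An invariant event corresponds to a set of codes that is invariant only almost surely, as the
correspondence needs good forests; the zero-one law is stated accordingly. -/
theorem ergodic_shift : Ergodic Forest.shift (forestLaw μ θ) := by
  have := isProbabilityMeasure_forestLaw hmean θ
  refine ⟨measurePreserving_shift hmean hμ hθ, ⟨fun A hA hinv => ?_⟩⟩
  obtain ⟨B, hB, h⟩ := exists_code_mem_iff hA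
  have hS := measurePreserving_seqShift (labelMeasure μ θ) 1
  have hBinv : seqShift 1 ⁻¹' B =ᵐ[Measure.infinitePi fun _ : ℤ => labelMeasure μ θ] B := by
    have hm : MeasurableSet {z : ℤ → ℕ × Site d | z ∈ seqShift 1 ⁻¹' B ↔ z ∈ B} :=
      measurableSet_setOfPred.2 ((measurableSet_setOfPred.1 (hS.measurable hB)).iff
        (measurableSet_setOfPred.1 hB))
    have key : ∀ᵐ z ∂(Measure.infinitePi fun _ : ℤ => labelMeasure μ θ),
        (z ∈ seqShift 1 ⁻¹' B ↔ z ∈ B) := by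
      rw [← map_code hmean hμ hθ, ae_map_iff measurable_code_seq.aemeasurable hm]
      filter_upwards [ae_good hmean hμ θ] with F hF
      rw [Set.mem_preimage, ← hF.code_shift_eq, ← h _ hF.shift, ← h _ hF, ← Set.mem_preimage, hinv]
    filter_upwards [key] with z hz
    exact propext hz
  rw [Filter.eventuallyConst_set]
  rcases infinitePi_eq_zero_or_one_of_invariant _ hB hBinv with h0 | h0
  · rw [← forestLaw_eq_of_code hmean hμ hθ hB h] at h0
    exact Or.inr (measure_eq_zero_iff_ae_notMem.1 h0)
  · rw [← forestLaw_eq_of_code hmean hμ hθ hB h] at h0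
    exact Or.inl ((prob_compl_eq_zero_iff hA).2 h0)

/-! ### Stationarity of the positions -/

omit hmean hμ hθ in
lemma Good.X_zero {F : Forest d} (hF : F.Good) : F.X 0 = 0 := by
  rw [X, hF.isEnum.zero, pos_base]

omit hmean hμ hθ in
lemma Good.iterate_shift {F : Forest d} (hF : F.Good) (m : ℕ) :
    (Forest.shift^[m] F).Good ∧ ∀ j, (Forest.shift^[m] F).X j = F.X (j + m) - F.X m := by
  induction m with
  | zero => exact ⟨hF, fun j => by simp [hF.X_zero]⟩
  | succ m ih =>
    rw [Function.iterate_succ_apply']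
    refine ⟨ih.1.shift, fun j => ?_⟩
    rw [ih.1.X_shift, ih.2, ih.2, sub_sub_sub_cancel_right, add_assoc, add_comm (1 : ℤ)]
    push_cast
    rfl

lemma identDistrib_increments (i : ℤ) (n : ℕ) : IdentDistrib
    (fun (F : Forest d) (k : Fin (n + 1)) => F.X (i + (k : ℤ)) - F.X i)
    (fun (F : Forest d) (k : Fin (n + 1)) => F.X (k : ℤ)) (forestLaw μ θ) (forestLaw μ θ) := by
  have hmp := fun m : ℕ => (measurePreserving_shift hmean hμ hθ).iterate m
  have hf : Measurable fun (F : Forest d) (k : Fin (n + 1)) => F.X (i + (k : ℤ)) - F.X i :=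
    measurable_pi_iff.2 fun k => (measurable_X _).sub (measurable_X _)
  have hg : Measurable fun (F : Forest d) (k : Fin (n + 1)) => F.X (k : ℤ) :=
    measurable_pi_iff.2 fun k => measurable_X _
  have comp : ∀ (m : ℕ) {g : Forest d → Fin (n + 1) → Site d}, Measurable g →
      IdentDistrib (g ∘ Forest.shift^[m]) g (forestLaw μ θ) (forestLaw μ θ) := by
    intro m g hg
    refine ⟨(hg.comp (hmp m).measurable).aemeasurable, hg.aemeasurable, ?_⟩
    rw [← Measure.map_map hg (hmp m).measurable, (hmp m).map_eq]
  rcases le_total 0 i with hi | hi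
  · obtain ⟨m, rfl⟩ := Int.eq_ofNat_of_zero_le hi
    refine (IdentDistrib.of_ae_eq hf.aemeasurable ?_).trans (comp m hg)
    filter_upwards [ae_good hmean hμ θ] with F hF
    funext k
    simp only [Function.comp_apply, (hF.iterate_shift m).2, add_comm]
  · obtain ⟨m, hm⟩ := Int.eq_ofNat_of_zero_le (neg_nonneg.2 hi)
    obtain rfl : i = -(m : ℤ) := by omega
    -- For negative `i` the shift goes the other way: `m` shifts carry the increments from `-m` onto
    -- the positions from `0`.
    refine ((IdentDistrib.of_ae_eq hg.aemeasurable ?_).trans (comp m hf)).symm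
    filter_upwards [ae_good hmean hμ θ] with F hF
    funext k
    simp only [Function.comp_apply, (hF.iterate_shift m).2, sub_sub_sub_cancel_right,
      neg_add_cancel, hF.X_zero, sub_zero]
    congr 1; ring

/-- The centred range is a function of the vector of increments, with which equality in law is
inherited. -/
lemma identDistrib_range (i : ℤ) (n : ℕ) : IdentDistrib
    (fun F : Forest d => (F.range i (i + n)).image (fun x => x - F.X i))
    (fun F : Forest d => F.range 0 n) (forestLaw μ θ) (forestLaw μ θ) := by
  have h := (identDistrib_increments hmean hμ hθ i n).comp
    (u := fun y : Fin (n + 1) → Site d => Finset.univ.image y) Measurable.of_discrete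
  have hIcc : ∀ j : ℤ, Finset.Icc j (j + n) =
      Finset.univ.image fun k : Fin (n + 1) => j + ((k : ℕ) : ℤ) := by
    intro j
    ext l
    simp only [Finset.mem_Icc, Finset.mem_image, Finset.mem_univ, true_and]
    constructor
    · rintro ⟨h1, h2⟩
      exact ⟨⟨(l - j).toNat, by omega⟩, by simp only; omega⟩
    · rintro ⟨k, rfl⟩
      have := k.2
      omega
  have h1 : (fun F : Forest d => (F.range i (i + n)).image fun x => x - F.X i) =
      (fun y : Fin (n + 1) → Site d => Finset.univ.image y) ∘
        fun (F : Forest d) (k : Fin (n + 1)) => F.X (i + (k : ℤ)) - F.X i := by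
    funext F
    simp only [range, hIcc, Finset.image_image, Function.comp_def]
  have h2 : (fun F : Forest d => F.range 0 n) =
      (fun y : Fin (n + 1) → Site d => Finset.univ.image y) ∘
        fun (F : Forest d) (k : Fin (n + 1)) => F.X (k : ℤ) := by
    funext F
    have := hIcc 0
    simp only [zero_add] at this
    simp only [range, this, Finset.image_image, Function.comp_def]
  rw [h1, h2]
  exact h

end Law

end Forest

end SpineForest

end

theorem mainTheorem7 (d : ℕ) (μ : PMF ℕ) (hmean : ∑' k : ℕ, (k : ENNReal) * μ k = 1)
    (hμ : μ ≠ PMF.pure 1) (θ : PMF (SpineForest.Site d)) (hθ : ∀ x, θ (-x) = θ x) :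
    MeasureTheory.IsProbabilityMeasure (SpineForest.forestLaw μ θ) ∧
    -- the lexicographic exploration lists all the vertices as `…, v_{-1}, v_0, v_1, …`
    (∀ᵐ F ∂(SpineForest.forestLaw μ θ),
      (∀ i j : ℤ, i < j → SpineForest.Before (F.node i) (F.node j)) ∧
      Set.range F.node = F.verts ∧ F.node 0 = SpineForest.base) ∧
    -- the shift acts on vertices by `v_i ↦ v_{i+1}` (as an isomorphism of rooted trees) and on
    -- positions by `X_i ↦ X_{i+1} - X_1`
    (∀ᵐ F ∂(SpineForest.forestLaw μ θ),
      (∀ i j : ℤ, SpineForest.parent (F.shift.node i) = F.shift.node j ↔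
        SpineForest.parent (F.node (i + 1)) = F.node (j + 1)) ∧
      ∀ i : ℤ, F.shift.X i = F.X (i + 1) - F.X 1) ∧
    Ergodic SpineForest.Forest.shift (SpineForest.forestLaw μ θ) ∧
    (∀ (i : ℤ) (n : ℕ), ProbabilityTheory.IdentDistrib
      (fun (F : SpineForest.Forest d) (k : Fin (n + 1)) => F.X (i + (k : ℤ)) - F.X i)
      (fun (F : SpineForest.Forest d) (k : Fin (n + 1)) => F.X (k : ℤ))
      (SpineForest.forestLaw μ θ) (SpineForest.forestLaw μ θ)) ∧
    (∀ (i : ℤ) (n : ℕ), ProbabilityTheory.IdentDistrib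
      (fun F : SpineForest.Forest d => (F.range i (i + n)).image (fun x => x - F.X i))
      (fun F : SpineForest.Forest d => F.range 0 n)
      (SpineForest.forestLaw μ θ) (SpineForest.forestLaw μ θ)) := by
  have hgood := SpineForest.Forest.ae_good hmean hμ θ
  refine ⟨SpineForest.isProbabilityMeasure_forestLaw hmean θ, ?_, ?_,
    SpineForest.Forest.ergodic_shift hmean hμ hθ,
    SpineForest.Forest.identDistrib_increments hmean hμ hθ,
    SpineForest.Forest.identDistrib_range hmean hμ hθ⟩
  · filter_upwards [hgood] with F hF
    exact ⟨hF.isEnum.before, hF.isEnum.range_eq, hF.isEnum.zero⟩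
  · filter_upwards [hgood] with F hF
    exact ⟨hF.parent_shift_node_iff, hF.X_shift⟩
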